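/- **Plant.** Let $n,m\ge 1$, $A\in\mathbb R^{n\times n}$, $B\in\mathbb R^{n\times 1}$, $C_X\in\mathbb R^{1\times n}$, $q>0$, $\bar a_1,\dots,\bar a_m\in\mathbb R$, and consider on $(x,t)\in[0,1]\times[0,\infty)$ $$\dot X=AX+Bu_x(0,t),\quad u_t=q\,u_{xx},\quad u(0,t)=C_XX(t),\quad u(1,t)=C_zZ(t),\quad \dot Z=A_zZ+B_zU(t),$$ where $A_z$ is the $m\times m$ companion matrix with ones on the superdiagonal and last row $(\bar a_1,\dots,\bar a_m)$, $B_z=(0,\dots,0,1)^T$, $C_z=(1,0,\dots,0)$. Let $K\in\mathbb R^{1\times n}$ be such that $A+BK$ is Hurwitz (such a $K$ exists if $(A,B)$ is controllable). **Kernels.** Put $$\Phi(x)=\big[C_X,\;K-\tfrac1qC_XBC_X\big]e^{Dx}\begin{bmatrix}I\\0\end{bmatrix},\quad \phi(x,y)=\tfrac1q\Phi(x-y)B,\quad D=\begin{pmatrix}0&A/q\\ I&-BC_X/q\end{pmatrix},$$ $$\Gamma(x)=-\big[C_X,\;K\big]e^{Ex}\begin{bmatrix}I\\0\end{bmatrix},\quad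 \psi(x,y)=\tfrac1q\Gamma(x-y)B,\quad E=\begin{pmatrix}0&(A+BK)/q\\ I&0\end{pmatrix},$$ so that $w(x)=u(x)-\int_0^x\phi(x,y)u(y)\,dy-\Phi(x)X$ has the inverse $u(x)=w(x)-\int_0^x\psi(x,y)w(y)\,dy-\Gamma(x)X$. Let $\chi_{k,j}$ be the coefficients in $\partial_x^k\int_0^x\psi(x,y)w(y)\,dy=\int_0^x\partial_x^k\psi(x,y)w(y)\,dy+\sum_{j=0}^{k-1}\chi_{k,j}(x)\,\partial_x^{k-j-1}w(x)$, obtained by successive differentiation, and for $x_0\in\{0,1\}$ put $\mathcal I_{k,x_0}=\partial_x^k-\sum_{j=0}^{k-1}\chi_{k,j}(x_0)\,\partial_x^{k-j-1}$. **Control law.** Define differential operators in $x$ with constant coefficients $$\mathcal B=\bar a_1+\sum_{k=1}^{m-1}\bar a_{k+1}q^k\mathcal I_{2k,1}+q^m\sum_{i=1}^{2m}(-1)^i\,\partial_y^{i-1}\phi(1,1)\,\mathcal I_{2m-i,1},$$ $$\mathcal C=-q^m\sum_{i=1}^{2m}(-1)^i\,\partial_y^{i-1}\phi(1,0)\,\mathcal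 I_{2m-i,0}-\Phi(1)\sum_{i=1}^mA^{i-1}B\,q^{m-i}\,\mathcal I_{2(m-i)+1,0}.$$ For gains $c_1,\dots,c_m>0$ put formally $y_0=0$, $\tau_0=0$, $y_i=\partial_t^{i-1}w(1,t)+\tau_{i-1}$, $\tau_i=\dot\tau_{i-1}+y_{i-1}+c_iy_i$, write $y_{m-1}+\dot\tau_{m-1}=\sum_{i=0}^{m-1}\alpha_i\,\partial_t^iw(1,t)$ and $y_m=\sum_{i=0}^{m-1}\beta_i\,\partial_t^iw(1,t)$, where $\alpha_i,\beta_i$ depend only on $c_1,\dots,c_{m-1}$, and let $\mathcal L=-\mathcal B-\sum_{i=0}^{m-1}q^i(\alpha_i+c_m\beta_i)\,\partial_x^{2i}$. The control law is $$U(t)=\mathcal Lu(1,t)-\big(\mathcal L\Phi(1)-\mathcal C\Phi(0)\big)X(t)-\mathcal Cu(0,t)-\Big(\mathcal L\!\int_0^x\!\phi(x,y)u(y,t)\,dy\Big)\Big|_{x=1}+\Big(\mathcal C\!\int_0^x\!\phi(x,y)u(y,t)\,dy\Big)\Big|_{x=0}.$$ **Solutions.** A closed-loop solution is a triple $(u,X,Z)$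 with $u\in C([0,\infty);H^{2m}(0,1))\cap C^1([0,\infty);L^2(0,1))$ and $X,Z$ differentiable on $[0,\infty)$ (one-sidedly at $0$) that satisfies the plant equations for all $t\ge0$ (the heat equation as an identity in $L^2(0,1)$) with $U(t)$ given by the control law. In particular $u(\cdot,0)\in H^{2m}(0,1)$. **Theorem.** For all $c_1,\dots,c_{m-1}>0$ there is $c^*>0$ such that for every $c_m>c^*$ there is $\lambda_{sf}>0$ with the following property: for all initial data $(u_0,X_0,Z_0)$ there is a constant $\Upsilon_{sf}>0$, depending (for the given plant and gains) only on $(u_0,X_0,Z_0)$, such that every closed-loop solution with $u(\cdot,0)=u_0$ on $[0,1]$, $X(0)=X_0$, $Z(0)=Z_0$ satisfies, for all $t\ge 0$, $$|U(t)|\le\Upsilon_{sf}\qquad\text{and}\qquad|U(t)|\le\Upsilon_{sf}\,e^{-\lambda_{sf}t}.$$ -/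

import Mathlib

open Set Filter Topology MeasureTheory
open scoped Matrix

noncomputable section

namespace Sandwich

/-! ### Plant data -/

/-- Coefficients of the ODE-PDE-ODE plant
`X' = A X + B u_x(0,t)`, `u_t = q u_xx`, `u(0,t) = C_X X`, `u(1,t) = C_z Z`, `Z' = A_z Z + B_z U`.
The column `B` and the row `C_X` are plain vectors; `a` is the last row of the companion matrix
`A_z` (so `a k` is the entry usually written with the index `k + 1`). -/
structure Plant (n m : ℕ) where
  A : Matrix (Fin n) (Fin n) ℝ
  B : Fin n → ℝ
  CX : Fin n → ℝ
  q : ℝ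
  a : Fin m → ℝ

variable {n m : ℕ}

/-- Companion matrix of the input ODE. -/
def Plant.Az (P : Plant n m) : Matrix (Fin m) (Fin m) ℝ := fun i j =>
  if i.val + 1 = m then P.a j else if j.val = i.val + 1 then 1 else 0

/-- `B_z = (0, …, 0, 1)ᵀ`. -/
def Bz (m : ℕ) : Fin m → ℝ := fun i => if i.val + 1 = m then 1 else 0

/-- `C_z = (1, 0, …, 0)`. -/
def Cz (m : ℕ) : Fin m → ℝ := fun i => if i.val = 0 then 1 else 0

/-- The matrix `A + B K` of the target ODE. -/
def Plant.AK (P : Plant n m) (K : Fin n → ℝ) : Matrix (Fin n) (Fin n) ℝ :=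
  P.A + Matrix.vecMulVec P.B K

/-- A real square matrix is Hurwitz if all its complex eigenvalues have negative real part. -/
def IsHurwitz (M : Matrix (Fin n) (Fin n) ℝ) : Prop :=
  ∀ z ∈ spectrum ℂ (M.map (algebraMap ℝ ℂ)), z.re < 0

/-! ### Backstepping kernels

The direct transformation is `w(x) = u(x) - ∫₀ˣ φ(x,y) u(y) dy - Φ(x) X`, the inverse one is
`u(x) = w(x) - ∫₀ˣ ψ(x,y) w(y) dy - Γ(x) X`. -/

/-- The block matrix with `Φ'' = Φ A / q - Φ' B C_X / q`, i.e. `(Φ, Φ')' = (Φ, Φ') D`. -/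
def Plant.D (P : Plant n m) : Matrix (Fin n ⊕ Fin n) (Fin n ⊕ Fin n) ℝ :=
  Matrix.fromBlocks 0 (P.q⁻¹ • P.A) 1 (-(P.q⁻¹ • Matrix.vecMulVec P.B P.CX))

/-- The block matrix with `Γ'' = Γ (A + B K) / q`, i.e. `(Γ, Γ')' = (Γ, Γ') E`. -/
def Plant.E (P : Plant n m) (K : Fin n → ℝ) : Matrix (Fin n ⊕ Fin n) (Fin n ⊕ Fin n) ℝ :=
  Matrix.fromBlocks 0 (P.q⁻¹ • P.AK K) 1 0

/-- `Φ(x) = [C_X, K - C_X B C_X / q] e^{D x} [I; 0]`. -/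
def Plant.Phi (P : Plant n m) (K : Fin n → ℝ) (x : ℝ) : Fin n → ℝ := fun j =>
  (Sum.elim P.CX (K - (P.q⁻¹ * (P.CX ⬝ᵥ P.B)) • P.CX) ᵥ* NormedSpace.exp (x • P.D)) (Sum.inl j)

/-- `φ(x,y) = Φ(x - y) B / q`. -/
def Plant.phi (P : Plant n m) (K : Fin n → ℝ) (x y : ℝ) : ℝ :=
  P.q⁻¹ * (P.Phi K (x - y) ⬝ᵥ P.B)

/-- `Γ(x) = -[C_X, K] e^{E x} [I; 0]`. -/
def Plant.Gam (P : Plant n m) (K : Fin n → ℝ) (x : ℝ) : Fin n → ℝ := fun j =>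
  -(Sum.elim P.CX K ᵥ* NormedSpace.exp (x • P.E K)) (Sum.inl j)

/-- `ψ(x,y) = Γ(x - y) B / q`. -/
def Plant.psi (P : Plant n m) (K : Fin n → ℝ) (x y : ℝ) : ℝ :=
  P.q⁻¹ * (P.Gam K (x - y) ⬝ᵥ P.B)

/-! ### The boundary operators `𝓑`, `𝓒` and the feedback law -/

/-- `∂ₓᵏ f` on `[0,1]`, one-sided at the end points. -/
def dx (k : ℕ) (f : ℝ → ℝ) : ℝ → ℝ := iteratedDerivWithin k f (Icc 0 1)

/-- The coefficients `χ_{k_j}(x)` in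
`∂ₓᵏ ∫₀ˣ ψ(x,y) w(y) dy = ∫₀ˣ ∂ₓᵏψ(x,y) w(y) dy + ∑_{j<k} χ_{k_j}(x) ∂ₓ^{k-j-1} w(x)`,
generated by differentiating this formula once more; `χ_{k_j} = 0` for `k ≤ j`. -/
def chi (ψ : ℝ → ℝ → ℝ) : ℕ → ℕ → ℝ → ℝ
  | 0, _ => fun _ => 0
  | k + 1, j => fun x =>
      (if j = k then iteratedDeriv k (fun x' => ψ x' x) x else chi ψ k j x)
        + (if j = 0 then 0 else deriv (chi ψ k (j - 1)) x)

/-- The part of `∂ₓᵏ u(x)` (with `u` written in terms of `w` by the inverse transformation)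
that consists of point values at `x` of derivatives of `w`, with coefficients frozen at `x₀`:
`∂ₓᵏ w(x) - ∑_{j<k} χ_{k_j}(x₀) ∂ₓ^{k-j-1} w(x)`. -/
def Plant.invD (P : Plant n m) (K : Fin n → ℝ) (k : ℕ) (x₀ : ℝ) (f : ℝ → ℝ) (x : ℝ) : ℝ :=
  dx k f x - ∑ j ∈ Finset.range k, chi (P.psi K) k j x₀ * dx (k - j - 1) f x

/-- `∂_y^k φ(x,y)`. -/
def Plant.dyPhi (P : Plant n m) (K : Fin n → ℝ) (k : ℕ) (x y : ℝ) : ℝ :=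
  iteratedDeriv k (fun y' => P.phi K x y') y

/-- The differential operator `𝓑`, acting on a function of `x ∈ [0,1]`. -/
def Plant.opB (P : Plant n m) (K : Fin n → ℝ) (f : ℝ → ℝ) (x : ℝ) : ℝ :=
  (∑ k : Fin m, P.a k * P.q ^ (k : ℕ) * P.invD K (2 * k) 1 f x)
    + P.q ^ m * ∑ i ∈ Finset.Icc 1 (2 * m),
        (-1) ^ i * P.dyPhi K (i - 1) 1 1 * P.invD K (2 * m - i) 1 f x

/-- The differential operator `𝓒`, acting on a function of `x ∈ [0,1]`. -/
def Plant.opC (P : Plant n m) (K : Fin n → ℝ) (f : ℝ → ℝ) (x : ℝ) : ℝ :=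
  -(P.q ^ m * ∑ i ∈ Finset.Icc 1 (2 * m),
        (-1) ^ i * P.dyPhi K (i - 1) 1 0 * P.invD K (2 * m - i) 0 f x)
    - ∑ i ∈ Finset.Icc 1 m,
        (P.Phi K 1 ⬝ᵥ (P.A ^ (i - 1) *ᵥ P.B)) * P.q ^ (m - i) *
          P.invD K (2 * (m - i) + 1) 0 f x

/-- The virtual controls `τ_i` as polynomials in `∂_t` applied to `w(1,t)`:
`τ_0 = 0`, `τ_1 = c_1 y_1`, `τ_i = ∂_t τ_{i-1} + y_{i-1} + c_i y_i`,
where `y_i = ∂_t^{i-1} w(1,t) + τ_{i-1}`. -/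
def tau (c : ℕ → ℝ) : ℕ → Polynomial ℝ
  | 0 => 0
  | 1 => Polynomial.C (c 1)
  | i + 2 => Polynomial.X * tau c (i + 1) + (Polynomial.X ^ i + tau c i)
      + Polynomial.C (c (i + 2)) * (Polynomial.X ^ (i + 1) + tau c (i + 1))

/-- The states `y_i = ∂_t^{i-1} w(1,t) + τ_{i-1}` as polynomials in `∂_t`, with `y_0 = 0`. -/
def yPoly (c : ℕ → ℝ) : ℕ → Polynomial ℝ
  | 0 => 0
  | i + 1 => Polynomial.X ^ i + tau c i

/-- `α_i`, from `y_{m-1} + ∂_t τ_{m-1} = ∑_{i<m} α_i ∂_t^i w(1,t)`. -/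
def alpha (m : ℕ) (c : ℕ → ℝ) (i : ℕ) : ℝ :=
  (yPoly c (m - 1) + Polynomial.X * tau c (m - 1)).coeff i

/-- `β_i`, from `y_m = ∑_{i<m} β_i ∂_t^i w(1,t)`. -/
def beta (m : ℕ) (c : ℕ → ℝ) (i : ℕ) : ℝ := (yPoly c m).coeff i

/-- `𝓛 = -𝓑 - ∑_{i<m} q^i (α_i + c_m β_i) ∂ₓ^{2i}`; `c` supplies `c_1, …, c_{m-1}`. -/
def Plant.opL (P : Plant n m) (K : Fin n → ℝ) (c : ℕ → ℝ) (cm : ℝ) (f : ℝ → ℝ) (x : ℝ) : ℝ :=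
  -P.opB K f x
    - ∑ i ∈ Finset.range m, P.q ^ i * (alpha m c i + cm * beta m c i) * dx (2 * i) f x

/-- `x ↦ ∫₀ˣ φ(x,y) f(y) dy`. -/
def Plant.volt (P : Plant n m) (K : Fin n → ℝ) (f : ℝ → ℝ) (x : ℝ) : ℝ :=
  ∫ y in (0 : ℝ)..x, P.phi K x y * f y

/-- The state-feedback law, evaluated at the state `(f, ξ) = (u(·,t), X(t))`:
`𝓛u(1) - (𝓛Φ(1) - 𝓒Φ(0)) X - 𝓒u(0) - 𝓛∫φu (1) + 𝓒∫φu (0)`. -/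
def Plant.feedback (P : Plant n m) (K : Fin n → ℝ) (c : ℕ → ℝ) (cm : ℝ)
    (f : ℝ → ℝ) (ξ : Fin n → ℝ) : ℝ :=
  P.opL K c cm f 1
    - (fun j => P.opL K c cm (fun x => P.Phi K x j) 1 - P.opC K (fun x => P.Phi K x j) 0) ⬝ᵥ ξ
    - P.opC K f 0
    - P.opL K c cm (P.volt K f) 1
    + P.opC K (P.volt K f) 0

/-! ### Solutions of the closed loop -/

/-- Lebesgue measure on `[0,1]`. -/
def unitMeasure : Measure ℝ := volume.restrict (Icc 0 1)

/-- `f ∈ H^k(0,1)` (continuous representative when `k ≥ 1`): `f` is `C^{k-1}` on `[0,1]`,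
`∂ₓ^{k-1} f` is absolutely continuous, and its a.e. derivative is square integrable. -/
def MemH : ℕ → (ℝ → ℝ) → Prop
  | 0, f => MemLp f 2 unitMeasure
  | k + 1, f => ContDiffOn ℝ k f (Icc 0 1) ∧ AbsolutelyContinuousOnInterval (dx k f) 0 1 ∧
      MemLp (dx (k + 1) f) 2 unitMeasure

/-- `(u, X, Z, U)` is a strong solution on `[0,∞)` of the plant under the feedback law:
`u ∈ C([0,∞); H^{2m}(0,1)) ∩ C¹([0,∞); L²(0,1))`, the ODEs and boundary conditions hold for all
`t ≥ 0`, and `U(t)` is the feedback law. -/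
structure Plant.IsClosedLoopSolution (P : Plant n m) (K : Fin n → ℝ) (c : ℕ → ℝ) (cm : ℝ)
    (u : ℝ → ℝ → ℝ) (X : ℝ → Fin n → ℝ) (Z : ℝ → Fin m → ℝ) (U : ℝ → ℝ) : Prop where
  memH : ∀ t, 0 ≤ t → MemH (2 * m) (fun x => u x t)
  continuous_H : ∀ t, 0 ≤ t → ∀ i ≤ 2 * m,
    Tendsto (fun s => eLpNorm (fun x => dx i (fun y => u y s) x - dx i (fun y => u y t) x)
      2 unitMeasure) (𝓝[Ici 0] t) (𝓝 0)
  heat : ∀ t, 0 ≤ t →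
    Tendsto (fun s => eLpNorm
      (fun x => (s - t)⁻¹ * (u x s - u x t) - P.q * dx 2 (fun y => u y t) x)
      2 unitMeasure) (𝓝[Ici 0 \ {t}] t) (𝓝 0)
  odeX : ∀ t, 0 ≤ t →
    HasDerivWithinAt X (P.A *ᵥ X t + dx 1 (fun y => u y t) 0 • P.B) (Ici 0) t
  odeZ : ∀ t, 0 ≤ t → HasDerivWithinAt Z (P.Az *ᵥ Z t + U t • Bz m) (Ici 0) t
  left : ∀ t, 0 ≤ t → u 0 t = P.CX ⬝ᵥ X t
  right : ∀ t, 0 ≤ t → u 1 t = Cz m ⬝ᵥ Z t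
  control : ∀ t, 0 ≤ t → U t = P.feedback K c cm (fun x => u x t) (X t)

end Sandwich

end

open Set Filter Topology MeasureTheory
open scoped Matrix

noncomputable section

namespace Sandwich

/-! The backstepping variable w = u - ∫φu - ΦX satisfies the heat equation with w(0,t) = 0, and X' =
(A + BK)X + B w_x(0,t) (`IsReduced.heatJet_wJet`, `IsReduced.odeX_wJet`). With A + BK Hurwitz, this
system is driven only by its boundary value w(1,t). Since Z consists of time derivatives of u(1,t),
the control enters the m-th time derivative of w(1,t). The operators 𝓑 and 𝓒 are designed to cancel
there all traces of u of high order (`IsReduced.boundary_identity`). What is left is ∂_t^m w(1,t) =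
G - ∑ (α_i + c_m β_i) ∂_t^i w(1,t), where the perturbation G (`distG`) is bounded by sup |w| + |X|
up to a constant and does not involve c_m. In the coordinates y_i this is a chain with skew
couplings, damping c_i, and G in the last equation.

The loop is closed by a small-gain argument with exponential weights. If |w(1,s)| ≤ S e^{-λs}, with
S above the size of the initial data, then the maximum principle gives the same bound for w and
twice it for w_x(0,·). The Hurwitz estimate then bounds X, so |G| ≤ C S e^{-λt} with C independent
of c_m (`IsTarget.abs_distG_le`). In the Lyapunov estimate for ∑ y_i² the perturbation enters only
divided by λ c_m (`sum_sq_le_of_chain`), so a large c_m absorbs it (`IsTarget.sum_sq_yPoly_le`).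

The control is a fixed linear combination of the traces of ∂ₓᵏ w, k < 2m, at the two ends
(`IsClosedLoopSolution.control_eq`). Even traces at x = 1 are time derivatives of w(1,t), and even
traces at x = 0 vanish. Odd traces are controlled by quadratic barriers for the even derivatives,
each of which again satisfies the heat equation with zero value at x = 0 (`IsTarget.abs_traces_le`).

An H^{2m} solution has only 2m - 1 continuous x-derivatives, so the even derivative of order 2m - 2
need not satisfy the heat equation pointwise. The equation is therefore kept in the form integrated
over [0,x] (`HeatJet`), and the maximum principle is applied to averages over short time windows. -/

variable {n m : ℕ}

/-! ### Derivatives of the kernels -/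

/-- The `k`-th derivative of `x ↦ r e^{x M}`. -/
def expRow {ι : Type*} [Fintype ι] [DecidableEq ι] (r : ι → ℝ) (M : Matrix ι ι ℝ) (k : ℕ) (x : ℝ) :
    ι → ℝ :=
  (r ᵥ* M ^ k) ᵥ* NormedSpace.exp (x • M)

section
attribute [local instance] Matrix.linftyOpNormedRing Matrix.linftyOpNormedAlgebra

theorem hasDerivAt_exp_smul_matrix {ι : Type*} [Fintype ι] [DecidableEq ι] (M : Matrix ι ι ℝ)
    (x : ℝ) : HasDerivAt (fun x : ℝ => NormedSpace.exp (x • M))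
      (M * NormedSpace.exp (x • M)) x :=
  hasDerivAt_exp_smul_const' M x
end

section ExpRow

variable {ι : Type*} [Fintype ι] [DecidableEq ι] (r : ι → ℝ) (M : Matrix ι ι ℝ)

theorem hasDerivAt_expRow (k : ℕ) (x : ℝ) (i : ι) :
    HasDerivAt (fun x => expRow r M k x i) (expRow r M (k + 1) x i) x := by
  have h := hasDerivAt_exp_smul_matrix M x
  have h2 : ∀ a b, HasDerivAt (fun x : ℝ => NormedSpace.exp (x • M) a b)
      ((M * NormedSpace.exp (x • M)) a b) x := fun a b =>
    hasDerivAt_pi.1 (hasDerivAt_pi.1 h a) b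
  have h3 : expRow r M (k + 1) x i
      = ∑ a, (r ᵥ* M ^ k) a * (M * NormedSpace.exp (x • M)) a i := by
    unfold expRow
    rw [pow_succ, ← Matrix.vecMul_vecMul, Matrix.vecMul_vecMul]
    rfl
  rw [h3]
  exact HasDerivAt.fun_sum fun a _ => (h2 a i).const_mul _

theorem expRow_succ (k : ℕ) (x : ℝ) : expRow r M (k + 1) x = expRow r M k x ᵥ* M := by
  have hc : Commute M (NormedSpace.exp (x • M)) :=
    ((Commute.refl M).smul_right x).exp_right
  unfold expRow
  rw [pow_succ, ← Matrix.vecMul_vecMul, Matrix.vecMul_vecMul, hc.eq, ← Matrix.vecMul_vecMul]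

theorem expRow_zero_right (k : ℕ) : expRow r M k 0 = r ᵥ* M ^ k := by
  simp [expRow]

end ExpRow

variable (P : Plant n m) (K : Fin n → ℝ)

/-- The `k`-th derivative of `Φ`. -/
def Plant.PhiD (k : ℕ) (x : ℝ) : Fin n → ℝ := fun j =>
  expRow (Sum.elim P.CX (K - (P.q⁻¹ * (P.CX ⬝ᵥ P.B)) • P.CX)) P.D k x (Sum.inl j)

/-- The `k`-th derivative of `Γ`. -/
def Plant.GamD (k : ℕ) (x : ℝ) : Fin n → ℝ := fun j =>
  -expRow (Sum.elim P.CX K) (P.E K) k x (Sum.inl j)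

/-- The `k`-th derivative of `s ↦ Φ(s) B / q`. -/
def Plant.phiD (k : ℕ) (x : ℝ) : ℝ := P.q⁻¹ * (P.PhiD K k x ⬝ᵥ P.B)

/-- The `k`-th derivative of `s ↦ Γ(s) B / q`. -/
def Plant.psiD (k : ℕ) (x : ℝ) : ℝ := P.q⁻¹ * (P.GamD K k x ⬝ᵥ P.B)

theorem Plant.PhiD_zero (x : ℝ) : P.PhiD K 0 x = P.Phi K x := by
  funext j; simp [Plant.PhiD, Plant.Phi, expRow]

theorem Plant.GamD_zero (x : ℝ) : P.GamD K 0 x = P.Gam K x := by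
  funext j; simp [Plant.GamD, Plant.Gam, expRow]

theorem Plant.phi_eq (x y : ℝ) : P.phi K x y = P.phiD K 0 (x - y) := by
  simp [Plant.phi, Plant.phiD, Plant.PhiD_zero]

theorem Plant.psi_eq (x y : ℝ) : P.psi K x y = P.psiD K 0 (x - y) := by
  simp [Plant.psi, Plant.psiD, Plant.GamD_zero]

theorem Plant.hasDerivAt_PhiD (k : ℕ) (x : ℝ) (j : Fin n) :
    HasDerivAt (fun x => P.PhiD K k x j) (P.PhiD K (k + 1) x j) x :=
  hasDerivAt_expRow _ _ _ _ _

theorem Plant.hasDerivAt_GamD (k : ℕ) (x : ℝ) (j : Fin n) :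
    HasDerivAt (fun x => P.GamD K k x j) (P.GamD K (k + 1) x j) x :=
  (hasDerivAt_expRow _ _ _ _ _).neg

theorem hasDerivAt_dotProduct_const {v : ℝ → Fin n → ℝ} {v' : Fin n → ℝ} {x : ℝ} {s : Set ℝ}
    (h : ∀ j, HasDerivWithinAt (fun x => v x j) (v' j) s x) (b : Fin n → ℝ) :
    HasDerivWithinAt (fun x => v x ⬝ᵥ b) (v' ⬝ᵥ b) s x :=
  HasDerivWithinAt.fun_sum fun j _ => (h j).mul_const _

theorem Plant.hasDerivAt_phiD (k : ℕ) (x : ℝ) :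
    HasDerivAt (P.phiD K k) (P.phiD K (k + 1) x) x :=
  (HasDerivAt.fun_sum fun j _ => (P.hasDerivAt_PhiD K k x j).mul_const (P.B j)).const_mul _

theorem Plant.hasDerivAt_psiD (k : ℕ) (x : ℝ) :
    HasDerivAt (P.psiD K k) (P.psiD K (k + 1) x) x :=
  (HasDerivAt.fun_sum fun j _ => (P.hasDerivAt_GamD K k x j).mul_const (P.B j)).const_mul _

@[fun_prop]
theorem Plant.continuous_PhiD (k : ℕ) : Continuous (P.PhiD K k) :=
  continuous_pi fun j => continuous_iff_continuousAt.2 fun x =>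
    (P.hasDerivAt_PhiD K k x j).continuousAt

@[fun_prop]
theorem Plant.continuous_GamD (k : ℕ) : Continuous (P.GamD K k) :=
  continuous_pi fun j => continuous_iff_continuousAt.2 fun x =>
    (P.hasDerivAt_GamD K k x j).continuousAt

@[fun_prop]
theorem Plant.continuous_phiD (k : ℕ) : Continuous (P.phiD K k) :=
  continuous_iff_continuousAt.2 fun x => (P.hasDerivAt_phiD K k x).continuousAt

@[fun_prop]
theorem Plant.continuous_psiD (k : ℕ) : Continuous (P.psiD K k) :=
  continuous_iff_continuousAt.2 fun x => (P.hasDerivAt_psiD K k x).continuousAt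

/-- The left block column of `D` is (0, I), so the second half of the row is the derivative of the
first: the exponential encodes a second-order equation for Φ. -/
theorem expRow_D_inl (r : Fin n ⊕ Fin n → ℝ) (k : ℕ) (x : ℝ) (j : Fin n) :
    expRow r P.D (k + 1) x (Sum.inl j) = expRow r P.D k x (Sum.inr j) := by
  rw [expRow_succ]
  simp [Matrix.vecMul, dotProduct, Plant.D, Matrix.one_apply]

theorem expRow_D_inr (r : Fin n ⊕ Fin n → ℝ) (k : ℕ) (x : ℝ) (j : Fin n) :
    expRow r P.D (k + 1) x (Sum.inr j)
      = P.q⁻¹ * ((fun i => expRow r P.D k x (Sum.inl i)) ᵥ* P.A) j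
        - P.q⁻¹ * ((fun i => expRow r P.D k x (Sum.inr i)) ⬝ᵥ P.B) * P.CX j := by
  rw [expRow_succ]
  simp only [Matrix.vecMul, dotProduct, Plant.D, Fintype.sum_sum_type, Matrix.fromBlocks_apply₁₂,
    Matrix.fromBlocks_apply₂₂, Matrix.smul_apply, Matrix.neg_apply, Matrix.vecMulVec_apply,
    smul_eq_mul, Finset.mul_sum, Finset.sum_mul, ← Finset.sum_sub_distrib, ← Finset.sum_add_distrib]
  exact Finset.sum_congr rfl fun i _ => by ring

theorem expRow_E_inl (r : Fin n ⊕ Fin n → ℝ) (k : ℕ) (x : ℝ) (j : Fin n) :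
    expRow r (P.E K) (k + 1) x (Sum.inl j) = expRow r (P.E K) k x (Sum.inr j) := by
  rw [expRow_succ]
  simp [Matrix.vecMul, dotProduct, Plant.E, Matrix.one_apply]

theorem expRow_E_inr (r : Fin n ⊕ Fin n → ℝ) (k : ℕ) (x : ℝ) (j : Fin n) :
    expRow r (P.E K) (k + 1) x (Sum.inr j)
      = P.q⁻¹ * ((fun i => expRow r (P.E K) k x (Sum.inl i)) ᵥ* P.AK K) j := by
  rw [expRow_succ]
  simp only [Matrix.vecMul, dotProduct, Plant.E, Fintype.sum_sum_type, Matrix.fromBlocks_apply₁₂,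
    Matrix.fromBlocks_apply₂₂, Matrix.smul_apply, Matrix.zero_apply,
    smul_eq_mul, Finset.mul_sum, mul_zero, Finset.sum_const_zero, add_zero]
  exact Finset.sum_congr rfl fun i _ => by ring

/-- `Φ'' = Φ A / q - Φ' B C_X / q`, differentiated `k` times. -/
theorem Plant.PhiD_add_two (k : ℕ) (x : ℝ) :
    P.PhiD K (k + 2) x
      = P.q⁻¹ • (P.PhiD K k x ᵥ* P.A) - P.phiD K (k + 1) x • P.CX := by
  have h : P.PhiD K (k + 1) x = fun i => expRow
      (Sum.elim P.CX (K - (P.q⁻¹ * (P.CX ⬝ᵥ P.B)) • P.CX)) P.D k x (Sum.inr i) :=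
    funext fun i => expRow_D_inl _ _ _ _ _
  funext j
  rw [Plant.phiD, h]
  exact (expRow_D_inl _ _ _ _ _).trans (expRow_D_inr _ _ _ _ _)

/-- `Γ'' = Γ (A + B K) / q`, differentiated `k` times. -/
theorem Plant.GamD_add_two (k : ℕ) (x : ℝ) :
    P.GamD K (k + 2) x = P.q⁻¹ • (P.GamD K k x ᵥ* P.A) + P.psiD K k x • K := by
  have h : P.GamD K k x = -fun i => expRow (Sum.elim P.CX K) (P.E K) k x (Sum.inl i) := rfl
  funext j
  rw [Plant.psiD, h]
  refine (congrArg Neg.neg ((expRow_E_inl _ _ _ _ _ _).trans (expRow_E_inr _ _ _ _ _ _))).trans ?_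
  simp only [Plant.AK, Matrix.vecMul_add, Matrix.vecMul_vecMulVec, Matrix.neg_vecMul,
    neg_dotProduct, Pi.add_apply, Pi.smul_apply, Pi.neg_apply, smul_eq_mul]
  ring

theorem Plant.PhiD_zero_zero : P.PhiD K 0 0 = P.CX := by
  funext j; simp [Plant.PhiD, expRow_zero_right]

theorem Plant.PhiD_one_zero : P.PhiD K 1 0 = K - (P.q⁻¹ * (P.CX ⬝ᵥ P.B)) • P.CX := by
  funext j
  simp only [Plant.PhiD, expRow_D_inl P _ 0]
  simp [expRow_zero_right]

theorem Plant.GamD_zero_zero : P.GamD K 0 0 = -P.CX := by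
  funext j; simp [Plant.GamD, expRow_zero_right]

theorem Plant.GamD_one_zero : P.GamD K 1 0 = -K := by
  funext j
  simp only [Plant.GamD, expRow_E_inl P K _ 0]
  simp [expRow_zero_right]

theorem iteratedDeriv_eq_of_hasDerivAt {f : ℕ → ℝ → ℝ}
    (h : ∀ k x, HasDerivAt (f k) (f (k + 1) x) x) (k : ℕ) : iteratedDeriv k (f 0) = f k := by
  induction k with
  | zero => simp
  | succ k ih => rw [iteratedDeriv_succ, ih]; exact funext fun x => (h k x).deriv

/-- φ depends on x - y only, so each ∂_y costs a sign. Against the factors (-1)^i in 𝓑 and 𝓒 this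
leaves the constant sign -1, which is why `jetB` and `jetC` carry no alternating signs. -/
theorem Plant.dyPhi_eq (k : ℕ) (x y : ℝ) :
    P.dyPhi K k x y = (-1) ^ k * P.phiD K k (x - y) := by
  have h := iteratedDeriv_eq_of_hasDerivAt (f := fun k y => (-1) ^ k * P.phiD K k (x - y))
    (fun k y => by
      have h1 := ((P.hasDerivAt_phiD K k (x - y)).comp y ((hasDerivAt_id y).const_sub x)).const_mul
        ((-1 : ℝ) ^ k)
      refine h1.congr_deriv ?_
      rw [pow_succ]; ring) k
  unfold Plant.dyPhi
  rw [← congrFun h y]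
  congr 1
  funext y
  simp [Plant.phi_eq]

/-- ψ depends on x - y only, so its derivatives are constant on the diagonal and the derivative term
in the recursion always vanishes. The point where 𝓘 is frozen is thus immaterial, and `invJ` needs
no such argument. -/
theorem Plant.chi_eq (k j : ℕ) :
    chi (P.psi K) k j = fun _ => if j < k then P.psiD K j 0 else 0 := by
  induction k generalizing j with
  | zero => simp [chi]
  | succ k ih =>
    funext x
    have h := iteratedDeriv_eq_of_hasDerivAt (f := fun k y => P.psiD K k (y - x))
      (fun k y => by
        have h1 := (P.hasDerivAt_psiD K k (y - x)).comp y ((hasDerivAt_id y).sub_const x)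
        exact h1.congr_deriv (mul_one _)) k
    have h2 : iteratedDeriv k (fun x' => P.psi K x' x) x = P.psiD K k 0 := by
      have : (fun x' => P.psi K x' x) = fun y => P.psiD K 0 (y - x) := by
        funext y; rw [Plant.psi_eq]
      rw [this, h]; simp
    have h3 : (if j = 0 then (0 : ℝ) else deriv (chi (P.psi K) k (j - 1)) x) = 0 := by
      split_ifs
      · rfl
      · rw [ih]; simp
    rw [chi]
    beta_reduce
    rw [h2, h3, add_zero, ih]
    rcases lt_trichotomy j k with h | h | h
    · simp [h, h.ne, h.trans (Nat.lt_succ_self k)]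
    · subst h; simp
    · simp [h.ne', h.not_gt, (Nat.succ_le_of_lt h).not_gt]

/-! ### Parametric integrals and Volterra convolutions -/

theorem intervalIntegral_swap_of_continuous {F : ℝ → ℝ → ℝ} (hF : Continuous (Function.uncurry F))
    (a b c d : ℝ) :
    ∫ x in a..b, ∫ y in c..d, F x y = ∫ y in c..d, ∫ x in a..b, F x y :=
  intervalIntegral_intervalIntegral_swap <|
    (hF.continuousOn.integrableOn_compact (isCompact_uIcc.prod isCompact_uIcc)).mono_set
      (prod_mono uIoc_subset_uIcc uIoc_subset_uIcc)

/-- Fubini's theorem on a triangle. -/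
theorem intervalIntegral_triangle {F : ℝ → ℝ → ℝ} (hF : Continuous (Function.uncurry F)) {x : ℝ}
    (hx : 0 ≤ x) :
    ∫ y in (0 : ℝ)..x, ∫ r in y..x, F y r = ∫ r in (0 : ℝ)..x, ∫ y in (0 : ℝ)..r, F y r := by
  set S : Set (ℝ × ℝ) := {p | p.1 < p.2} with hS
  have hSm : MeasurableSet S := measurableSet_lt measurable_fst measurable_snd
  have hint : IntegrableOn (S.indicator (Function.uncurry F)) (uIoc 0 x ×ˢ uIoc 0 x) :=
    ((hF.continuousOn.integrableOn_compact (isCompact_uIcc.prod isCompact_uIcc)).mono_set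
      (prod_mono uIoc_subset_uIcc uIoc_subset_uIcc)).indicator hSm
  have key := intervalIntegral_intervalIntegral_swap
    (F := fun y r => S.indicator (Function.uncurry F) (y, r)) (a := 0) (b := x) (c := 0) (d := x)
    hint
  have h1 : ∀ y ∈ uIcc 0 x, ∫ r in (0 : ℝ)..x, S.indicator (Function.uncurry F) (y, r)
      = ∫ r in y..x, F y r := by
    intro y hy
    rw [uIcc_of_le hx] at hy
    rw [intervalIntegral.integral_of_le hx, intervalIntegral.integral_of_le hy.2]
    have : (fun r => S.indicator (Function.uncurry F) (y, r)) = (Ioi y).indicator (F y) := by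
      funext r
      by_cases h : y < r
      · rw [indicator_of_mem (show (y, r) ∈ S from h), indicator_of_mem (show r ∈ Ioi y from h)]
        rfl
      · rw [indicator_of_notMem (show (y, r) ∉ S from h),
          indicator_of_notMem (show r ∉ Ioi y from h)]
    rw [this, setIntegral_indicator measurableSet_Ioi]
    congr 2
    ext r
    simp only [mem_inter_iff, mem_Ioc, mem_Ioi]
    exact ⟨fun h => ⟨h.2, h.1.2⟩, fun h => ⟨⟨hy.1.trans_lt h.1, h.2⟩, h.1⟩⟩
  have h2 : ∀ r ∈ uIcc 0 x, ∫ y in (0 : ℝ)..x, S.indicator (Function.uncurry F) (y, r)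
      = ∫ y in (0 : ℝ)..r, F y r := by
    intro r hr
    rw [uIcc_of_le hx] at hr
    rw [intervalIntegral.integral_of_le hx, intervalIntegral.integral_of_le hr.1,
      integral_Ioc_eq_integral_Ioo (x := 0) (y := r)]
    have : (fun y => S.indicator (Function.uncurry F) (y, r))
        = (Iio r).indicator (fun y => F y r) := by
      funext y
      by_cases h : y < r
      · rw [indicator_of_mem (show (y, r) ∈ S from h), indicator_of_mem (show y ∈ Iio r from h)]
        rfl
      · rw [indicator_of_notMem (show (y, r) ∉ S from h),
          indicator_of_notMem (show y ∉ Iio r from h)]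
    rw [this, setIntegral_indicator measurableSet_Iio]
    congr 2
    ext y
    simp only [mem_inter_iff, mem_Ioc, mem_Iio, mem_Ioo]
    exact ⟨fun h => ⟨h.1.1, h.2⟩, fun h => ⟨⟨h.1, h.2.le.trans hr.2⟩, h.2⟩⟩
  rw [intervalIntegral.integral_congr h1, intervalIntegral.integral_congr h2] at key
  exact key

theorem hasDerivWithinAt_integral_right {g : ℝ → ℝ} (hg : Continuous g) (a t : ℝ) (s : Set ℝ) :
    HasDerivWithinAt (fun t => ∫ τ in a..t, g τ) (g t) s t :=
  (intervalIntegral.integral_hasDerivAt_right (hg.intervalIntegrable _ _)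
    hg.stronglyMeasurable.stronglyMeasurableAtFilter hg.continuousAt).hasDerivWithinAt

theorem integral_eq_sub_of_hasDerivWithinAt {f f' : ℝ → ℝ} {a b : ℝ} (hab : a ≤ b)
    (hf' : Continuous f') {s : Set ℝ} (hs : Icc a b ⊆ s)
    (h : ∀ x ∈ Icc a b, HasDerivWithinAt f (f' x) s x) :
    ∫ y in a..b, f' y = f b - f a := by
  refine intervalIntegral.integral_eq_sub_of_hasDeriv_right
    (fun x hx => ?_) (fun x hx => ?_) (hf'.intervalIntegrable _ _)
  · rw [uIcc_of_le hab] at hx ⊢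
    exact (h x hx).continuousWithinAt.mono hs
  · rw [min_eq_left hab, max_eq_right hab] at hx
    have : Icc a b ∈ 𝓝 x := Icc_mem_nhds hx.1 hx.2
    exact (((h x (Ioo_subset_Icc_self hx)).mono hs).hasDerivAt this).hasDerivWithinAt

/-- The fundamental theorem in t and Fubini turn the integral into a constant plus a primitive of a
continuous function of t. This works with derivatives within [0,∞), including t = 0. -/
theorem hasDerivWithinAt_parametric_integral {F F' : ℝ → ℝ → ℝ} {x : ℝ} (hx : 0 ≤ x)
    (hF : ∀ t, Continuous fun y => F y t) (hF' : Continuous (Function.uncurry F'))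
    (h : ∀ y ∈ Icc 0 x, ∀ t, 0 ≤ t → HasDerivWithinAt (F y) (F' y t) (Ici 0) t)
    {t : ℝ} (ht : 0 ≤ t) :
    HasDerivWithinAt (fun t => ∫ y in (0 : ℝ)..x, F y t) (∫ y in (0 : ℝ)..x, F' y t) (Ici 0) t := by
  have hG : Continuous fun τ => ∫ y in (0 : ℝ)..x, F' y τ :=
    intervalIntegral.continuous_parametric_intervalIntegral_of_continuous
      (f := fun τ y => F' y τ) (hF'.comp (continuous_snd.prodMk continuous_fst)) continuous_const
  have key : ∀ t, 0 ≤ t → ∫ y in (0 : ℝ)..x, F y t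
      = (∫ y in (0 : ℝ)..x, F y 0) + ∫ τ in (0 : ℝ)..t, ∫ y in (0 : ℝ)..x, F' y τ := by
    intro t ht
    rw [intervalIntegral_swap_of_continuous (F := fun τ y => F' y τ)
      (hF'.comp (continuous_snd.prodMk continuous_fst)), ← intervalIntegral.integral_add
      ((hF 0).intervalIntegrable _ _)]
    · refine intervalIntegral.integral_congr fun y hy => ?_
      rw [uIcc_of_le hx] at hy
      have := integral_eq_sub_of_hasDerivWithinAt ht (f := F y) (f' := F' y)
        (hF'.comp (continuous_const.prodMk continuous_id)) (s := Ici 0) Icc_subset_Ici_self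
        (fun τ hτ => h y hy τ hτ.1)
      simp only [this]; ring
    · refine Continuous.intervalIntegrable ?_ _ _
      exact intervalIntegral.continuous_parametric_intervalIntegral_of_continuous
        (f := F') hF' continuous_const
  refine HasDerivWithinAt.congr ?_ (fun s hs => key s hs) (key t ht)
  exact (hasDerivWithinAt_integral_right hG 0 t (Ici 0)).const_add _

/-- The Volterra convolution `x ↦ ∫₀ˣ k(x - y) f(y) dy`. -/
def conv (k f : ℝ → ℝ) (x : ℝ) : ℝ := ∫ y in (0 : ℝ)..x, k (x - y) * f y

theorem continuous_conv₂ {k : ℝ → ℝ} {f : ℝ → ℝ → ℝ} (hk : Continuous k)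
    (hf : Continuous (Function.uncurry f)) :
    Continuous fun z : ℝ × ℝ => conv k (fun y => f y z.2) z.1 := by
  unfold conv
  refine intervalIntegral.continuous_parametric_intervalIntegral_of_continuous
    (f := fun (z : ℝ × ℝ) y => k (z.1 - y) * f y z.2) ?_ continuous_fst
  have h2 : Continuous fun p : (ℝ × ℝ) × ℝ => f p.2 p.1.2 :=
    hf.comp (continuous_snd.prodMk (continuous_snd.comp continuous_fst))
  exact (hk.comp (by fun_prop)).mul h2

theorem continuous_conv {k f : ℝ → ℝ} (hk : Continuous k) (hf : Continuous f) :
    Continuous (conv k f) :=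
  (continuous_conv₂ (f := fun y _ => f y) hk (hf.comp continuous_fst)).comp
    (continuous_id.prodMk (continuous_const (y := (0 : ℝ))))

/-- Write k(x - y) = k(0) + ∫_y^x k'(r - y) dr and exchange the integrals over the triangle. The
result displays the convolution as a primitive, without differentiability of f. -/
theorem conv_eq_integral {k k' f : ℝ → ℝ} (hk : ∀ x, HasDerivAt k (k' x) x) (hk' : Continuous k')
    (hf : Continuous f) {x : ℝ} (hx : 0 ≤ x) :
    conv k f x = ∫ r in (0 : ℝ)..x, (k 0 * f r + conv k' f r) := by
  have hkc : Continuous k := continuous_iff_continuousAt.2 fun x => (hk x).continuousAt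
  have h1 : ∀ y ∈ uIcc 0 x, k (x - y) * f y = k 0 * f y + ∫ r in y..x, k' (r - y) * f y := by
    intro y hy
    rw [uIcc_of_le hx] at hy
    have := integral_eq_sub_of_hasDerivWithinAt hy.2 (f := fun r => k (r - y) * f y)
      (f' := fun r => k' (r - y) * f y) (by fun_prop) (s := univ) (subset_univ _)
      (fun r _ => ((((hk (r - y)).comp r ((hasDerivAt_id r).sub_const y)).congr_deriv
        (mul_one _)).mul_const (f y)).hasDerivWithinAt)
    rw [this]; simp
  have hF : Continuous (Function.uncurry fun y r => k' (r - y) * f y) := by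
    unfold Function.uncurry; fun_prop
  have hF2 : Continuous fun y => ∫ r in y..x, k' (r - y) * f y := by
    have := intervalIntegral.continuous_parametric_intervalIntegral_of_continuous
      (a₀ := x) (μ := volume) (f := fun y r => k' (r - y) * f y) hF continuous_id
    refine this.neg.congr fun y => ?_
    rw [Pi.neg_apply, intervalIntegral.integral_symm, neg_neg]; rfl
  rw [conv, intervalIntegral.integral_congr h1, intervalIntegral.integral_add
    ((hf.const_mul _).intervalIntegrable _ _) (hF2.intervalIntegrable _ _),
    intervalIntegral_triangle hF hx, intervalIntegral.integral_add
    ((hf.const_mul _).intervalIntegrable _ _)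
    ((continuous_conv hk' hf).intervalIntegrable _ _)]
  rfl

theorem hasDerivWithinAt_conv {k k' f : ℝ → ℝ} (hk : ∀ x, HasDerivAt k (k' x) x)
    (hk' : Continuous k') (hf : Continuous f) {s : Set ℝ} (hs : s ⊆ Ici 0) {x : ℝ} (hx : 0 ≤ x) :
    HasDerivWithinAt (conv k f) (k 0 * f x + conv k' f x) s x := by
  refine HasDerivWithinAt.congr ?_ (fun s hs' => conv_eq_integral hk hk' hf (hs hs'))
    (conv_eq_integral hk hk' hf hx)
  exact hasDerivWithinAt_integral_right ((hf.const_mul _).add (continuous_conv hk' hf)) 0 x s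

/-- Integration by parts in y moves the derivative from f to the kernel. -/
theorem conv_deriv {k k' f f' : ℝ → ℝ} (hk : ∀ x, HasDerivAt k (k' x) x) (hk' : Continuous k')
    (hf' : Continuous f') (hfc : Continuous f)
    (hf : ∀ x ∈ Icc (0 : ℝ) 1, HasDerivWithinAt f (f' x) (Icc 0 1) x) {x : ℝ} (hx : x ∈ Icc (0 : ℝ) 1) :
    conv k f' x = k 0 * f x - k x * f 0 + conv k' f x := by
  have hkc : Continuous k := continuous_iff_continuousAt.2 fun x => (hk x).continuousAt
  have hd : ∀ y ∈ Icc 0 x, HasDerivWithinAt (fun y => k (x - y) * f y)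
      (k (x - y) * f' y - k' (x - y) * f y) (Icc 0 1) y := by
    intro y hy
    have h1 := (((hk (x - y)).comp y ((hasDerivAt_id y).const_sub x))).hasDerivWithinAt
      (s := Icc 0 1)
    have h2 := h1.mul (hf y ⟨hy.1, hy.2.trans hx.2⟩)
    refine h2.congr_deriv ?_
    simp only [Function.comp_apply]
    ring
  have := integral_eq_sub_of_hasDerivWithinAt hx.1 (by fun_prop)
    (Icc_subset_Icc_right hx.2) hd
  rw [intervalIntegral.integral_sub (Continuous.intervalIntegrable (by fun_prop) _ _)
    (Continuous.intervalIntegrable (by fun_prop) _ _)] at this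
  simp only [sub_self, sub_zero] at this
  unfold conv
  linarith

/-- Both sides are the same integral over a triangle, after a translation of the inner variable. -/
theorem conv_assoc {a b f : ℝ → ℝ} (ha : Continuous a) (hb : Continuous b) (hf : Continuous f)
    {x : ℝ} (hx : 0 ≤ x) : conv a (conv b f) x = conv (conv a b) f x := by
  have hF : Continuous (Function.uncurry fun z y => a (x - y) * (b (y - z) * f z)) := by
    unfold Function.uncurry; fun_prop
  have h := intervalIntegral_triangle hF hx
  have h1 : conv a (conv b f) x
      = ∫ y in (0 : ℝ)..x, ∫ z in (0 : ℝ)..y, a (x - y) * (b (y - z) * f z) := by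
    unfold conv
    refine intervalIntegral.integral_congr fun y _ => ?_
    simp only [intervalIntegral.integral_const_mul]
  rw [h1, ← h, conv]
  refine intervalIntegral.integral_congr fun z _ => ?_
  simp only [conv]
  have h2 := intervalIntegral.integral_comp_sub_right (a := z) (b := x)
    (fun y => a (x - z - y) * b y * f z) z
  rw [sub_self, intervalIntegral.integral_mul_const, intervalIntegral.integral_mul_const] at h2
  rw [← h2, ← intervalIntegral.integral_mul_const]
  refine intervalIntegral.integral_congr fun y _ => ?_
  simp only [sub_sub_sub_cancel_right]
  ring

theorem conv_add {k f g : ℝ → ℝ} (hk : Continuous k) (hf : Continuous f) (hg : Continuous g)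
    (x : ℝ) : conv k (fun y => f y + g y) x = conv k f x + conv k g x := by
  unfold conv
  rw [← intervalIntegral.integral_add (Continuous.intervalIntegrable (by fun_prop) _ _)
    (Continuous.intervalIntegrable (by fun_prop) _ _)]
  simp only [mul_add]

theorem conv_sub {k f g : ℝ → ℝ} (hk : Continuous k) (hf : Continuous f) (hg : Continuous g)
    (x : ℝ) : conv k (fun y => f y - g y) x = conv k f x - conv k g x := by
  unfold conv
  rw [← intervalIntegral.integral_sub (Continuous.intervalIntegrable (by fun_prop) _ _)
    (Continuous.intervalIntegrable (by fun_prop) _ _)]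
  simp only [mul_sub]

theorem conv_const_mul (k f : ℝ → ℝ) (c x : ℝ) :
    conv k (fun y => c * f y) x = c * conv k f x := by
  unfold conv
  rw [← intervalIntegral.integral_const_mul]
  exact intervalIntegral.integral_congr fun y _ => by ring

theorem conv_mul_const (k f : ℝ → ℝ) (c x : ℝ) :
    conv k (fun y => f y * c) x = conv k f x * c := by
  unfold conv
  rw [← intervalIntegral.integral_mul_const]
  exact intervalIntegral.integral_congr fun y _ => by ring

theorem conv_congr_right {k f g : ℝ → ℝ} {x : ℝ} (hx : 0 ≤ x) (h : ∀ y ∈ Icc 0 x, f y = g y) :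
    conv k f x = conv k g x := by
  refine intervalIntegral.integral_congr fun y hy => ?_
  rw [uIcc_of_le hx] at hy
  simp only [h y hy]

theorem conv_zero_right (k f : ℝ → ℝ) : conv k f 0 = 0 := by simp [conv]

theorem abs_conv_le {k f : ℝ → ℝ} {x C N : ℝ} (hx : x ∈ Icc (0 : ℝ) 1)
    (hk : ∀ y ∈ Icc (0 : ℝ) 1, |k y| ≤ C) (hf : ∀ y ∈ Icc (0 : ℝ) 1, |f y| ≤ N) :
    |conv k f x| ≤ C * N := by
  have hC : 0 ≤ C := (abs_nonneg _).trans (hk 0 (by simp))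
  have hN : 0 ≤ N := (abs_nonneg _).trans (hf 0 (by simp))
  have := intervalIntegral.norm_integral_le_of_norm_le_const (a := 0) (b := x)
    (f := fun y => k (x - y) * f y) (C := C * N) (fun y hy => by
      rw [uIoc_of_le hx.1] at hy
      rw [Real.norm_eq_abs, abs_mul]
      exact mul_le_mul (hk _ ⟨by linarith [hy.2], by linarith [hy.1, hx.2]⟩)
        (hf _ ⟨hy.1.le, hy.2.trans hx.2⟩) (abs_nonneg _) hC)
  rw [Real.norm_eq_abs, sub_zero, abs_of_nonneg hx.1] at this
  exact this.trans (mul_le_of_le_one_right (mul_nonneg hC hN) hx.2)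

theorem hasDerivWithinAt_conv_time {k : ℝ → ℝ} {F F' : ℝ → ℝ → ℝ} {x : ℝ} (hx : 0 ≤ x)
    (hk : Continuous k) (hF : ∀ t, Continuous fun y => F y t)
    (hF' : Continuous (Function.uncurry F'))
    (h : ∀ y ∈ Icc 0 x, ∀ t, 0 ≤ t → HasDerivWithinAt (F y) (F' y t) (Ici 0) t)
    {t : ℝ} (ht : 0 ≤ t) :
    HasDerivWithinAt (fun t => conv k (fun y => F y t) x) (conv k (fun y => F' y t) x) (Ici 0) t :=
  hasDerivWithinAt_parametric_integral (F := fun y t => k (x - y) * F y t)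
    (F' := fun y t => k (x - y) * F' y t) hx (fun t => by have := hF t; fun_prop)
    ((hk.comp (continuous_const.sub continuous_fst)).mul hF')
    (fun y hy t ht => (h y hy t ht).const_mul _) ht

/-! ### Jets of solutions of the heat equation -/

/-- `g 0, …, g N` are the `x`-derivatives of a function on `[0,1] × [0,∞)` that satisfies the heat
equation `g_t = q g_xx` in the integrated form `d/dt ∫₀ˣ g = q (g_x(x) - g_x(0))`. -/
structure HeatJet (q : ℝ) (N : ℕ) (g : ℕ → ℝ → ℝ → ℝ) : Prop where
  cont : ∀ i ≤ N, Continuous (Function.uncurry (g i))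
  space : ∀ i < N, ∀ t, 0 ≤ t → ∀ x ∈ Icc (0 : ℝ) 1,
    HasDerivWithinAt (fun x => g i x t) (g (i + 1) x t) (Icc 0 1) x
  flux : ∀ x ∈ Icc (0 : ℝ) 1, ∀ t, 0 ≤ t →
    HasDerivWithinAt (fun t => ∫ y in (0 : ℝ)..x, g 0 y t) (q * (g 1 x t - g 1 0 t)) (Ici 0) t

theorem continuous_uncurry_left {g : ℝ → ℝ → ℝ} (h : Continuous (Function.uncurry g)) (x : ℝ) :
    Continuous (g x) :=
  h.comp (continuous_const.prodMk continuous_id)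

theorem continuous_uncurry_right {g : ℝ → ℝ → ℝ} (h : Continuous (Function.uncurry g)) (t : ℝ) :
    Continuous fun x => g x t :=
  h.comp (continuous_id.prodMk continuous_const)

namespace HeatJet

variable {q : ℝ} {N : ℕ} {g : ℕ → ℝ → ℝ → ℝ}

theorem hasDerivWithinAt_integral_space (hg : HeatJet q N g) {i : ℕ} (hi : i + 1 ≤ N)
    {t : ℝ} (ht : 0 ≤ t) {x : ℝ} (hx : x ∈ Icc (0 : ℝ) 1) :
    HasDerivWithinAt (fun x => ∫ τ in (0 : ℝ)..t, g i x τ) (∫ τ in (0 : ℝ)..t, g (i + 1) x τ)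
      (Icc 0 1) x := by
  have hc := hg.cont (i + 1) hi
  have hc' : Continuous (Function.uncurry fun τ y => g (i + 1) y τ) :=
    hc.comp (continuous_snd.prodMk continuous_fst)
  have hI : Continuous fun y => ∫ τ in (0 : ℝ)..t, g (i + 1) y τ :=
    intervalIntegral.continuous_parametric_intervalIntegral_of_continuous hc continuous_const
  have key : ∀ x ∈ Icc (0 : ℝ) 1, ∫ τ in (0 : ℝ)..t, g i x τ
      = (∫ τ in (0 : ℝ)..t, g i 0 τ)
        + ∫ y in (0 : ℝ)..x, ∫ τ in (0 : ℝ)..t, g (i + 1) y τ := by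
    intro x hx
    rw [intervalIntegral_swap_of_continuous hc, ← intervalIntegral.integral_add
      ((continuous_uncurry_left (hg.cont i (by omega)) 0).intervalIntegrable _ _)]
    · refine intervalIntegral.integral_congr fun τ hτ => ?_
      rw [uIcc_of_le ht] at hτ
      have := integral_eq_sub_of_hasDerivWithinAt hx.1 (continuous_uncurry_right hc τ)
        (Icc_subset_Icc_right hx.2)
        (fun y hy => hg.space i (by omega) τ hτ.1 y ⟨hy.1, hy.2.trans hx.2⟩)
      simp only [this]; ring
    · exact (intervalIntegral.continuous_parametric_intervalIntegral_of_continuous hc'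
        continuous_const).intervalIntegrable _ _
  exact ((hasDerivWithinAt_integral_right hI 0 x _).const_add _).congr key (key x hx)

/-- Integrated in time, the flux identity says that ∫₀ᵗ g_1 has x-derivative (g_0(t) - g_0(0))/q.
Where g_2 exists, uniqueness of derivatives identifies this with ∫₀ᵗ g_2, and differentiation in x
raises the order by one. The first conclusion still holds at i + 1 = N, one order beyond the second;
the maximum principle needs exactly this for the top even derivative. -/
theorem hasDerivWithinAt_integral_and_integral_eq (hg : HeatJet q N g) (hq : 0 < q) (i : ℕ) :
    (i + 1 ≤ N → ∀ t, 0 ≤ t → ∀ x ∈ Icc (0 : ℝ) 1,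
      HasDerivWithinAt (fun x => ∫ τ in (0 : ℝ)..t, g (i + 1) x τ) (q⁻¹ * (g i x t - g i x 0))
        (Icc 0 1) x) ∧
    (i + 2 ≤ N → ∀ t, 0 ≤ t → ∀ x ∈ Icc (0 : ℝ) 1,
      g i x t - g i x 0 = q * ∫ τ in (0 : ℝ)..t, g (i + 2) x τ) := by
  have step : ∀ i, (i + 1 ≤ N → ∀ t, 0 ≤ t → ∀ x ∈ Icc (0 : ℝ) 1,
      HasDerivWithinAt (fun x => ∫ τ in (0 : ℝ)..t, g (i + 1) x τ) (q⁻¹ * (g i x t - g i x 0))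
        (Icc 0 1) x) → (i + 2 ≤ N → ∀ t, 0 ≤ t → ∀ x ∈ Icc (0 : ℝ) 1,
      g i x t - g i x 0 = q * ∫ τ in (0 : ℝ)..t, g (i + 2) x τ) := by
    intro i h hi t ht x hx
    have h2 := hg.hasDerivWithinAt_integral_space (i := i + 1) hi ht hx
    have := (uniqueDiffOn_Icc (zero_lt_one (α := ℝ)) x hx).eq_deriv _ (h (by omega) t ht x hx) h2
    rw [← this]
    field_simp
  induction i with
  | zero =>
    have h1 : 0 + 1 ≤ N → ∀ t, 0 ≤ t → ∀ x ∈ Icc (0 : ℝ) 1,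
      HasDerivWithinAt (fun x => ∫ τ in (0 : ℝ)..t, g (0 + 1) x τ) (q⁻¹ * (g 0 x t - g 0 x 0))
        (Icc 0 1) x := by
      intro hi t ht x hx
      have hc := fun x => continuous_uncurry_left (hg.cont 1 hi) x
      have hc0 := fun t => continuous_uncurry_right (hg.cont 0 (by omega)) t
      have key : ∀ x ∈ Icc (0 : ℝ) 1, ∫ τ in (0 : ℝ)..t, g (0 + 1) x τ
          = (∫ τ in (0 : ℝ)..t, g 1 0 τ)
            + q⁻¹ * ((∫ y in (0 : ℝ)..x, g 0 y t) - ∫ y in (0 : ℝ)..x, g 0 y 0) := by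
        intro x hx
        have := integral_eq_sub_of_hasDerivWithinAt ht (f' := fun τ => q * (g 1 x τ - g 1 0 τ))
          (((hc x).sub (hc 0)).const_mul q) (s := Ici 0) Icc_subset_Ici_self
          (fun τ hτ => hg.flux x hx τ hτ.1)
        rw [← this, intervalIntegral.integral_const_mul, intervalIntegral.integral_sub
          ((hc x).intervalIntegrable _ _) ((hc 0).intervalIntegrable _ _)]
        field_simp
        ring
      exact ((((hasDerivWithinAt_integral_right (hc0 t) 0 x _).sub
        (hasDerivWithinAt_integral_right (hc0 0) 0 x _)).const_mul _).const_add _).congr key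
        (key x hx)
    exact ⟨h1, step 0 h1⟩
  | succ i ih =>
    have h1 : i + 1 + 1 ≤ N → ∀ t, 0 ≤ t → ∀ x ∈ Icc (0 : ℝ) 1,
      HasDerivWithinAt (fun x => ∫ τ in (0 : ℝ)..t, g (i + 1 + 1) x τ)
        (q⁻¹ * (g (i + 1) x t - g (i + 1) x 0)) (Icc 0 1) x := by
      intro hi t ht x hx
      have key : ∀ x ∈ Icc (0 : ℝ) 1, ∫ τ in (0 : ℝ)..t, g (i + 1 + 1) x τ
          = q⁻¹ * (g i x t - g i x 0) := by
        intro x hx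
        rw [ih.2 (by omega) t ht x hx]; field_simp
      exact (((hg.space i (by omega) t ht x hx).sub
        (hg.space i (by omega) 0 le_rfl x hx)).const_mul _).congr key (key x hx)
    exact ⟨h1, step _ h1⟩

theorem hasDerivWithinAt_integral (hg : HeatJet q N g) (hq : 0 < q) {i : ℕ} (hi : i + 1 ≤ N)
    {t : ℝ} (ht : 0 ≤ t) {x : ℝ} (hx : x ∈ Icc (0 : ℝ) 1) :
    HasDerivWithinAt (fun x => ∫ τ in (0 : ℝ)..t, g (i + 1) x τ) (q⁻¹ * (g i x t - g i x 0))
      (Icc 0 1) x :=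
  (hg.hasDerivWithinAt_integral_and_integral_eq hq i).1 hi t ht x hx

/-- Each derivative `g i` with `i + 2 ≤ N` satisfies the heat equation pointwise. -/
theorem time (hg : HeatJet q N g) (hq : 0 < q) {i : ℕ} (hi : i + 2 ≤ N)
    {t : ℝ} (ht : 0 ≤ t) {x : ℝ} (hx : x ∈ Icc (0 : ℝ) 1) :
    HasDerivWithinAt (g i x) (q * g (i + 2) x t) (Ici 0) t := by
  have h := (hg.hasDerivWithinAt_integral_and_integral_eq hq i).2 hi
  have key : ∀ t, 0 ≤ t → g i x t = g i x 0 + q * ∫ τ in (0 : ℝ)..t, g (i + 2) x τ := by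
    intro t ht
    rw [← h t ht x hx]; ring
  exact (((hasDerivWithinAt_integral_right (continuous_uncurry_left (hg.cont _ hi) x) 0 t
    _).const_mul q).const_add _).congr (fun s hs => key s hs) (key t ht)

end HeatJet

/-! ### A maximum principle -/

/-- If the second derivative were positive, the maximum would also be a local minimum, so f would be
locally constant with second derivative 0. -/
theorem deriv_deriv_nonpos_of_isLocalMax {f f' : ℝ → ℝ} {f'' x : ℝ} (hmax : IsLocalMax f x)
    (hf : ∀ᶠ y in 𝓝 x, HasDerivAt f (f' y) y) (hf' : HasDerivAt f' f'' x) : f'' ≤ 0 := by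
  by_contra! hpos
  have hd : deriv f =ᶠ[𝓝 x] f' := hf.mono fun y hy => hy.deriv
  have hdd : deriv (deriv f) x = f'' := hd.deriv_eq.trans hf'.deriv
  have hmin := isLocalMin_of_deriv_deriv_pos (hdd ▸ hpos) hmax.deriv_eq_zero
    hf.self_of_nhds.continuousAt
  have hconst : f =ᶠ[𝓝 x] fun _ => f x := by
    filter_upwards [hmax, hmin] with y h1 h2 using le_antisymm h1 h2
  have h0 : deriv f =ᶠ[𝓝 x] fun _ => 0 := by
    filter_upwards [hconst.eventuallyEq_nhds] with y hy
    rw [hy.deriv_eq]; simp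
  rw [h0.deriv_eq] at hdd
  simp at hdd
  linarith

/-- The classical weak maximum principle for subsolutions of `f_t = q f_xx`. -/
theorem classical_maximum_principle {q S k : ℝ} (hq : 0 < q) {f ft fx fxx : ℝ → ℝ → ℝ}
    (hf : ContinuousOn (Function.uncurry f) (Icc 0 1 ×ˢ Icc 0 S))
    (hft : ∀ x ∈ Icc (0 : ℝ) 1, ∀ t ∈ Icc 0 S, HasDerivWithinAt (f x) (ft x t) (Icc 0 S) t)
    (hfx : ∀ x ∈ Icc (0 : ℝ) 1, ∀ t ∈ Icc 0 S,
      HasDerivWithinAt (fun x => f x t) (fx x t) (Icc 0 1) x)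
    (hfxx : ∀ x ∈ Icc (0 : ℝ) 1, ∀ t ∈ Icc 0 S,
      HasDerivWithinAt (fun x => fx x t) (fxx x t) (Icc 0 1) x)
    (hsub : ∀ x ∈ Icc (0 : ℝ) 1, ∀ t ∈ Icc 0 S, ft x t ≤ q * fxx x t)
    (h0 : ∀ t ∈ Icc 0 S, f 0 t ≤ k) (h1 : ∀ t ∈ Icc 0 S, f 1 t ≤ k)
    (hi : ∀ x ∈ Icc (0 : ℝ) 1, f x 0 ≤ k) :
    ∀ x ∈ Icc (0 : ℝ) 1, ∀ t ∈ Icc 0 S, f x t ≤ k := by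
  intro x hx t ht
  have hS : 0 ≤ S := ht.1.trans ht.2
  by_contra! hlt
  -- Subtracting δt makes the inequality strict at a maximum; δS stays below the excess of f over k,
  -- so the maximum still lies off the parabolic boundary.
  set δ := (f x t - k) / (2 * (S + 1)) with hδ
  have hδ0 : 0 < δ := div_pos (sub_pos.2 hlt) (by positivity)
  have hδS : δ * S < f x t - k := by
    have h2 : δ * (2 * (S + 1)) = f x t - k := by rw [hδ]; field_simp
    nlinarith
  set F : ℝ × ℝ → ℝ := fun z => f z.1 z.2 - δ * z.2 with hF
  have hFc : ContinuousOn F (Icc 0 1 ×ˢ Icc 0 S) :=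
    hf.sub (Continuous.continuousOn (by fun_prop))
  obtain ⟨⟨a, b⟩, ⟨ha, hb⟩, hmax⟩ := (isCompact_Icc.prod isCompact_Icc).exists_isMaxOn
    ⟨(x, t), mk_mem_prod hx ht⟩ hFc
  simp only at ha hb
  have hval : k < f a b - δ * b := by
    have h2 : F (x, t) ≤ F (a, b) := hmax (mk_mem_prod hx ht)
    simp only [hF] at h2
    nlinarith [ht.2]
  have hpos : k < f a b := by nlinarith [hb.1]
  have ha0 : 0 < a := lt_of_le_of_ne ha.1 (by rintro rfl; exact absurd (h0 b hb) hpos.not_ge)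
  have ha1 : a < 1 := lt_of_le_of_ne ha.2 (by rintro rfl; exact absurd (h1 b hb) hpos.not_ge)
  have hb0 : 0 < b := lt_of_le_of_ne hb.1 (by rintro rfl; exact absurd (hi a ha) hpos.not_ge)
  have hnhds : Icc (0 : ℝ) 1 ∈ 𝓝 a := Icc_mem_nhds ha0 ha1
  have hxx : fxx a b ≤ 0 := by
    refine deriv_deriv_nonpos_of_isLocalMax (f := fun x => f x b) (f' := fun x => fx x b)
      (x := a) ?_ ?_ ((hfxx a ha b hb).hasDerivAt hnhds)
    · filter_upwards [hnhds] with y hy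
      have h2 : F (y, b) ≤ F (a, b) := hmax (mk_mem_prod hy hb)
      simp only [hF] at h2
      linarith
    · filter_upwards [Ioo_mem_nhds ha0 ha1] with y hy
      exact (hfx y (Ioo_subset_Icc_self hy) b hb).hasDerivAt (Icc_mem_nhds hy.1 hy.2)
  -- The maximum may sit at the final time, so only left difference quotients are compared.
  have htt : δ ≤ ft a b := by
    have hd : HasDerivWithinAt (fun s => f a s - δ * s) (ft a b - δ * 1) (Icc 0 b) b :=
      ((hft a ha b hb).sub ((hasDerivWithinAt_id b _).const_mul δ)).mono
        (Icc_subset_Icc_right hb.2)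
    have hd' : HasDerivWithinAt (fun s => f a s - δ * s) (ft a b - δ * 1) (Iio b) b :=
      hd.mono_of_mem_nhdsWithin (mem_nhdsWithin.2 ⟨Ioi 0, isOpen_Ioi, hb0, fun s hs =>
        ⟨le_of_lt hs.1, le_of_lt hs.2⟩⟩)
    have hslope := (hasDerivWithinAt_iff_tendsto_slope' (by simp)).1 hd'
    have h3 : 0 ≤ ft a b - δ * 1 := by
      refine ge_of_tendsto hslope ?_
      filter_upwards [Ioo_mem_nhdsLT hb0] with s hs
      have h2 : F (a, s) ≤ F (a, b) := hmax (mk_mem_prod ha ⟨hs.1.le, hs.2.le.trans hb.2⟩)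
      simp only [hF] at h2
      rw [slope_def_field]
      exact div_nonneg_of_nonpos (by linarith) (by linarith [hs.2])
    linarith
  have := hsub a ha b hb
  nlinarith

/-- A weak maximum principle for functions whose time integral has two derivatives in `x`. -/
theorem weak_maximum_principle {q T : ℝ} (hq : 0 < q) {r R1 R2 : ℝ → ℝ → ℝ}
    (hr : Continuous (Function.uncurry r))
    (hR1 : ∀ x ∈ Icc (0 : ℝ) 1, ∀ t ∈ Icc 0 T,
      HasDerivWithinAt (fun x => ∫ τ in (0 : ℝ)..t, r x τ) (R1 x t) (Icc 0 1) x)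
    (hR2 : ∀ x ∈ Icc (0 : ℝ) 1, ∀ t ∈ Icc 0 T,
      HasDerivWithinAt (fun x => R1 x t) (R2 x t) (Icc 0 1) x)
    (hsub : ∀ x ∈ Icc (0 : ℝ) 1, ∀ s t, 0 ≤ s → s ≤ t → t ≤ T →
      r x t - r x s ≤ q * (R2 x t - R2 x s))
    (h0 : ∀ t ∈ Icc 0 T, r 0 t ≤ 0) (h1 : ∀ t ∈ Icc 0 T, r 1 t ≤ 0)
    (hi : ∀ x ∈ Icc (0 : ℝ) 1, r x 0 ≤ 0) {x t : ℝ} (hx : x ∈ Icc (0 : ℝ) 1) (ht : 0 ≤ t)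
    (htT : t < T) : r x t ≤ 0 := by
  by_contra! hpos
  set ε := r x t / 2 with hε
  have hε0 : 0 < ε := by positivity
  -- near `t = 0` and near `(x, t)`
  obtain ⟨h₁, hh₁, hsmall⟩ : ∃ h > 0, ∀ y ∈ Icc (0 : ℝ) 1, ∀ τ ∈ Icc 0 h, r y τ ≤ ε := by
    have hU : {z : ℝ × ℝ | Function.uncurry r z < ε} ∈ 𝓝ˢ (Icc (0 : ℝ) 1 ×ˢ {(0 : ℝ)}) := by
      rw [(isOpen_lt hr continuous_const).mem_nhdsSet]
      rintro ⟨y, τ⟩ ⟨hy, hτ⟩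
      simp only [mem_singleton_iff] at hτ
      subst hτ
      exact (hi y hy).trans_lt hε0
    rw [(isCompact_Icc).nhdsSet_prod_eq isCompact_singleton, nhdsSet_singleton,
      Filter.mem_prod_iff] at hU
    obtain ⟨s₁, hs₁, s₂, hs₂, hss⟩ := hU
    obtain ⟨h, hh, hb⟩ := Metric.mem_nhds_iff.1 hs₂
    refine ⟨h / 2, half_pos hh, fun y hy τ hτ => ?_⟩
    have : (y, τ) ∈ s₁ ×ˢ s₂ := ⟨subset_of_mem_nhdsSet hs₁ hy, hb (by
      rw [Metric.mem_ball, Real.dist_eq, sub_zero, abs_of_nonneg hτ.1]; linarith [hτ.2])⟩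
    exact (show r y τ < ε from hss this).le
  obtain ⟨h₂, hh₂, hbig⟩ : ∃ h > 0, ∀ τ ∈ Icc t (t + h), ε < r x τ := by
    have hU : {τ | ε < r x τ} ∈ 𝓝 t :=
      (isOpen_lt continuous_const (continuous_uncurry_left hr x)).mem_nhds (by
        change r x t / 2 < r x t; linarith)
    obtain ⟨h, hh, hb⟩ := Metric.mem_nhds_iff.1 hU
    refine ⟨h / 2, half_pos hh, fun τ hτ => hb ?_⟩
    rw [Metric.mem_ball, Real.dist_eq, abs_of_nonneg (by linarith [hτ.1])]; linarith [hτ.2]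
  -- The last entry keeps the window [t, t + h] inside [0,T]; it is positive because t < T.
  set h := min (min h₁ h₂) (T - t) with hh
  have hh0 : 0 < h := lt_min (lt_min hh₁ hh₂) (by linarith)
  have hle₁ : h ≤ h₁ := (min_le_left _ _).trans (min_le_left _ _)
  have hle₂ : h ≤ h₂ := (min_le_left _ _).trans (min_le_right _ _)
  have hle₃ : h ≤ T - t := min_le_right _ _
  have hrx := fun x => continuous_uncurry_left hr x
  have hsplit : ∀ x t, ∫ τ in t..(t + h), r x τ
      = (∫ τ in (0 : ℝ)..(t + h), r x τ) - ∫ τ in (0 : ℝ)..t, r x τ := fun x t => by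
    rw [intervalIntegral.integral_interval_sub_left ((hrx x).intervalIntegrable _ _)
      ((hrx x).intervalIntegrable _ _)]
  have hle : ∀ x t c, (∀ τ ∈ Icc t (t + h), r x τ ≤ c) → ∫ τ in t..(t + h), r x τ ≤ h * c := by
    intro x t c hc
    have := intervalIntegral.integral_mono_on (show t ≤ t + h by linarith)
      ((hrx x).intervalIntegrable (μ := volume) _ _)
      (continuous_const.intervalIntegrable _ _) hc
    simpa using this
  -- The averages ∫_t^{t+h} r are classical subsolutions: their t-derivative is an increment of r,
  -- their second x-derivative the same increment of R2. Initial and boundary values are at most hε,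
  -- but the average at (x,t) exceeds hε.
  have key := classical_maximum_principle (q := q) (S := T - h) (k := h * ε) hq
    (f := fun x t => ∫ τ in t..(t + h), r x τ) (ft := fun x t => r x (t + h) - r x t)
    (fx := fun x t => R1 x (t + h) - R1 x t) (fxx := fun x t => R2 x (t + h) - R2 x t)
    ?_ ?_ ?_ ?_ ?_ ?_ ?_ ?_ x hx t ⟨ht, by linarith⟩
  · have h4 : h * ε < ∫ τ in t..(t + h), r x τ := by
      have := intervalIntegral.integral_lt_integral_of_continuousOn_of_le_of_exists_lt
        (show t < t + h by linarith) (continuousOn_const (c := ε)) (hrx x).continuousOn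
        (fun τ hτ => (hbig τ ⟨hτ.1.le, by linarith [hτ.2]⟩).le)
        ⟨t, ⟨le_rfl, by linarith⟩, hbig t ⟨le_rfl, by linarith⟩⟩
      simpa using this
    exact absurd key h4.not_ge
  · refine Continuous.continuousOn ?_
    have hp : Continuous fun z : ℝ × ℝ => ∫ τ in (0 : ℝ)..(z.2 + h), r z.1 τ :=
      intervalIntegral.continuous_parametric_intervalIntegral_of_continuous
        (f := fun (z : ℝ × ℝ) τ => r z.1 τ)
        (hr.comp ((continuous_fst.comp continuous_fst).prodMk continuous_snd)) (by fun_prop)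
    have hp' : Continuous fun z : ℝ × ℝ => ∫ τ in (0 : ℝ)..z.2, r z.1 τ :=
      intervalIntegral.continuous_parametric_intervalIntegral_of_continuous
        (f := fun (z : ℝ × ℝ) τ => r z.1 τ)
        (hr.comp ((continuous_fst.comp continuous_fst).prodMk continuous_snd)) (by fun_prop)
    exact (hp.sub hp').congr fun z => (hsplit z.1 z.2).symm
  · intro x hx t ht
    have e1 := (hasDerivWithinAt_integral_right (hrx x) 0 (t + h) univ)
    have e2 := (e1.hasDerivAt univ_mem).comp_add_const t h
    have e3 := (e2.hasDerivWithinAt (s := Icc 0 (T - h))).sub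
      (hasDerivWithinAt_integral_right (hrx x) 0 t (Icc 0 (T - h)))
    exact e3.congr (fun s _ => hsplit x s) (hsplit x t)
  · intro x hx t ht
    exact ((hR1 x hx (t + h) ⟨by linarith [ht.1], by linarith [ht.2]⟩).sub
      (hR1 x hx t ⟨ht.1, by linarith [ht.2]⟩)).congr (fun s _ => hsplit s t) (hsplit x t)
  · intro x hx t ht
    exact (hR2 x hx (t + h) ⟨by linarith [ht.1], by linarith [ht.2]⟩).sub
      (hR2 x hx t ⟨ht.1, by linarith [ht.2]⟩)
  · intro x hx t ht
    have a1 := hsub x hx t (t + h) ht.1 (by linarith) (by linarith [ht.2])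
    linarith
  · intro t ht
    exact (hle 0 t 0 fun τ hτ => h0 τ ⟨ht.1.trans hτ.1, by linarith [hτ.2, ht.2]⟩).trans
      (by rw [mul_zero]; positivity)
  · intro t ht
    exact (hle 1 t 0 fun τ hτ => h1 τ ⟨ht.1.trans hτ.1, by linarith [hτ.2, ht.2]⟩).trans
      (by rw [mul_zero]; positivity)
  · intro y hy
    exact hle y 0 ε fun τ hτ => hsmall y hy τ ⟨hτ.1, by linarith [hτ.2]⟩

/-! ### Boundary decay from quadratic barriers -/

theorem HeatJet.neg {q : ℝ} {N : ℕ} {g : ℕ → ℝ → ℝ → ℝ} (hg : HeatJet q N g) :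
    HeatJet q N fun i x t => -g i x t where
  cont i hi := (hg.cont i hi).neg
  space i hi t ht x hx := (hg.space i hi t ht x hx).neg
  flux x hx t ht := by
    have h := (hg.flux x hx t ht).neg
    simp only [intervalIntegral.integral_neg]
    exact h.congr_deriv (by ring)

theorem integral_exp_neg_mul {lam : ℝ} (hlam : 0 < lam) (s t : ℝ) :
    ∫ τ in s..t, Real.exp (-lam * τ) = lam⁻¹ * (Real.exp (-lam * s) - Real.exp (-lam * t)) := by
  rw [intervalIntegral.integral_comp_mul_left (fun x => Real.exp x) (neg_ne_zero.2 hlam.ne'),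
    integral_exp, smul_eq_mul, inv_neg]
  ring

/-- Comparison of a solution of the heat equation with the supersolution
`h(t) + M e^{-λt} (b₀ + b₁ x - x²)`. -/
theorem HeatJet.le_barrier {q lam M b₀ b₁ T : ℝ} {N i : ℕ} {g : ℕ → ℝ → ℝ → ℝ} {h : ℝ → ℝ}
    (hg : HeatJet q N g) (hq : 0 < q) (hlam : 0 < lam) (hM : 0 ≤ M) (hi : i + 1 ≤ N)
    (hh : Continuous h)
    (hb : ∀ x ∈ Icc (0 : ℝ) 1, b₀ + b₁ * x - x ^ 2 ≤ 1)
    (hh' : ∀ s t, 0 ≤ s → s ≤ t → t ≤ T →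
      h s - h t ≤ M * (2 * q * lam⁻¹ - 1) * (Real.exp (-lam * s) - Real.exp (-lam * t)))
    (h0 : ∀ t ∈ Icc 0 T, g i 0 t ≤ h t + M * Real.exp (-lam * t) * b₀)
    (h1 : ∀ t ∈ Icc 0 T, g i 1 t ≤ h t + M * Real.exp (-lam * t) * (b₀ + b₁ - 1))
    (hini : ∀ x ∈ Icc (0 : ℝ) 1, g i x 0 ≤ h 0 + M * (b₀ + b₁ * x - x ^ 2))
    {x t : ℝ} (hx : x ∈ Icc (0 : ℝ) 1) (ht : t ∈ Icc 0 T) :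
    g i x t ≤ h t + M * Real.exp (-lam * t) * (b₀ + b₁ * x - x ^ 2) := by
  have hgc := hg.cont i (by omega)
  set r : ℝ → ℝ → ℝ := fun x t =>
    g i x t - (h t + M * Real.exp (-lam * t) * (b₀ + b₁ * x - x ^ 2)) with hr
  have hrc : Continuous (Function.uncurry r) :=
    hgc.sub (((hh.comp continuous_snd).add (by fun_prop)))
  have hint : ∀ x t, ∫ τ in (0 : ℝ)..t, r x τ = (∫ τ in (0 : ℝ)..t, g i x τ)
      - ((∫ τ in (0 : ℝ)..t, h τ)
        + M * (∫ τ in (0 : ℝ)..t, Real.exp (-lam * τ)) * (b₀ + b₁ * x - x ^ 2)) := by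
    intro x t
    rw [intervalIntegral.integral_sub ((continuous_uncurry_left hgc x).intervalIntegrable _ _)
      (Continuous.intervalIntegrable (by fun_prop) _ _), intervalIntegral.integral_add
      (hh.intervalIntegrable _ _) (Continuous.intervalIntegrable (by fun_prop) _ _),
      intervalIntegral.integral_mul_const, intervalIntegral.integral_const_mul]
  -- The weak maximum principle needs room after t. The endpoint T follows by continuity, or from
  -- the initial bound when T = 0.
  suffices H : ∀ t ∈ Ico 0 T, r x t ≤ 0 by
    have hcl : IsClosed {t | r x t ≤ 0} :=
      isClosed_le (continuous_uncurry_left hrc x) continuous_const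
    rcases eq_or_ne (0 : ℝ) T with hT | hT
    · have : t = 0 := le_antisymm (hT ▸ ht.2) ht.1
      subst this
      simpa using hini x hx
    · have h2 := hcl.closure_subset_iff.2 H
      rw [closure_Ico hT] at h2
      have h3 : r x t ≤ 0 := h2 ht
      simp only [hr] at h3
      linarith
  intro t ht
  refine weak_maximum_principle hq (T := T) hrc
    (R1 := fun x t => (∫ τ in (0 : ℝ)..t, g (i + 1) x τ)
      - M * (∫ τ in (0 : ℝ)..t, Real.exp (-lam * τ)) * (b₁ - 2 * x))
    (R2 := fun x t => q⁻¹ * (g i x t - g i x 0)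
      + 2 * M * ∫ τ in (0 : ℝ)..t, Real.exp (-lam * τ)) ?_ ?_ ?_ ?_ ?_ ?_ hx ht.1 ht.2
  · intro x hx t ht
    have hb : HasDerivWithinAt (fun x : ℝ => b₀ + b₁ * x - x ^ 2) (b₁ - 2 * x) (Icc 0 1) x := by
      have e1 := ((hasDerivAt_id x).const_mul b₁).const_add b₀
      have e2 := e1.sub (hasDerivAt_pow 2 x)
      exact e2.hasDerivWithinAt.congr_deriv (by simp)
    have hd := (hg.hasDerivWithinAt_integral_space hi ht.1 hx).sub
      ((hb.const_mul (M * ∫ τ in (0 : ℝ)..t, Real.exp (-lam * τ))).const_add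
        (∫ τ in (0 : ℝ)..t, h τ))
    exact hd.congr (fun y _ => hint y t) (hint x t)
  · intro x hx t ht
    have hb : HasDerivWithinAt (fun x : ℝ => b₁ - 2 * x) (-2) (Icc 0 1) x := by
      have e1 := ((hasDerivAt_id x).const_mul 2).const_sub b₁
      exact e1.hasDerivWithinAt.congr_deriv (by simp)
    exact ((hg.hasDerivWithinAt_integral hq hi ht.1 hx).sub (hb.const_mul _)).congr_deriv
      (by ring)
  -- The comparison function is a supersolution: -q∂ₓ² yields 2qM e^{-λt}, while the decay of the
  -- exponential costs at most λM e^{-λt} because the polynomial is at most 1. Hypothesis `hh'` is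
  -- the time-integrated statement that h falls no faster than the difference allows.
  · intro x hx s t hs hst htT
    have e1 := hh' s t hs hst htT
    have e2 := hb x hx
    have e3 : Real.exp (-lam * t) ≤ Real.exp (-lam * s) := Real.exp_le_exp.2 (by nlinarith)
    simp only [hr, integral_exp_neg_mul hlam]
    have e4 : 0 ≤ M * (Real.exp (-lam * s) - Real.exp (-lam * t))
        * (1 - (b₀ + b₁ * x - x ^ 2)) :=
      mul_nonneg (mul_nonneg hM (by linarith)) (by linarith)
    have e5 : q * (q⁻¹ * (g i x t - g i x 0)
        + 2 * M * (lam⁻¹ * (Real.exp (-lam * 0) - Real.exp (-lam * t)))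
        - (q⁻¹ * (g i x s - g i x 0)
          + 2 * M * (lam⁻¹ * (Real.exp (-lam * 0) - Real.exp (-lam * s)))))
        = g i x t - g i x s + M * (2 * q * lam⁻¹) *
          (Real.exp (-lam * s) - Real.exp (-lam * t)) := by
      field_simp
      ring
    rw [e5]
    nlinarith
  · intro t ht
    have := h0 t ht
    simp only [hr]
    linarith
  · intro t ht
    have := h1 t ht
    simp only [hr]
    linarith
  · intro x hx
    have := hini x hx
    simp only [hr, mul_zero, Real.exp_zero, mul_one]
    linarith

theorem abs_deriv_le_of_abs_sub_le {f : ℝ → ℝ} {f' a C : ℝ} (ha : a ∈ Icc (0 : ℝ) 1)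
    (hf : HasDerivWithinAt f f' (Icc 0 1) a)
    (h : ∀ x ∈ Icc (0 : ℝ) 1, |f x - f a| ≤ C * |x - a|) : |f'| ≤ C := by
  have hne : (𝓝[Icc 0 1 \ {a}] a).NeBot := by
    have := uniqueDiffWithinAt_iff_accPt.1 (uniqueDiffOn_Icc (zero_lt_one (α := ℝ)) a ha)
    rwa [accPt_principal_iff_nhdsWithin] at this
  have hs := (hasDerivWithinAt_iff_tendsto_slope.1 hf).abs
  refine le_of_tendsto hs ?_
  filter_upwards [self_mem_nhdsWithin] with x hx
  have hpos : 0 < |x - a| := abs_pos.2 (sub_ne_zero.2 hx.2)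
  rw [slope_def_field, abs_div, div_le_iff₀ hpos]
  exact h x hx.1

/-- Decay of a solution of the heat equation that vanishes at `x = 0`, from the decay of its
boundary values at `x = 1`. -/
theorem HeatJet.abs_le_of_boundary {q lam M T : ℝ} {N i : ℕ} {g : ℕ → ℝ → ℝ → ℝ}
    (hg : HeatJet q N g) (hq : 0 < q) (hlam : 0 < lam) (hlq : lam ≤ q) (hM : 0 ≤ M)
    (hi : i + 1 ≤ N) (h0 : ∀ t, 0 ≤ t → g i 0 t = 0)
    (h1 : ∀ t ∈ Icc 0 T, |g i 1 t| ≤ M * Real.exp (-lam * t))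
    (hini : ∀ x ∈ Icc (0 : ℝ) 1, |g i x 0| ≤ M * x)
    {x t : ℝ} (hx : x ∈ Icc (0 : ℝ) 1) (ht : t ∈ Icc 0 T) :
    |g i x t| ≤ M * Real.exp (-lam * t) * (2 * x - x ^ 2) := by
  have hl : 1 ≤ 2 * q * lam⁻¹ := by
    rw [← div_eq_mul_inv, le_div_iff₀ hlam]; linarith
  have aux : ∀ g : ℕ → ℝ → ℝ → ℝ, HeatJet q N g → (∀ t, 0 ≤ t → g i 0 t = 0) →
      (∀ t ∈ Icc 0 T, g i 1 t ≤ M * Real.exp (-lam * t)) →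
      (∀ x ∈ Icc (0 : ℝ) 1, g i x 0 ≤ M * x) →
      g i x t ≤ M * Real.exp (-lam * t) * (2 * x - x ^ 2) := by
    intro g hg h0 h1 hini
    -- The profile 2x - x² vanishes at 0, equals 1 at 1 and dominates x on [0,1].
    have := hg.le_barrier (h := fun _ => 0) (b₀ := 0) (b₁ := 2) (T := T) hq hlam hM hi
      continuous_const (fun x _ => by nlinarith [sq_nonneg (x - 1)])
      (fun s t hs hst htT => by
        have e3 : Real.exp (-lam * t) ≤ Real.exp (-lam * s) := Real.exp_le_exp.2 (by nlinarith)
        rw [sub_self]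
        exact mul_nonneg (mul_nonneg hM (by linarith)) (by linarith))
      (fun t ht => by simp [h0 t ht.1])
      (fun t ht => (h1 t ht).trans (le_of_eq (by ring)))
      (fun x hx => (hini x hx).trans (by nlinarith [mul_nonneg hM (mul_nonneg hx.1 (sub_nonneg.2 hx.2))]))
      hx ht
    simpa using this
  refine abs_le.2 ⟨?_, aux g hg h0 (fun t ht => (le_abs_self _).trans (h1 t ht))
    (fun x hx => (le_abs_self _).trans (hini x hx))⟩
  have := aux _ hg.neg (fun t ht => by simp [h0 t ht])
    (fun t ht => (neg_le_abs _).trans (h1 t ht)) (fun x hx => (neg_le_abs _).trans (hini x hx))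
  linarith

/-- The solution lies between ± M e^{-λt}(2x - x²), which vanish at x = 0 and have slope ± 2M
e^{-λt} there. -/
theorem HeatJet.abs_deriv_zero_le {q lam M T : ℝ} {N i : ℕ} {g : ℕ → ℝ → ℝ → ℝ}
    (hg : HeatJet q N g) (hq : 0 < q) (hlam : 0 < lam) (hlq : lam ≤ q) (hM : 0 ≤ M)
    (hi : i + 1 ≤ N) (h0 : ∀ t, 0 ≤ t → g i 0 t = 0)
    (h1 : ∀ t ∈ Icc 0 T, |g i 1 t| ≤ M * Real.exp (-lam * t))
    (hini : ∀ x ∈ Icc (0 : ℝ) 1, |g i x 0| ≤ M * x) {t : ℝ} (ht : t ∈ Icc 0 T) :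
    |g (i + 1) 0 t| ≤ 2 * M * Real.exp (-lam * t) := by
  refine abs_deriv_le_of_abs_sub_le (by simp) (hg.space i (by omega) t ht.1 0 (by simp)) ?_
  intro x hx
  rw [h0 t ht.1, sub_zero, sub_zero, abs_of_nonneg hx.1]
  refine (hg.abs_le_of_boundary hq hlam hlq hM hi h0 h1 hini hx ht).trans ?_
  have : 0 ≤ M * Real.exp (-lam * t) := by positivity
  nlinarith [mul_nonneg this (sq_nonneg x)]

/-- Decay of the boundary derivative at `x = 1`, from the decay of the time derivative `η` of the
boundary values. -/
theorem HeatJet.abs_deriv_one_le {q lam M T : ℝ} {N i : ℕ} {g : ℕ → ℝ → ℝ → ℝ}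
    (hg : HeatJet q N g) (hq : 0 < q) (hlam : 0 < lam) (hlq : lam ≤ q) (hM : 0 ≤ M)
    (hi : i + 1 ≤ N) (h0 : ∀ t, 0 ≤ t → g i 0 t = 0)
    (h1 : ∀ t ∈ Icc 0 T, |g i 1 t| ≤ M * Real.exp (-lam * t))
    {η : ℝ → ℝ} (hη : ∀ t, 0 ≤ t → HasDerivWithinAt (g i 1) (η t) (Ici 0) t)
    (hη' : ∀ t ∈ Icc 0 T, |η t| ≤ q * M * Real.exp (-lam * t))
    (hini : ∀ x ∈ Icc (0 : ℝ) 1, |g i x 0 - g i 1 0| ≤ M * (1 - x)) {t : ℝ} (ht : t ∈ Icc 0 T) :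
    |g (i + 1) 1 t| ≤ 2 * M * Real.exp (-lam * t) := by
  have hgc := continuous_uncurry_left (hg.cont i (by omega)) 1
  -- Integrating the bound on η gives the factor q/λ, which is at most 2q/λ - 1 because λ ≤ q.
  have hdiff : ∀ s t, 0 ≤ s → s ≤ t → t ≤ T → |g i 1 t - g i 1 s|
      ≤ M * (2 * q * lam⁻¹ - 1) * (Real.exp (-lam * s) - Real.exp (-lam * t)) := by
    intro s t hs hst htT
    have hb := image_norm_le_of_norm_deriv_right_le_deriv_boundary
      (f := fun τ => g i 1 τ - g i 1 s) (f' := η) (a := s) (b := t)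
      (B := fun τ => q * M * lam⁻¹ * (Real.exp (-lam * s) - Real.exp (-lam * τ)))
      (B' := fun τ => q * M * Real.exp (-lam * τ))
      (hgc.sub continuous_const).continuousOn
      (fun τ hτ => ((hη τ (hs.trans hτ.1)).mono (Ici_subset_Ici.2 (hs.trans hτ.1))).sub_const _)
      (by simp)
      (fun τ => by
        have e1 := ((hasDerivAt_id τ).const_mul (-lam)).exp
        have e2 := (e1.const_sub (Real.exp (-lam * s))).const_mul (q * M * lam⁻¹)
        refine e2.congr_deriv ?_
        simp only [id]
        field_simp)
      (fun τ hτ => hη' τ ⟨hs.trans hτ.1, hτ.2.le.trans htT⟩) ⟨hst, le_rfl⟩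
    refine hb.trans ?_
    have e3 : Real.exp (-lam * t) ≤ Real.exp (-lam * s) := Real.exp_le_exp.2 (by nlinarith)
    refine mul_le_mul_of_nonneg_right ?_ (by linarith)
    have hl : 1 ≤ q * lam⁻¹ := by
      rw [← div_eq_mul_inv, le_div_iff₀ hlam]; linarith
    nlinarith
  have aux : ∀ g : ℕ → ℝ → ℝ → ℝ, HeatJet q N g → (∀ t, 0 ≤ t → g i 0 t = 0) →
      (∀ t ∈ Icc 0 T, |g i 1 t| ≤ M * Real.exp (-lam * t)) →
      (∀ s t, 0 ≤ s → s ≤ t → t ≤ T → |g i 1 t - g i 1 s|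
        ≤ M * (2 * q * lam⁻¹ - 1) * (Real.exp (-lam * s) - Real.exp (-lam * t))) →
      (∀ x ∈ Icc (0 : ℝ) 1, |g i x 0 - g i 1 0| ≤ M * (1 - x)) →
      ∀ x ∈ Icc (0 : ℝ) 1,
      g i x t ≤ g i 1 t + M * Real.exp (-lam * t) * (1 - x ^ 2) := by
    intro g hg h0 h1 hdiff hini x hx
    -- This barrier touches the solution at x = 1 with slope -2M e^{-λt}, and is nonnegative at x =
    -- 0 by the bound on the values at x = 1.
    have := hg.le_barrier (h := g i 1) (b₀ := 1) (b₁ := 0) (T := T) hq hlam hM hi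
      (continuous_uncurry_left (hg.cont i (by omega)) 1) (fun x _ => by nlinarith [sq_nonneg x])
      (fun s t hs hst htT => (le_abs_self _).trans ((abs_sub_comm _ _).le.trans (hdiff s t hs hst htT)))
      (fun t ht => by rw [h0 t ht.1]; linarith [(abs_le.1 (h1 t ht)).1])
      (fun t ht => by simp)
      (fun x hx => by
        have e1 := (abs_le.1 (hini x hx)).2
        nlinarith [mul_nonneg hM (mul_nonneg hx.1 (sub_nonneg.2 hx.2))])
      hx ht
    simpa using this
  refine abs_deriv_le_of_abs_sub_le (by simp) (hg.space i (by omega) t ht.1 1 (by simp)) ?_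
  intro x hx
  have a1 := aux g hg h0 h1 hdiff hini x hx
  have a2 := aux _ hg.neg (fun t ht => by simp [h0 t ht]) (fun t ht => by simpa using h1 t ht)
    (fun s t hs hst htT => by
      have := hdiff s t hs hst htT
      rwa [abs_sub_comm, ← neg_sub_neg] at this)
    (fun x hx => by
      have := hini x hx
      rw [← abs_neg] at this
      exact (le_of_eq (by congr 1; ring)).trans this) x hx
  have hE : 0 ≤ M * Real.exp (-lam * t) := by positivity
  rw [abs_of_nonpos (by linarith [hx.2] : x - 1 ≤ 0)]
  have hq2 : M * Real.exp (-lam * t) * (1 - x ^ 2) ≤ 2 * M * Real.exp (-lam * t) * -(x - 1) := by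
    nlinarith [mul_nonneg hE (mul_self_nonneg (1 - x))]
  exact abs_le.2 ⟨by linarith, by linarith⟩

/-! ### Exponential estimates for ordinary differential equations -/

/-- The integrating factor e^{-zt} leaves only the forcing, which then grows at most like e^{νt}
with ν = -Re z - λ ≥ μ - λ > 0; integrating costs a factor 1/ν. -/
theorem norm_le_of_hasDerivWithinAt_smul_add {E : Type*} [NormedAddCommGroup E] [NormedSpace ℂ E]
    {z : ℂ} {lam mu N T : ℝ} (hz : z.re ≤ -mu) (hlam : lam < mu) {f g : ℝ → E}
    (hf : ∀ t, 0 ≤ t → HasDerivWithinAt f (z • f t + g t) (Ici 0) t)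
    (hg : ∀ t ∈ Icc 0 T, ‖g t‖ ≤ N * Real.exp (-lam * t)) {t : ℝ} (ht : t ∈ Icc 0 T) :
    ‖f t‖ ≤ (‖f 0‖ + (mu - lam)⁻¹ * N) * Real.exp (-lam * t) := by
  have hN : 0 ≤ N := by
    have h := hg 0 ⟨le_rfl, ht.1.trans ht.2⟩
    simp only [mul_zero, Real.exp_zero, mul_one] at h
    exact (norm_nonneg _).trans h
  set ν := -z.re - lam with hν
  have hν0 : 0 < ν := by linarith
  have hexp : ∀ τ : ℝ, HasDerivAt (fun τ : ℝ => Complex.exp (-z * τ))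
      (Complex.exp (-z * τ) * -z) τ := fun τ => by
    have e1 : HasDerivAt (fun τ : ℝ => -z * (τ : ℂ)) (-z * 1) τ :=
      (Complex.ofRealCLM.hasDerivAt).const_mul _
    simpa using e1.cexp
  have hnorm : ∀ τ : ℝ, ‖Complex.exp (-z * τ)‖ = Real.exp (-z.re * τ) := fun τ => by
    rw [Complex.norm_exp]; simp
  have hd : ∀ τ : ℝ, 0 ≤ τ → HasDerivWithinAt (fun τ : ℝ => Complex.exp (-z * τ) • f τ)
      (Complex.exp (-z * τ) • g τ) (Ici 0) τ := by
    intro τ hτ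
    refine ((hexp τ).hasDerivWithinAt.smul (hf τ hτ)).congr_deriv ?_
    module
  have hb := image_norm_le_of_norm_deriv_right_le_deriv_boundary
    (f := fun τ : ℝ => Complex.exp (-z * τ) • f τ) (f' := fun τ : ℝ => Complex.exp (-z * τ) • g τ)
    (a := 0) (b := t) (B := fun τ => ‖f 0‖ + ν⁻¹ * N * (Real.exp (ν * τ) - 1))
    (B' := fun τ => N * Real.exp (ν * τ))
    (fun τ hτ => ((hd τ hτ.1).continuousWithinAt).mono Icc_subset_Ici_self)
    (fun τ hτ => (hd τ hτ.1).mono (Ici_subset_Ici.2 hτ.1))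
    (by simp)
    (fun τ => by
      have e1 := ((hasDerivAt_id τ).const_mul ν).exp
      refine (((e1.sub_const 1).const_mul (ν⁻¹ * N)).const_add ‖f 0‖).congr_deriv ?_
      simp only [id]
      field_simp)
    (fun τ hτ => by
      rw [norm_smul, hnorm]
      have := hg τ ⟨hτ.1, hτ.2.le.trans ht.2⟩
      calc Real.exp (-z.re * τ) * ‖g τ‖ ≤ Real.exp (-z.re * τ) * (N * Real.exp (-lam * τ)) := by
            gcongr
        _ = N * (Real.exp (-z.re * τ) * Real.exp (-lam * τ)) := by ring
        _ = N * Real.exp (ν * τ) := by rw [← Real.exp_add]; congr 2; rw [hν]; ring) ⟨ht.1, le_rfl⟩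
  simp only [norm_smul, hnorm] at hb
  have h1 : ‖f t‖ ≤ Real.exp (z.re * t) * (‖f 0‖ + ν⁻¹ * N * Real.exp (ν * t)) := by
    have e1 : Real.exp (z.re * t) * (Real.exp (-z.re * t) * ‖f t‖) = ‖f t‖ := by
      rw [← mul_assoc, ← Real.exp_add]; simp
    rw [← e1]
    gcongr
    refine hb.trans ?_
    have : 0 ≤ ν⁻¹ * N := by positivity
    nlinarith
  refine h1.trans ?_
  have e2 : Real.exp (z.re * t) * Real.exp (ν * t) = Real.exp (-lam * t) := by
    rw [← Real.exp_add]; congr 1; rw [hν]; ring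
  have e3 : Real.exp (z.re * t) ≤ Real.exp (-lam * t) :=
    Real.exp_le_exp.2 (by nlinarith [ht.1])
  have e4 : ν⁻¹ ≤ (mu - lam)⁻¹ := inv_anti₀ (by linarith) (by linarith)
  calc Real.exp (z.re * t) * (‖f 0‖ + ν⁻¹ * N * Real.exp (ν * t))
      = ‖f 0‖ * Real.exp (z.re * t) + ν⁻¹ * N * (Real.exp (z.re * t) * Real.exp (ν * t)) := by ring
    _ ≤ ‖f 0‖ * Real.exp (-lam * t) + (mu - lam)⁻¹ * N * Real.exp (-lam * t) := by
      rw [e2]; gcongr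
    _ = _ := by ring

/-- Input-to-state estimate for `f' = M f + g`, on trajectories annihilated by a product of factors
`M - z` with `Re z ≤ -μ`. -/
theorem exists_bound_of_prod_sub_eq_zero {E : Type*} [NormedAddCommGroup E] [NormedSpace ℂ E]
    (M : E →L[ℂ] E) {lam mu : ℝ} (hlam : lam < mu) (l : List ℂ) (hl : ∀ z ∈ l, z.re ≤ -mu) :
    ∃ C : ℝ, 0 ≤ C ∧ ∀ (f g : ℝ → E) (N T : ℝ),
      (∀ t, 0 ≤ t → HasDerivWithinAt f (M (f t) + g t) (Ici 0) t) →
      (∀ t, 0 ≤ t → (l.map fun z => M - algebraMap ℂ (E →L[ℂ] E) z).prod (f t) = 0) →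
      (∀ t ∈ Icc 0 T, ‖g t‖ ≤ N * Real.exp (-lam * t)) →
      ∀ t ∈ Icc 0 T, ‖f t‖ ≤ C * (‖f 0‖ + N) * Real.exp (-lam * t) := by
  induction l with
  | nil =>
    refine ⟨0, le_rfl, fun f g N T _ h0 _ t ht => ?_⟩
    have := h0 t ht.1
    simp only [List.map_nil, List.prod_nil, one_apply_eq_self] at this
    simp [this]
  | cons z l ih =>
    obtain ⟨C, hC, hb⟩ := ih fun z hz => hl z (List.mem_cons_of_mem _ hz)
    -- With A = M - z the equation reads f' = z f + (A f + g). Here A f solves the original equation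
    -- with forcing A g and is annihilated by the remaining factors, since everything commutes, so
    -- the induction hypothesis bounds A f. The gap λ < μ prevents polynomial factors in t.
    set A := M - algebraMap ℂ (E →L[ℂ] E) z with hA
    refine ⟨1 + (mu - lam)⁻¹ * (C * ‖A‖ + 1), ?_, fun f g N T hf h0 hg t ht => ?_⟩
    · have : 0 < mu - lam := by linarith
      positivity
    have hN : 0 ≤ N := by
      have h := hg 0 ⟨le_rfl, ht.1.trans ht.2⟩
      simp only [mul_zero, Real.exp_zero, mul_one] at h
      exact (norm_nonneg _).trans h
    have hAM : Commute A M :=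
      (Commute.refl M).sub_left (Algebra.commutes z M)
    have h1 := hb (fun t => A (f t)) (fun t => A (g t)) (‖A‖ * N) T
      (fun t ht => by
        have := (A.restrictScalars ℝ).hasFDerivAt.comp_hasDerivWithinAt t (hf t ht)
        refine this.congr_deriv ?_
        have e := congrArg (fun B : E →L[ℂ] E => B (f t)) hAM.eq
        simp only [mul_apply_eq_comp] at e
        simp [map_add, e])
      (fun t ht => by
        have hcomm : Commute A (l.map fun z => M - algebraMap ℂ (E →L[ℂ] E) z).prod := by
          refine Commute.list_prod_right _ _ fun B hB => ?_
          obtain ⟨w, -, rfl⟩ := List.mem_map.1 hB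
          exact hAM.sub_right (Algebra.commutes w A).symm
        have := h0 t ht
        rw [List.map_cons, List.prod_cons, hcomm.eq] at this
        exact this)
      (fun t ht => (A.le_opNorm _).trans (by
        rw [mul_assoc]
        exact mul_le_mul_of_nonneg_left (hg t ht) (norm_nonneg _)))
    have h2 := norm_le_of_hasDerivWithinAt_smul_add (T := T) (f := f)
      (g := fun t => A (f t) + g t) (N := C * ‖A‖ * (‖f 0‖ + N) + N)
      (hl z (List.mem_cons_self)) hlam
      (fun t ht => (hf t ht).congr_deriv (by
        simp only [hA, sub_apply, ContinuousLinearMap.algebraMap_apply]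
        abel))
      (fun t ht => by
        refine (norm_add_le _ _).trans ?_
        rw [add_mul]
        refine add_le_add ((h1 t ht).trans ?_) (hg t ht)
        refine mul_le_mul_of_nonneg_right ?_ (Real.exp_pos _).le
        have := A.le_opNorm (f 0)
        nlinarith [norm_nonneg A]) ht
    refine h2.trans (mul_le_mul_of_nonneg_right ?_ (Real.exp_pos _).le)
    have h3 : 0 < (mu - lam)⁻¹ := inv_pos.2 (by linarith)
    have h4 := norm_nonneg (f 0)
    nlinarith [mul_nonneg h3.le h4]

theorem exists_pos_forall_re_le (l : List ℂ) (hl : ∀ z ∈ l, z.re < 0) :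
    ∃ mu : ℝ, 0 < mu ∧ ∀ z ∈ l, z.re ≤ -mu := by
  induction l with
  | nil => exact ⟨1, one_pos, by simp⟩
  | cons z l ih =>
    obtain ⟨mu, hmu, h⟩ := ih fun z hz => hl z (List.mem_cons_of_mem _ hz)
    have hz := hl z List.mem_cons_self
    refine ⟨min mu (-z.re), lt_min hmu (by linarith), fun w hw => ?_⟩
    rcases List.mem_cons.1 hw with rfl | hw
    · linarith [min_le_right mu (-w.re)]
    · linarith [h w hw, min_le_left mu (-z.re)]

/-- Input-to-state estimate for a Hurwitz matrix. -/
theorem exists_bound_of_isHurwitz {M : Matrix (Fin n) (Fin n) ℝ} (hM : IsHurwitz M) :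
    ∃ mu : ℝ, 0 < mu ∧ ∀ lam, lam < mu → ∃ C : ℝ, 0 ≤ C ∧
      ∀ (X g : ℝ → Fin n → ℝ) (N T : ℝ),
        (∀ t, 0 ≤ t → HasDerivWithinAt X (M *ᵥ X t + g t) (Ici 0) t) →
        (∀ t ∈ Icc 0 T, ‖g t‖ ≤ N * Real.exp (-lam * t)) →
        ∀ t ∈ Icc 0 T, ‖X t‖ ≤ C * (‖X 0‖ + N) * Real.exp (-lam * t) := by
  set Mc := M.map (algebraMap ℝ ℂ) with hMc
  set l := Mc.charpoly.roots.toList with hl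
  have hroots : ∀ z ∈ l, z.re < 0 := by
    intro z hz
    refine hM z ?_
    rw [hl, Multiset.mem_toList, Polynomial.mem_roots (Matrix.charpoly_monic _).ne_zero] at hz
    exact Matrix.mem_spectrum_of_isRoot_charpoly hz
  obtain ⟨mu, hmu, hre⟩ := exists_pos_forall_re_le l hroots
  refine ⟨mu, hmu, fun lam hlam => ?_⟩
  let Φ : Matrix (Fin n) (Fin n) ℂ →ₐ[ℂ] ((Fin n → ℂ) →L[ℂ] (Fin n → ℂ)) :=
    (Module.End.toContinuousLinearMap (Fin n → ℂ)).toAlgHom.comp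
      (Matrix.toLinAlgEquiv' (R := ℂ) (n := Fin n)).toAlgHom
  have hΦ : ∀ (B : Matrix (Fin n) (Fin n) ℂ) v, Φ B v = B *ᵥ v := fun B v => rfl
  -- Cayley–Hamilton with the characteristic polynomial split over ℂ: the product over its roots
  -- annihilates every trajectory, so no Jordan form enters.
  have hprod : (l.map fun z => Φ Mc - algebraMap ℂ _ z).prod = 0 := by
    have h1 : Mc.charpoly = (l.map fun a => Polynomial.X - Polynomial.C a).prod := by
      have := (IsAlgClosed.splits Mc.charpoly).eq_prod_roots_of_monic (Matrix.charpoly_monic _)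
      rw [hl, ← Multiset.prod_coe, ← Multiset.map_coe, Multiset.coe_toList]
      exact this
    have h2 := congrArg (Φ.comp (Polynomial.aeval Mc)) h1
    rw [map_list_prod, List.map_map, AlgHom.comp_apply, Matrix.aeval_self_charpoly, map_zero] at h2
    rw [h2]
    congr 1
    refine List.map_congr_left fun z _ => ?_
    simp
  obtain ⟨C, hC, hb⟩ := exists_bound_of_prod_sub_eq_zero (Φ Mc) hlam l hre
  refine ⟨C, hC, fun X g N T hX hg t ht => ?_⟩
  let ι : (Fin n → ℝ) → (Fin n → ℂ) := fun v j => (v j : ℂ)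
  have hι : ∀ v, ‖ι v‖ = ‖v‖ := fun v => by
    simp [ι, Pi.norm_def]
  have := hb (fun t => ι (X t)) (fun t => ι (g t)) N T
    (fun t ht => by
      refine hasDerivWithinAt_pi.2 fun j => ?_
      have h1 := (hasDerivWithinAt_pi.1 (hX t ht) j)
      have h2 := (Complex.ofRealCLM.hasFDerivAt).comp_hasDerivWithinAt t h1
      refine h2.congr_deriv ?_
      simp [hΦ, ι, hMc, Matrix.mulVec, dotProduct])
    (fun t ht => by rw [hprod]; rfl)
    (fun t ht => by rw [hι]; exact hg t ht) t ht
  simpa only [hι] using this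

/-- Lyapunov estimate for the chain `y_i' = y_{i+1} - y_{i-1} - c_i y_i` with disturbance `G` in
the last equation. -/
theorem sum_sq_le_of_chain {k : ℕ} {c : ℕ → ℝ} {cm lam N T : ℝ} {y : ℕ → ℝ → ℝ} {G : ℝ → ℝ}
    (hlam : 0 < lam) (hcm : 3 * lam ≤ cm) (hc : ∀ i < k, 3 * lam ≤ 2 * c (i + 1))
    (hy0 : ∀ t, y 0 t = 0)
    (hy : ∀ i < k, ∀ t, 0 ≤ t → HasDerivWithinAt (y (i + 1))
      (y (i + 2) t - y i t - c (i + 1) * y (i + 1) t) (Ici 0) t)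
    (hyk : ∀ t, 0 ≤ t → HasDerivWithinAt (y (k + 1))
      (-y k t - cm * y (k + 1) t + G t) (Ici 0) t)
    (hG : ∀ t ∈ Icc 0 T, |G t| ≤ N * Real.exp (-lam * t)) {t : ℝ} (ht : t ∈ Icc 0 T) :
    ∑ i ∈ Finset.range (k + 1), y (i + 1) t ^ 2
      ≤ (∑ i ∈ Finset.range (k + 1), y (i + 1) 0 ^ 2 + N ^ 2 / (lam * cm))
        * Real.exp (-lam * t) ^ 2 := by
  have hcm0 : 0 < cm := by linarith
  set V : ℝ → ℝ := fun t => ∑ i ∈ Finset.range (k + 1), y (i + 1) t ^ 2 with hV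
  set V' : ℝ → ℝ := fun t => ∑ i ∈ Finset.range k, 2 * y (i + 1) t *
    (y (i + 2) t - y i t - c (i + 1) * y (i + 1) t)
      + 2 * y (k + 1) t * (-y k t - cm * y (k + 1) t + G t) with hV'
  have hVd : ∀ t, 0 ≤ t → HasDerivWithinAt V (V' t) (Ici 0) t := by
    intro t ht
    simp only [hV, Finset.sum_range_succ]
    refine HasDerivWithinAt.add (HasDerivWithinAt.fun_sum fun i hi => ?_) ?_
    · exact ((hy i (Finset.mem_range.1 hi) t ht).pow 2).congr_deriv (by simp)
    · exact ((hyk t ht).pow 2).congr_deriv (by simp)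
  have hVle : ∀ t, V' t ≤ -(3 * lam) * V t + G t ^ 2 / cm := by
    intro t
    -- The couplings are skew, so they telescope; the remaining y_k y_{k+1} is cancelled by the last
    -- equation.
    have h1 : ∑ i ∈ Finset.range k, y (i + 1) t * (y (i + 2) t - y i t) = y k t * y (k + 1) t := by
      have := Finset.sum_range_sub (fun i => y i t * y (i + 1) t) k
      simp only [hy0, zero_mul, sub_zero] at this
      rw [← this]
      exact Finset.sum_congr rfl fun i _ => by ring
    have h2 : ∑ i ∈ Finset.range k, 2 * y (i + 1) t *
        (y (i + 2) t - y i t - c (i + 1) * y (i + 1) t)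
        = 2 * (y k t * y (k + 1) t) - ∑ i ∈ Finset.range k, 2 * c (i + 1) * y (i + 1) t ^ 2 := by
      rw [← h1, Finset.mul_sum, ← Finset.sum_sub_distrib]
      exact Finset.sum_congr rfl fun i _ => by ring
    have h3 : ∑ i ∈ Finset.range k, 3 * lam * y (i + 1) t ^ 2
        ≤ ∑ i ∈ Finset.range k, 2 * c (i + 1) * y (i + 1) t ^ 2 :=
      Finset.sum_le_sum fun i hi =>
        mul_le_mul_of_nonneg_right (hc i (Finset.mem_range.1 hi)) (sq_nonneg _)
    -- Young's inequality spends half of the damping 2 c_m y² on G; the other half provides the rate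
    -- 3λ.
    have h4 : 2 * y (k + 1) t * G t ≤ cm * y (k + 1) t ^ 2 + G t ^ 2 / cm := by
      have h5 : 0 ≤ (cm * y (k + 1) t - G t) ^ 2 / cm := by positivity
      have h6 : (cm * y (k + 1) t - G t) ^ 2 / cm
          = cm * y (k + 1) t ^ 2 + G t ^ 2 / cm - 2 * y (k + 1) t * G t := by
        field_simp; ring
      linarith
    simp only [hV, hV', h2, Finset.sum_range_succ, mul_add, Finset.mul_sum] at h3 ⊢
    have h7 : 3 * lam * y (k + 1) t ^ 2 ≤ cm * y (k + 1) t ^ 2 :=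
      mul_le_mul_of_nonneg_right hcm (sq_nonneg _)
    simp only [neg_mul, Finset.sum_neg_distrib]
    linarith
  -- V decays at rate 3λ, faster than the rate 2λ of G², so integrating gives a factor 1/λ instead
  -- of t.
  have hb := image_le_of_deriv_right_le_deriv_boundary
    (f := fun τ => Real.exp (3 * lam * τ) * V τ)
    (f' := fun τ => Real.exp (3 * lam * τ) * (3 * lam) * V τ + Real.exp (3 * lam * τ) * V' τ)
    (a := 0) (b := t) (B := fun τ => V 0 + N ^ 2 / (lam * cm) * (Real.exp (lam * τ) - 1))
    (B' := fun τ => N ^ 2 / cm * Real.exp (lam * τ))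
    (fun τ hτ => ((Continuous.continuousWithinAt (by fun_prop)).mul
      ((hVd τ hτ.1).continuousWithinAt.mono Icc_subset_Ici_self)))
    (fun τ hτ => by
      have e1 : HasDerivAt (fun τ => Real.exp (3 * lam * τ)) (Real.exp (3 * lam * τ) * (3 * lam)) τ := by
        simpa using ((hasDerivAt_id τ).const_mul (3 * lam)).exp
      exact e1.hasDerivWithinAt.mul ((hVd τ hτ.1).mono (Ici_subset_Ici.2 hτ.1)))
    (by simp)
    (fun τ hτ => by fun_prop)
    (fun τ hτ => by
      have e1 := ((hasDerivAt_id τ).const_mul lam).exp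
      have e2 := ((e1.sub_const 1).const_mul (N ^ 2 / (lam * cm))).const_add (V 0)
      refine e2.hasDerivWithinAt.congr_deriv ?_
      simp only [id]
      field_simp)
    (fun τ hτ => by
      have e1 := hVle τ
      have e2 : G τ ^ 2 ≤ (N * Real.exp (-lam * τ)) ^ 2 :=
        sq_le_sq' (by linarith [(abs_le.1 (hG τ ⟨hτ.1, hτ.2.le.trans ht.2⟩)).1])
          (abs_le.1 (hG τ ⟨hτ.1, hτ.2.le.trans ht.2⟩)).2
      have e3 : Real.exp (3 * lam * τ) * (Real.exp (-lam * τ)) ^ 2 = Real.exp (lam * τ) := by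
        rw [sq, ← Real.exp_add, ← Real.exp_add]; congr 1; ring
      calc Real.exp (3 * lam * τ) * (3 * lam) * V τ + Real.exp (3 * lam * τ) * V' τ
          = Real.exp (3 * lam * τ) * (3 * lam * V τ + V' τ) := by ring
        _ ≤ Real.exp (3 * lam * τ) * ((N * Real.exp (-lam * τ)) ^ 2 / cm) := by
          refine mul_le_mul_of_nonneg_left ?_ (Real.exp_pos _).le
          have := div_le_div_of_nonneg_right e2 hcm0.le
          linarith
        _ = N ^ 2 / cm * (Real.exp (3 * lam * τ) * (Real.exp (-lam * τ)) ^ 2) := by ring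
        _ = _ := by rw [e3]) ⟨ht.1, le_rfl⟩
  have h1 : V t = Real.exp (-(3 * lam) * t) * (Real.exp (3 * lam * t) * V t) := by
    rw [← mul_assoc, ← Real.exp_add]; simp
  have hV0 : 0 ≤ V 0 := Finset.sum_nonneg fun i _ => sq_nonneg _
  have h2 : Real.exp (-(3 * lam) * t) * Real.exp (lam * t) = Real.exp (-lam * t) ^ 2 := by
    rw [sq, ← Real.exp_add, ← Real.exp_add]; congr 1; ring
  have h3 : Real.exp (-(3 * lam) * t) ≤ Real.exp (-lam * t) ^ 2 := by
    rw [sq, ← Real.exp_add]; exact Real.exp_le_exp.2 (by nlinarith [ht.1])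
  change V t ≤ (V 0 + _) * _
  rw [h1]
  have hNn : 0 ≤ N ^ 2 / (lam * cm) := by positivity
  calc Real.exp (-(3 * lam) * t) * (Real.exp (3 * lam * t) * V t)
      ≤ Real.exp (-(3 * lam) * t) * (V 0 + N ^ 2 / (lam * cm) * (Real.exp (lam * t) - 1)) :=
        mul_le_mul_of_nonneg_left hb (Real.exp_pos _).le
    _ ≤ Real.exp (-(3 * lam) * t) * (V 0 + N ^ 2 / (lam * cm) * Real.exp (lam * t)) := by
        refine mul_le_mul_of_nonneg_left ?_ (Real.exp_pos _).le
        nlinarith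
    _ = V 0 * Real.exp (-(3 * lam) * t)
        + N ^ 2 / (lam * cm) * (Real.exp (-(3 * lam) * t) * Real.exp (lam * t)) := by ring
    _ ≤ V 0 * Real.exp (-lam * t) ^ 2 + N ^ 2 / (lam * cm) * Real.exp (-lam * t) ^ 2 := by
        rw [h2]; gcongr
    _ = _ := by ring

/-! ### Strong solutions as jets -/

instance : IsProbabilityMeasure unitMeasure :=
  ⟨by simp [unitMeasure]⟩

theorem abs_integral_le_eLpNorm {f : ℝ → ℝ} (hf : MemLp f 2 unitMeasure) {a b : ℝ}
    (ha : a ∈ Icc (0 : ℝ) 1) (hb : b ∈ Icc (0 : ℝ) 1) :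
    |∫ y in a..b, f y| ≤ (eLpNorm f 2 unitMeasure).toReal := by
  have h1 : MemLp f 1 unitMeasure := hf.mono_exponent (by norm_num)
  have hint : Integrable f unitMeasure := memLp_one_iff_integrable.1 h1
  have hsub : uIoc a b ⊆ Icc 0 1 := fun y hy =>
    (uIcc_subset_Icc ha hb) (uIoc_subset_uIcc hy)
  calc |∫ y in a..b, f y| = ‖∫ y in a..b, f y‖ := (Real.norm_eq_abs _).symm
    _ ≤ ∫ y in uIoc a b, ‖f y‖ := intervalIntegral.norm_integral_le_integral_norm_uIoc
    _ ≤ ∫ y in Icc 0 1, ‖f y‖ :=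
        setIntegral_mono_set hint.norm (Eventually.of_forall fun _ => norm_nonneg _)
          (LE.le.eventuallyLE hsub)
    _ = (eLpNorm f 1 unitMeasure).toReal := by
        rw [eLpNorm_one_eq_lintegral_enorm]
        exact integral_norm_eq_lintegral_enorm hint.1
    _ ≤ _ := ENNReal.toReal_mono hf.2.ne
        (eLpNorm_le_eLpNorm_of_exponent_le (by norm_num) hf.1)

theorem memLp_of_continuousOn {f : ℝ → ℝ} (hf : ContinuousOn f (Icc 0 1)) :
    MemLp f 2 unitMeasure := by
  obtain ⟨C, hC⟩ := isCompact_Icc.exists_bound_of_continuousOn hf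
  exact MemLp.of_bound (hf.aestronglyMeasurable measurableSet_Icc) C
    ((ae_restrict_iff' measurableSet_Icc).2 (Eventually.of_forall hC))

/-- Sobolev's inequality on the unit interval. -/
theorem abs_le_eLpNorm_add_eLpNorm {h h' : ℝ → ℝ} (hc : ContinuousOn h (Icc 0 1))
    (hh' : MemLp h' 2 unitMeasure)
    (hint : ∀ x ∈ Icc (0 : ℝ) 1, ∀ y ∈ Icc (0 : ℝ) 1, ∫ z in y..x, h' z = h x - h y)
    {x : ℝ} (hx : x ∈ Icc (0 : ℝ) 1) :
    |h x| ≤ (eLpNorm h 2 unitMeasure).toReal + (eLpNorm h' 2 unitMeasure).toReal := by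
  have hmem := memLp_of_continuousOn hc
  -- The bound |h x| ≤ |h y| + ‖h'‖ holds for every y; it is then averaged over y in [0,1].
  have h1 : ∀ y ∈ Icc (0 : ℝ) 1, |h x| - (eLpNorm h' 2 unitMeasure).toReal ≤ ‖h y‖ := by
    intro y hy
    have e1 := abs_integral_le_eLpNorm hh' hy hx
    rw [hint x hx y hy] at e1
    have e2 := abs_sub_abs_le_abs_sub (h x) (h y)
    rw [Real.norm_eq_abs]
    linarith
  have h2 := intervalIntegral.integral_mono_on (μ := volume) zero_le_one
    (continuous_const.intervalIntegrable _ _)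
    ((hc.norm.mono (by rw [uIcc_of_le zero_le_one])).intervalIntegrable) h1
  have h3 := (le_abs_self _).trans (abs_integral_le_eLpNorm hmem.norm (a := 0) (b := 1)
    (by simp) (by simp))
  rw [eLpNorm_norm] at h3
  simp only [intervalIntegral.integral_const, sub_zero, smul_eq_mul, one_mul] at h2
  linarith

theorem hasDerivWithinAt_dx {k i : ℕ} {f : ℝ → ℝ} (hf : ContDiffOn ℝ k f (Icc 0 1)) (hi : i < k)
    {x : ℝ} (hx : x ∈ Icc (0 : ℝ) 1) :
    HasDerivWithinAt (dx i f) (dx (i + 1) f x) (Icc 0 1) x := by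
  have h := (hf.differentiableOn_iteratedDerivWithin (m := i) (by exact_mod_cast hi)
    (uniqueDiffOn_Icc zero_lt_one)) x hx
  unfold dx
  rw [iteratedDerivWithin_succ]
  exact h.hasDerivWithinAt

theorem continuousOn_dx {k i : ℕ} {f : ℝ → ℝ} (hf : ContDiffOn ℝ k f (Icc 0 1)) (hi : i ≤ k) :
    ContinuousOn (dx i f) (Icc 0 1) :=
  hf.continuousOn_iteratedDerivWithin (by exact_mod_cast hi) (uniqueDiffOn_Icc zero_lt_one)

namespace MemH

variable {k i : ℕ} {f : ℝ → ℝ}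

theorem memLp_dx (hf : MemH (k + 1) f) (hi : i ≤ k + 1) : MemLp (dx i f) 2 unitMeasure := by
  rcases hi.lt_or_eq with hi | rfl
  · exact memLp_of_continuousOn (continuousOn_dx hf.1 (by omega))
  · exact hf.2.2

theorem integral_dx (hf : MemH (k + 1) f) (hi : i ≤ k) {x y : ℝ} (hx : x ∈ Icc (0 : ℝ) 1)
    (hy : y ∈ Icc (0 : ℝ) 1) : ∫ z in y..x, dx (i + 1) f z = dx i f x - dx i f y := by
  have hsub : uIcc y x ⊆ Icc 0 1 := uIcc_subset_Icc hy hx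
  rcases hi.lt_or_eq with hi | rfl
  · refine intervalIntegral.integral_eq_sub_of_hasDeriv_right
      ((continuousOn_dx hf.1 (by omega)).mono hsub) (fun z hz => ?_)
      (((continuousOn_dx hf.1 (by omega)).mono hsub).intervalIntegrable)
    have hz1 : z ∈ Ioo (0 : ℝ) 1 :=
      ⟨(le_min hy.1 hx.1).trans_lt hz.1, hz.2.trans_le (max_le hy.2 hx.2)⟩
    exact ((hasDerivWithinAt_dx hf.1 hi (Ioo_subset_Icc_self hz1)).hasDerivAt
      (Icc_mem_nhds hz1.1 hz1.2)).hasDerivWithinAt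
  -- At top order only absolute continuity is available; the one-sided and the ordinary derivative
  -- can differ only at the two end points.
  · have hac := hf.2.1.mono (c := y) (d := x) (by rwa [uIcc_of_le zero_le_one])
    rw [← hac.integral_deriv_eq_sub]
    refine intervalIntegral.integral_congr_ae ?_
    have hae : ∀ᵐ z : ℝ, z ≠ 0 ∧ z ≠ 1 := by
      filter_upwards [compl_mem_ae_iff.2 (measure_singleton (μ := volume) (0 : ℝ)),
        compl_mem_ae_iff.2 (measure_singleton (μ := volume) (1 : ℝ))] with z h0 h1 using ⟨h0, h1⟩
    filter_upwards [hae] with z hz hzx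
    have hz1 := hsub (uIoc_subset_uIcc hzx)
    have : Icc (0 : ℝ) 1 ∈ 𝓝 z :=
      Icc_mem_nhds (lt_of_le_of_ne hz1.1 (Ne.symm hz.1)) (lt_of_le_of_ne hz1.2 hz.2)
    rw [dx, iteratedDerivWithin_succ, derivWithin_of_mem_nhds this]
    rfl

end MemH

/-- The nearest point of `[0,1]`. -/
def clamp (x : ℝ) : ℝ := max 0 (min 1 x)

theorem clamp_mem (x : ℝ) : clamp x ∈ Icc (0 : ℝ) 1 :=
  ⟨le_max_left _ _, max_le zero_le_one (min_le_left _ _)⟩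

theorem clamp_of_mem {x : ℝ} (hx : x ∈ Icc (0 : ℝ) 1) : clamp x = x := by
  rw [clamp, min_eq_right hx.2, max_eq_right hx.1]

theorem continuous_clamp : Continuous clamp := by unfold clamp; fun_prop

/-- The `x`-derivatives of a function on `[0,1] × [0,∞)`, extended continuously to the plane. -/
def uJet (u : ℝ → ℝ → ℝ) (i : ℕ) (x t : ℝ) : ℝ := dx i (fun y => u y (max t 0)) (clamp x)

theorem uJet_of_mem (u : ℝ → ℝ → ℝ) (i : ℕ) {x t : ℝ} (hx : x ∈ Icc (0 : ℝ) 1) (ht : 0 ≤ t) :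
    uJet u i x t = dx i (fun y => u y t) x := by
  rw [uJet, clamp_of_mem hx, max_eq_left ht]

theorem uJet_zero (u : ℝ → ℝ → ℝ) {x t : ℝ} (hx : x ∈ Icc (0 : ℝ) 1) (ht : 0 ≤ t) :
    uJet u 0 x t = u x t := by
  rw [uJet_of_mem u 0 hx ht, dx, iteratedDerivWithin_zero]

/-- By Sobolev's inequality, L² convergence in time of the derivatives of orders i and i + 1 makes
the order i converge uniformly in x. -/
theorem continuous_uJet {k i : ℕ} {u : ℝ → ℝ → ℝ} (hu : ∀ t, 0 ≤ t → MemH (k + 1) fun x => u x t)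
    (hc : ∀ t, 0 ≤ t → ∀ i ≤ k + 1,
      Tendsto (fun s => eLpNorm (fun x => dx i (fun y => u y s) x - dx i (fun y => u y t) x)
        2 unitMeasure) (𝓝[Ici 0] t) (𝓝 0)) (hi : i ≤ k) :
    Continuous (Function.uncurry (uJet u i)) := by
  have hsup : ∀ t, 0 ≤ t → ∀ s, 0 ≤ s → ∀ x ∈ Icc (0 : ℝ) 1,
      |dx i (fun y => u y s) x - dx i (fun y => u y t) x|
        ≤ (eLpNorm (fun x => dx i (fun y => u y s) x - dx i (fun y => u y t) x)
            2 unitMeasure).toReal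
          + (eLpNorm (fun x => dx (i + 1) (fun y => u y s) x - dx (i + 1) (fun y => u y t) x)
            2 unitMeasure).toReal := by
    intro t ht s hs x hx
    refine abs_le_eLpNorm_add_eLpNorm
      (h := fun x => dx i (fun y => u y s) x - dx i (fun y => u y t) x)
      (h' := fun x => dx (i + 1) (fun y => u y s) x - dx (i + 1) (fun y => u y t) x)
      ((continuousOn_dx (hu s hs).1 hi).sub (continuousOn_dx (hu t ht).1 hi))
      (((hu s hs).memLp_dx (by omega)).sub ((hu t ht).memLp_dx (by omega))) ?_ hx
    intro x hx y hy
    have hII : ∀ r, 0 ≤ r → IntervalIntegrable (dx (i + 1) fun y => u y r) volume y x := by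
      intro r hr
      have h1 : Integrable (dx (i + 1) fun y => u y r) unitMeasure :=
        ((hu r hr).memLp_dx (by omega)).integrable (by norm_num)
      rw [intervalIntegrable_iff]
      exact IntegrableOn.mono_set h1 fun z hz => uIcc_subset_Icc hy hx (uIoc_subset_uIcc hz)
    rw [intervalIntegral.integral_sub (hII s hs) (hII t ht), (hu s hs).integral_dx hi hx hy,
      (hu t ht).integral_dx hi hx hy]
    ring
  rw [continuous_iff_continuousAt]
  rintro ⟨x₀, t₀⟩
  have ht₀ : 0 ≤ max t₀ 0 := le_max_right _ _
  have hlim : Tendsto (fun s => (eLpNorm (fun x => dx i (fun y => u y s) x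
        - dx i (fun y => u y (max t₀ 0)) x) 2 unitMeasure).toReal
          + (eLpNorm (fun x => dx (i + 1) (fun y => u y s) x
            - dx (i + 1) (fun y => u y (max t₀ 0)) x) 2 unitMeasure).toReal)
        (𝓝[Ici 0] (max t₀ 0)) (𝓝 0) := by
    have h1 := (ENNReal.tendsto_toReal ENNReal.zero_ne_top).comp (hc _ ht₀ i (by omega))
    have h2 := (ENNReal.tendsto_toReal ENNReal.zero_ne_top).comp (hc _ ht₀ (i + 1) (by omega))
    simpa using h1.add h2
  have hmax : Tendsto (fun z : ℝ × ℝ => max z.2 0) (𝓝 (x₀, t₀)) (𝓝[Ici 0] (max t₀ 0)) := by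
    refine tendsto_nhdsWithin_iff.2 ⟨?_, Eventually.of_forall fun z => mem_Ici.2 (le_max_right _ _)⟩
    exact (Continuous.tendsto (by fun_prop) (x₀, t₀))
  have hA : Tendsto (fun z : ℝ × ℝ => uJet u i z.1 z.2 - uJet u i z.1 t₀) (𝓝 (x₀, t₀)) (𝓝 0) :=
    squeeze_zero_norm (fun z => hsup _ ht₀ _ (le_max_right _ _) _ (clamp_mem _))
      (hlim.comp hmax)
  have hB : Tendsto (fun z : ℝ × ℝ => uJet u i z.1 t₀) (𝓝 (x₀, t₀)) (𝓝 (uJet u i x₀ t₀)) := by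
    have : Continuous fun x => uJet u i x t₀ :=
      (continuousOn_dx (hu _ ht₀).1 hi).comp_continuous continuous_clamp clamp_mem
    exact (this.comp continuous_fst).tendsto (x₀, t₀)
  have := hA.add hB
  simp only [sub_add_cancel, zero_add] at this
  exact this

/-- Integration over [0,x] is continuous on L², so it passes through the limit defining u_t, and ∫
u_xx is a difference of values of u_x. -/
theorem hasDerivWithinAt_integral_of_heat {k : ℕ} {q : ℝ} {u : ℝ → ℝ → ℝ} (hk : 1 ≤ k)
    (hu : ∀ t, 0 ≤ t → MemH (k + 1) fun x => u x t)
    (hheat : ∀ t, 0 ≤ t → Tendsto (fun s => eLpNorm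
      (fun x => (s - t)⁻¹ * (u x s - u x t) - q * dx 2 (fun y => u y t) x)
      2 unitMeasure) (𝓝[Ici 0 \ {t}] t) (𝓝 0))
    {x t : ℝ} (hx : x ∈ Icc (0 : ℝ) 1) (ht : 0 ≤ t) :
    HasDerivWithinAt (fun t => ∫ y in (0 : ℝ)..x, u y t)
      (q * (dx 1 (fun y => u y t) x - dx 1 (fun y => u y t) 0)) (Ici 0) t := by
  have hu0 : ∀ s, 0 ≤ s → ContinuousOn (fun y => u y s) (Icc 0 1) := fun s hs => (hu s hs).1.continuousOn
  have hsub : uIcc 0 x ⊆ Icc 0 1 := uIcc_subset_Icc (by simp) hx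
  rw [hasDerivWithinAt_iff_tendsto_slope, ← tendsto_sub_nhds_zero_iff]
  have hlim := (ENNReal.tendsto_toReal ENNReal.zero_ne_top).comp (hheat t ht)
  refine squeeze_zero_norm' ?_ hlim
  filter_upwards [self_mem_nhdsWithin] with s hs
  have hs0 : 0 ≤ s := hs.1
  have h2 : MemLp (dx 2 fun y => u y t) 2 unitMeasure := (hu t ht).memLp_dx (by omega)
  have hmem : MemLp (fun x => (s - t)⁻¹ * (u x s - u x t) - q * dx 2 (fun y => u y t) x) 2
      unitMeasure :=
    (((memLp_of_continuousOn (hu0 s hs0)).sub (memLp_of_continuousOn (hu0 t ht))).const_mul _).sub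
      (h2.const_mul q)
  have hI2 : IntervalIntegrable (dx 2 fun y => u y t) volume 0 x := by
    rw [intervalIntegrable_iff]
    exact IntegrableOn.mono_set (h2.integrable (by norm_num))
      fun z hz => hsub (uIoc_subset_uIcc hz)
  have hIs : ∀ s, 0 ≤ s → IntervalIntegrable (fun y => u y s) volume 0 x := fun s hs =>
    ((hu0 s hs).mono hsub).intervalIntegrable
  have e := abs_integral_le_eLpNorm hmem (a := 0) (by simp) hx
  rw [intervalIntegral.integral_sub (((hIs s hs0).sub (hIs t ht)).const_mul _) (hI2.const_mul q),
    intervalIntegral.integral_const_mul, intervalIntegral.integral_const_mul,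
    intervalIntegral.integral_sub (hIs s hs0) (hIs t ht),
    (hu t ht).integral_dx (i := 1) hk hx (by simp)] at e
  simpa [slope_def_module] using e

/-- A strong solution gives a heat jet. -/
theorem Plant.IsClosedLoopSolution.heatJet {P : Plant n m} {K : Fin n → ℝ} {c : ℕ → ℝ} {cm : ℝ}
    {u : ℝ → ℝ → ℝ} {X : ℝ → Fin n → ℝ} {Z : ℝ → Fin m → ℝ} {U : ℝ → ℝ} (hm : 1 ≤ m)
    (h : P.IsClosedLoopSolution K c cm u X Z U) : HeatJet P.q (2 * m - 1) (uJet u) := by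
  obtain ⟨k, hk⟩ : ∃ k, 2 * m = k + 1 := ⟨2 * m - 1, by omega⟩
  have hmem := h.memH
  have hcont := h.continuous_H
  rw [hk] at hmem hcont
  have hk' : 2 * m - 1 = k := by omega
  rw [hk']
  refine ⟨fun i hi => continuous_uJet hmem hcont hi, fun i hi t ht x hx => ?_,
    fun x hx t ht => ?_⟩
  · rw [uJet_of_mem u _ hx ht]
    exact (hasDerivWithinAt_dx (hmem t ht).1 hi hx).congr (fun y hy => uJet_of_mem u i hy ht)
      (uJet_of_mem u i hx ht)
  · rw [uJet_of_mem u _ hx ht, uJet_of_mem u _ (by simp) ht]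
    have key : ∀ s, 0 ≤ s → ∫ y in (0 : ℝ)..x, uJet u 0 y s = ∫ y in (0 : ℝ)..x, u y s := by
      intro s hs
      refine intervalIntegral.integral_congr fun y hy => ?_
      exact uJet_zero u (uIcc_subset_Icc (by simp) hx hy) hs
    exact (hasDerivWithinAt_integral_of_heat (by omega) hmem h.heat hx ht).congr
      (fun s hs => key s hs) (key t ht)

/-! ### The backstepping transformation -/

theorem conv_comm (k f : ℝ → ℝ) (x : ℝ) : conv k f x = conv f k x := by
  have := intervalIntegral.integral_comp_sub_left (a := 0) (b := x) (fun y => k y * f (x - y)) x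
  simp only [sub_self, sub_zero, sub_sub_cancel] at this
  unfold conv
  rw [this]
  exact intervalIntegral.integral_congr fun y _ => mul_comm _ _

theorem conv_congr_left {k k' f : ℝ → ℝ} {x : ℝ} (hx : 0 ≤ x) (h : ∀ y ∈ Icc 0 x, k y = k' y) :
    conv k f x = conv k' f x := by
  rw [conv_comm, conv_comm k', conv_congr_right hx h]

theorem conv_dotProduct {k : ℝ → ℝ} (hk : Continuous k) {v : ℝ → Fin n → ℝ} (hv : Continuous v)
    (b : Fin n → ℝ) (x : ℝ) :
    conv k (fun y => v y ⬝ᵥ b) x = (fun i => conv k (fun y => v y i) x) ⬝ᵥ b := by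
  unfold conv dotProduct
  simp only [Finset.mul_sum]
  rw [intervalIntegral.integral_finsetSum fun i _ => Continuous.intervalIntegrable (by fun_prop) _ _]
  refine Finset.sum_congr rfl fun i _ => ?_
  rw [← intervalIntegral.integral_mul_const]
  exact intervalIntegral.integral_congr fun y _ => by ring

/-- The `x`-derivatives of `g 0 - ∫₀ˣ κ(x - y) g 0 dy - G(x) X`, where `κ i` and `G i` are the
derivatives of `κ 0` and `G 0`, and `g i` those of `g 0`. -/
def transJet (κ : ℕ → ℝ → ℝ) (G : ℕ → ℝ → Fin n → ℝ) (g : ℕ → ℝ → ℝ → ℝ) (X : ℝ → Fin n → ℝ)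
    (i : ℕ) (x t : ℝ) : ℝ :=
  g i x t - (conv (κ i) (fun y => g 0 y t) x + ∑ j ∈ Finset.range i, κ j 0 * g (i - 1 - j) x t)
    - G i x ⬝ᵥ X t

section TransJet

variable {κ : ℕ → ℝ → ℝ} {G : ℕ → ℝ → Fin n → ℝ} {g : ℕ → ℝ → ℝ → ℝ} {X : ℝ → Fin n → ℝ} {N : ℕ}

theorem continuous_transJet (hκ : ∀ i, Continuous (κ i)) (hG : ∀ i, Continuous (G i))
    (hg : ∀ i ≤ N, Continuous (Function.uncurry (g i))) (hX : Continuous X) {i : ℕ} (hi : i ≤ N) :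
    Continuous (Function.uncurry (transJet κ G g X i)) := by
  have h1 := continuous_conv₂ (hκ i) (hg 0 (by omega))
  have h2 : Continuous fun z : ℝ × ℝ => ∑ j ∈ Finset.range i, κ j 0 * g (i - 1 - j) z.1 z.2 :=
    continuous_finsetSum _ fun j _ => continuous_const.mul (hg (i - 1 - j) (by omega))
  have h3 : Continuous fun z : ℝ × ℝ => G i z.1 ⬝ᵥ X z.2 :=
    ((hG i).comp continuous_fst).dotProduct (hX.comp continuous_snd)
  exact ((hg i hi).sub (h1.add h2)).sub h3

/-- Differentiating the convolution produces the next one and the boundary term κ_i(0) g_0, which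
becomes the last term of the longer sum. -/
theorem hasDerivWithinAt_transJet (hκ : ∀ i x, HasDerivAt (κ i) (κ (i + 1) x) x)
    (hG : ∀ i x j, HasDerivAt (fun x => G i x j) (G (i + 1) x j) x) {t : ℝ}
    (hgc : Continuous fun x => g 0 x t) {i : ℕ}
    (hg : ∀ j ≤ i, ∀ x ∈ Icc (0 : ℝ) 1,
      HasDerivWithinAt (fun x => g j x t) (g (j + 1) x t) (Icc 0 1) x)
    {x : ℝ} (hx : x ∈ Icc (0 : ℝ) 1) :
    HasDerivWithinAt (fun x => transJet κ G g X i x t) (transJet κ G g X (i + 1) x t)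
      (Icc 0 1) x := by
  have hκc : ∀ i, Continuous (κ i) := fun i =>
    continuous_iff_continuousAt.2 fun x => (hκ i x).continuousAt
  have h1 := hasDerivWithinAt_conv (hκ i) (hκc (i + 1)) hgc (s := Icc 0 1) Icc_subset_Ici_self hx.1
  have h2 : HasDerivWithinAt (fun x => ∑ j ∈ Finset.range i, κ j 0 * g (i - 1 - j) x t)
      (∑ j ∈ Finset.range i, κ j 0 * g (i - j) x t) (Icc 0 1) x := by
    refine HasDerivWithinAt.fun_sum fun j hj => ?_
    have hj' := Finset.mem_range.1 hj
    have := (hg (i - 1 - j) (by omega) x hx).const_mul (κ j 0)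
    rwa [show i - 1 - j + 1 = i - j by omega] at this
  have h3 := hasDerivAt_dotProduct_const (fun j => (hG i x j).hasDerivWithinAt (s := Icc 0 1)) (X t)
  refine (((hg i le_rfl x hx).sub (h1.add h2)).sub h3).congr_deriv ?_
  rw [transJet, Finset.sum_range_succ]
  simp only [Nat.add_sub_cancel, Nat.sub_self]
  ring

end TransJet

/-- The part of the closed loop that does not involve the control: the jet `g` of `u` and the
state `X`. -/
structure Plant.IsReduced (P : Plant n m) (N : ℕ) (g : ℕ → ℝ → ℝ → ℝ) (X : ℝ → Fin n → ℝ) :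
    Prop where
  one_le : 1 ≤ N
  jet : HeatJet P.q N g
  contX : Continuous X
  odeX : ∀ t, 0 ≤ t → HasDerivWithinAt X (P.A *ᵥ X t + g 1 0 t • P.B) (Ici 0) t
  left : ∀ t, 0 ≤ t → g 0 0 t = P.CX ⬝ᵥ X t

namespace Plant

variable (P : Plant n m) (K : Fin n → ℝ)

/-- The jet of `w = u - ∫φu - ΦX`. -/
def wJet (g : ℕ → ℝ → ℝ → ℝ) (X : ℝ → Fin n → ℝ) : ℕ → ℝ → ℝ → ℝ :=
  transJet (P.phiD K) (P.PhiD K) g X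

theorem PhiD_dotProduct_B (hq : 0 < P.q) (k : ℕ) (x : ℝ) :
    P.PhiD K k x ⬝ᵥ P.B = P.q * P.phiD K k x := by
  rw [phiD]; field_simp

variable {P} {N : ℕ} {g : ℕ → ℝ → ℝ → ℝ} {X : ℝ → Fin n → ℝ}

theorem IsReduced.wJet_zero_left (h : P.IsReduced N g X) {t : ℝ} (ht : 0 ≤ t) :
    P.wJet K g X 0 0 t = 0 := by
  simp [wJet, transJet, conv_zero_right, PhiD_zero_zero, h.left t ht]

/-- The correction C_X B C_X / q in Φ'(0) is there to cancel the boundary term φ(0,0) u(0,t) of the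
Volterra integral. -/
theorem IsReduced.wJet_one_left (h : P.IsReduced N g X) {t : ℝ} (ht : 0 ≤ t) :
    P.wJet K g X 1 0 t = g 1 0 t - K ⬝ᵥ X t := by
  simp only [wJet, transJet, conv_zero_right, PhiD_one_zero, phiD, PhiD_zero_zero,
    Finset.sum_range_one, h.left t ht, sub_dotProduct, smul_dotProduct, smul_eq_mul, Nat.sub_self]
  ring

theorem IsReduced.odeX_wJet (h : P.IsReduced N g X) {t : ℝ} (ht : 0 ≤ t) :
    HasDerivWithinAt X (P.AK K *ᵥ X t + P.wJet K g X 1 0 t • P.B) (Ici 0) t := by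
  refine (h.odeX t ht).congr_deriv ?_
  rw [h.wJet_one_left K ht, AK, Matrix.add_mulVec, Matrix.vecMulVec_mulVec, sub_smul]
  ext i
  simp

/-- By the kernel equation, ΦA is the x-derivative of q(Φ' + φ C_X). -/
theorem integral_PhiD_dotProduct (hq : 0 < P.q) (X : Fin n → ℝ) (x : ℝ) :
    ∫ y in (0 : ℝ)..x, P.PhiD K 0 y ⬝ᵥ (P.A *ᵥ X)
      = P.q * ((P.phiD K 0 x - P.phiD K 0 0) * (P.CX ⬝ᵥ X)
        + (P.PhiD K 1 x ⬝ᵥ X - P.PhiD K 1 0 ⬝ᵥ X)) := by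
  have hd : ∀ y, HasDerivAt
      (fun y => P.q * (P.phiD K 0 y * (P.CX ⬝ᵥ X) + P.PhiD K 1 y ⬝ᵥ X))
      (P.PhiD K 0 y ⬝ᵥ (P.A *ᵥ X)) y := by
    intro y
    have h1 := hasDerivAt_dotProduct_const
      (fun j => (P.hasDerivAt_PhiD K 1 y j).hasDerivWithinAt (s := univ)) X
    refine ((((P.hasDerivAt_phiD K 0 y).mul_const (P.CX ⬝ᵥ X)).add
      (h1.hasDerivAt univ_mem)).const_mul P.q).congr_deriv ?_
    rw [PhiD_add_two, sub_dotProduct, smul_dotProduct, smul_dotProduct, Matrix.dotProduct_mulVec,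
      smul_eq_mul, smul_eq_mul]
    field_simp
    ring
  rw [intervalIntegral.integral_eq_sub_of_hasDerivAt (fun y _ => hd y)
    (Continuous.intervalIntegrable ((P.continuous_PhiD K 0).dotProduct continuous_const) _ _)]
  ring

/-- The target system: `w` satisfies the heat equation. -/
theorem IsReduced.heatJet_wJet (h : P.IsReduced N g X) (hq : 0 < P.q) :
    HeatJet P.q N (P.wJet K g X) where
  cont i hi := continuous_transJet (P.continuous_phiD K) (P.continuous_PhiD K) h.jet.cont h.contX hi
  space i hi t ht x hx := hasDerivWithinAt_transJet (P.hasDerivAt_phiD K) (P.hasDerivAt_PhiD K)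
    (continuous_uncurry_right (h.jet.cont 0 (by omega)) t)
    (fun j hj x hx => h.jet.space j (by omega) t ht x hx) hx
  flux x hx t ht := by
    have hc0 := h.jet.cont 0 (by omega)
    have hc1 := h.jet.cont 1 h.one_le
    have hφ := P.continuous_phiD K
    have hu := continuous_uncurry_right hc0
    have hprim : ∀ s, Continuous (conv (fun _ => 1) fun y => g 0 y s) := fun s =>
      continuous_conv continuous_const (hu s)
    have hone : ∀ f : ℝ → ℝ, ∀ x, conv (fun _ => 1) f x = ∫ y in (0 : ℝ)..x, f y := fun f x => by
      simp [conv]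
    -- the time derivative of the integral of the Volterra term
    have hV : HasDerivWithinAt (fun s => ∫ y in (0 : ℝ)..x, conv (P.phiD K 0) (fun y => g 0 y s) y)
        (conv (P.phiD K 0) (fun y => P.q * (g 1 y t - g 1 0 t)) x) (Ici 0) t := by
      -- Convolutions commute, so ∫₀ˣ φ∗u = φ ∗ ∫u, and only the flux identity for u is needed.
      have e1 := hasDerivWithinAt_conv_time (k := P.phiD K 0) (x := x)
        (F := fun y s => conv (fun _ => 1) (fun z => g 0 z s) y)
        (F' := fun y s => P.q * (g 1 y s - g 1 0 s)) hx.1 (hφ 0) hprim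
        (continuous_const.mul (hc1.sub (hc1.comp (continuous_const.prodMk continuous_snd))))
        (fun y hy s hs => by
          simp only [hone]
          exact h.jet.flux y ⟨hy.1, hy.2.trans hx.2⟩ s hs) ht
      refine e1.congr_of_eventuallyEq (Eventually.of_forall fun s => ?_) ?_ <;>
      · change _ = conv (P.phiD K 0) (conv (fun _ => 1) _) x
        rw [conv_assoc (hφ 0) continuous_const (hu _) hx.1,
          funext (conv_comm (P.phiD K 0) fun _ => 1),
          ← conv_assoc continuous_const (hφ 0) (hu _) hx.1, hone]
    have hΦ : HasDerivWithinAt (fun s => ∫ y in (0 : ℝ)..x, P.PhiD K 0 y ⬝ᵥ X s)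
        (∫ y in (0 : ℝ)..x, P.PhiD K 0 y ⬝ᵥ (P.A *ᵥ X t + g 1 0 t • P.B)) (Ici 0) t := by
      refine hasDerivWithinAt_parametric_integral
        (F := fun y s => P.PhiD K 0 y ⬝ᵥ X s)
        (F' := fun y s => P.PhiD K 0 y ⬝ᵥ (P.A *ᵥ X s + g 1 0 s • P.B)) hx.1
        (fun s => (P.continuous_PhiD K 0).dotProduct continuous_const) ?_ (fun y _ s hs => ?_) ht
      · refine ((P.continuous_PhiD K 0).comp continuous_fst).dotProduct ?_
        have e1 : Continuous fun s => g 1 0 s := continuous_uncurry_left hc1 0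
        have e2 := h.contX
        exact ((continuous_const.matrix_mulVec e2).add (e1.smul continuous_const)).comp
          continuous_snd
      · have e1 := hasDerivAt_dotProduct_const (fun j => hasDerivWithinAt_pi.1 (h.odeX s hs) j)
          (P.PhiD K 0 y)
        simpa only [dotProduct_comm] using e1
    have htot := ((h.jet.flux x hx t ht).sub hV).sub hΦ
    have hsplit : ∀ s, ∫ y in (0 : ℝ)..x, P.wJet K g X 0 y s
        = (∫ y in (0 : ℝ)..x, g 0 y s)
          - (∫ y in (0 : ℝ)..x, conv (P.phiD K 0) (fun y => g 0 y s) y)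
          - ∫ y in (0 : ℝ)..x, P.PhiD K 0 y ⬝ᵥ X s := by
      intro s
      have e1 := continuous_conv (hφ 0) (hu s)
      have e2 : Continuous fun y => P.PhiD K 0 y ⬝ᵥ X s :=
        (P.continuous_PhiD K 0).dotProduct continuous_const
      have e12 : Continuous fun y => g 0 y s - conv (P.phiD K 0) (fun y => g 0 y s) y :=
        (hu s).sub e1
      rw [← intervalIntegral.integral_sub ((hu s).intervalIntegrable _ _)
        (e1.intervalIntegrable _ _), ← intervalIntegral.integral_sub
        (e12.intervalIntegrable _ _) (e2.intervalIntegrable _ _)]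
      simp [wJet, transJet]
    refine (htot.congr (fun s _ => hsplit s) (hsplit t)).congr_deriv ?_
    have e1 : ∫ y in (0 : ℝ)..x, P.PhiD K 0 y ⬝ᵥ (P.A *ᵥ X t + g 1 0 t • P.B)
        = (∫ y in (0 : ℝ)..x, P.PhiD K 0 y ⬝ᵥ (P.A *ᵥ X t))
          + g 1 0 t * P.q * conv (P.phiD K 0) (fun _ => 1) x := by
      rw [conv_comm, hone, ← intervalIntegral.integral_const_mul, ← intervalIntegral.integral_add
        (Continuous.intervalIntegrable ((P.continuous_PhiD K 0).dotProduct continuous_const) _ _)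
        (((hφ 0).const_mul _).intervalIntegrable _ _)]
      refine intervalIntegral.integral_congr fun y _ => ?_
      simp only [dotProduct_add, dotProduct_smul, smul_eq_mul, PhiD_dotProduct_B P K hq]
      ring
    have e2 : conv (P.phiD K 0) (fun y => P.q * (g 1 y t - g 1 0 t)) x
        = P.q * (conv (P.phiD K 0) (fun y => g 1 y t) x
          - g 1 0 t * conv (P.phiD K 0) (fun _ => 1) x) := by
      rw [conv_const_mul, conv_sub (hφ 0) (continuous_uncurry_right hc1 t) continuous_const,
        ← conv_const_mul]
      simp only [mul_one]
    have e3 := conv_deriv (P.hasDerivAt_phiD K 0) (hφ 1) (continuous_uncurry_right hc1 t) (hu t)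
      (fun x hx => h.jet.space 0 (by have := h.one_le; omega) t ht x hx) hx
    -- The terms with u_x(0,t) ∫φ cancel because φ = ΦB/q, those with φ(x) u(0,t) because u(0,t) =
    -- C_X X.
    rw [e1, e2, e3, integral_PhiD_dotProduct K hq, ← h.left t ht]
    simp only [wJet, transJet, Finset.sum_range_one, conv_zero_right, Nat.sub_self]
    ring

/-! ### The inverse transformation -/

/-- The resolvent identity `Γ + Φ = ψ * Φ`. -/
theorem GamD_add_PhiD (P : Plant n m) (K : Fin n → ℝ) (j : Fin n) {x : ℝ}
    (hx : x ∈ Icc (0 : ℝ) 1) :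
    P.GamD K 0 x j + P.PhiD K 0 x j = conv (P.psiD K 0) (fun y => P.PhiD K 0 y j) x := by
  have hΦc : ∀ k j, Continuous fun y => P.PhiD K k y j := fun k j =>
    (continuous_apply j).comp (P.continuous_PhiD K k)
  set S : ℝ → Fin n → ℝ := fun x j => conv (P.psiD K 0) (fun y => P.PhiD K 0 y j) x with hS
  set T : ℝ → Fin n → ℝ := fun x j => conv (P.psiD K 0) (fun y => P.PhiD K 1 y j) x with hT
  have key : ∀ k j x, x ∈ Icc (0 : ℝ) 1 →
      HasDerivWithinAt (conv (P.psiD K 0) fun y => P.PhiD K k y j)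
        (P.psiD K 0 x * P.PhiD K k 0 j + conv (P.psiD K 0) (fun y => P.PhiD K (k + 1) y j) x)
        (Icc 0 1) x := by
    intro k j x hx
    refine (hasDerivWithinAt_conv (P.hasDerivAt_psiD K 0) (P.continuous_psiD K 1) (hΦc k j)
      (s := Icc 0 1) Icc_subset_Ici_self hx.1).congr_deriv ?_
    rw [conv_deriv (P.hasDerivAt_psiD K 0) (P.continuous_psiD K 1) (hΦc (k + 1) j) (hΦc k j)
      (fun x _ => (P.hasDerivAt_PhiD K k x j).hasDerivWithinAt) hx]
    ring
  have hconv2 : ∀ x j, conv (P.psiD K 0) (fun y => P.PhiD K 2 y j) x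
      = P.q⁻¹ * (S x ᵥ* P.A) j - P.q⁻¹ * (T x ⬝ᵥ P.B) * P.CX j := by
    intro x j
    have e1 : (fun y => P.PhiD K 2 y j) = fun y => P.q⁻¹ * (P.PhiD K 0 y ⬝ᵥ fun i => P.A i j)
        - (P.PhiD K 1 y ⬝ᵥ P.B) * (P.q⁻¹ * P.CX j) := by
      funext y
      rw [PhiD_add_two, phiD]
      simp only [Pi.sub_apply, Pi.smul_apply, smul_eq_mul, Matrix.vecMul, zero_add]
      ring
    rw [e1, conv_sub (P.continuous_psiD K 0)
      (((P.continuous_PhiD K 0).dotProduct continuous_const).const_mul _)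
      (((P.continuous_PhiD K 1).dotProduct continuous_const).mul_const _),
      conv_const_mul, conv_mul_const, conv_dotProduct (P.continuous_psiD K 0)
      (P.continuous_PhiD K 0), conv_dotProduct (P.continuous_psiD K 0) (P.continuous_PhiD K 1)]
    simp only [Matrix.vecMul, hS, hT]
    ring
  -- v collects the defect of the identity and its x-derivative. It satisfies the equation v' = vD
  -- of Φ with v(0) = 0, so Gronwall's inequality makes it vanish.
  set v : ℝ → Fin n ⊕ Fin n → ℝ := fun x => Sum.elim
    (P.GamD K 0 x + P.PhiD K 0 x - S x)
    (P.GamD K 1 x + P.PhiD K 1 x - (P.psiD K 0 x • P.CX + T x)) with hv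
  have hvd : ∀ x ∈ Icc (0 : ℝ) 1, HasDerivWithinAt v (v x ᵥ* P.D) (Icc 0 1) x := by
    intro x hx
    refine hasDerivWithinAt_pi.2 ?_
    rintro (j | j)
    · refine (((P.hasDerivAt_GamD K 0 x j).add (P.hasDerivAt_PhiD K 0 x j)).hasDerivWithinAt.sub
        (key 0 j x hx)).congr_deriv ?_
      simp only [hv, Matrix.vecMul, dotProduct, D, Fintype.sum_sum_type, Sum.elim_inl,
        Sum.elim_inr, Matrix.fromBlocks_apply₁₁, Matrix.fromBlocks_apply₂₁, Matrix.zero_apply,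
        mul_zero, Finset.sum_const_zero, zero_add, Matrix.one_apply, mul_ite, mul_one,
        Finset.sum_ite_eq', Finset.mem_univ, if_true, PhiD_zero_zero, hT]
      simp
    · have e1 := ((P.hasDerivAt_psiD K 0 x).mul_const (P.CX j)).hasDerivWithinAt (s := Icc 0 1)
      refine (((P.hasDerivAt_GamD K 1 x j).add (P.hasDerivAt_PhiD K 1 x j)).hasDerivWithinAt.sub
        (e1.add (key 1 j x hx))).congr_deriv ?_
      have e2 : (v x ᵥ* P.D) (Sum.inr j)
          = P.q⁻¹ * ((P.GamD K 0 x + P.PhiD K 0 x - S x) ᵥ* P.A) j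
            - P.q⁻¹ * ((P.GamD K 1 x + P.PhiD K 1 x - (P.psiD K 0 x • P.CX + T x)) ⬝ᵥ P.B)
              * P.CX j := by
        simp only [hv, Matrix.vecMul, dotProduct, D, Fintype.sum_sum_type, Sum.elim_inl,
          Sum.elim_inr, Matrix.fromBlocks_apply₁₂, Matrix.fromBlocks_apply₂₂, Matrix.smul_apply,
          Matrix.neg_apply, Matrix.vecMulVec_apply, smul_eq_mul, Finset.mul_sum, Finset.sum_mul,
          ← Finset.sum_sub_distrib, ← Finset.sum_add_distrib]
        exact Finset.sum_congr rfl fun i _ => by ring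
      rw [e2, hconv2, PhiD_add_two, GamD_add_two, PhiD_one_zero]
      simp only [Matrix.add_vecMul, Matrix.sub_vecMul, add_dotProduct, sub_dotProduct,
        smul_dotProduct, Pi.add_apply, Pi.sub_apply, Pi.smul_apply, smul_eq_mul, zero_add, phiD,
        psiD]
      ring
  have hv0 : v 0 = 0 := by
    funext j
    rcases j with j | j
    · simp [hv, hS, conv_zero_right, PhiD_zero_zero, GamD_zero_zero]
    · simp [hv, hT, conv_zero_right, PhiD_one_zero, GamD_one_zero, psiD, GamD_zero_zero]
      ring
  let L : (Fin n ⊕ Fin n → ℝ) →L[ℝ] (Fin n ⊕ Fin n → ℝ) :=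
    LinearMap.toContinuousLinearMap (Matrix.vecMulLinear P.D)
  have hg := norm_le_gronwallBound_of_norm_deriv_right_le (f := v) (f' := fun x => v x ᵥ* P.D)
    (δ := 0) (K := ‖L‖) (ε := 0) (a := 0) (b := 1)
    (fun x hx => (hvd x hx).continuousWithinAt)
    (fun x hx => (hvd x (Ico_subset_Icc_self hx)).mono_of_mem_nhdsWithin
      (mem_of_superset (Icc_mem_nhdsGE hx.2) (Icc_subset_Icc_left hx.1)))
    (by simp [hv0]) (fun x _ => by rw [add_zero]; exact L.le_opNorm (v x)) x hx
  rw [gronwallBound_ε0, zero_mul, norm_le_zero_iff] at hg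
  have := congrFun hg (Sum.inl j)
  simp only [hv, Sum.elim_inl, Pi.sub_apply, Pi.add_apply, Pi.zero_apply, hS] at this
  linarith

/-- This is `GamD_add_PhiD` paired with B/q. -/
theorem psiD_add_phiD (P : Plant n m) (K : Fin n → ℝ) {x : ℝ} (hx : x ∈ Icc (0 : ℝ) 1) :
    conv (P.psiD K 0) (P.phiD K 0) x = P.psiD K 0 x + P.phiD K 0 x := by
  have e1 : P.phiD K 0 = fun y => P.q⁻¹ * (P.PhiD K 0 y ⬝ᵥ P.B) := rfl
  have e2 : (fun i => conv (P.psiD K 0) (fun y => P.PhiD K 0 y i) x)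
      = P.GamD K 0 x + P.PhiD K 0 x := funext fun i => (P.GamD_add_PhiD K i hx).symm
  rw [e1, conv_const_mul, conv_dotProduct (P.continuous_psiD K 0) (P.continuous_PhiD K 0), e2,
    add_dotProduct, mul_add]
  rfl

/-- The inverse transformation, differentiated `k` times. -/
theorem IsReduced.transJet_wJet (h : P.IsReduced N g X) (hq : 0 < P.q) {k : ℕ} (hk : k ≤ N)
    {t : ℝ} (ht : 0 ≤ t) {x : ℝ} (hx : x ∈ Icc (0 : ℝ) 1) :
    transJet (P.psiD K) (P.GamD K) (P.wJet K g X) X k x t = g k x t := by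
  have hw := h.heatJet_wJet K hq
  induction k generalizing x with
  | zero =>
    have hu := continuous_uncurry_right (h.jet.cont 0 (by omega)) t
    have hψ := P.continuous_psiD K 0
    have hφ := P.continuous_phiD K 0
    have e0 : (fun y => P.wJet K g X 0 y t) = fun y => (g 0 y t
        - conv (P.phiD K 0) (fun z => g 0 z t) y) - P.PhiD K 0 y ⬝ᵥ X t := by
      funext y; simp [wJet, transJet]
    -- Expand ψ∗w = ψ∗u - (ψ∗φ)∗u - (ψ∗Φ)X and insert the two resolvent identities; the terms ψ∗u
    -- cancel.
    have e1 : conv (P.psiD K 0) (fun y => P.wJet K g X 0 y t) x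
        = -conv (P.phiD K 0) (fun y => g 0 y t) x - (P.GamD K 0 x ⬝ᵥ X t + P.PhiD K 0 x ⬝ᵥ X t) := by
      have c1 := continuous_conv hφ hu
      have c2 : Continuous fun y => P.PhiD K 0 y ⬝ᵥ X t :=
        (P.continuous_PhiD K 0).dotProduct continuous_const
      have e2 : (fun i => conv (P.psiD K 0) (fun y => P.PhiD K 0 y i) x)
          = P.GamD K 0 x + P.PhiD K 0 x := funext fun i => (P.GamD_add_PhiD K i hx).symm
      have e3 : conv (conv (P.psiD K 0) (P.phiD K 0)) (fun y => g 0 y t) x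
          = conv (P.psiD K 0) (fun y => g 0 y t) x + conv (P.phiD K 0) (fun y => g 0 y t) x := by
        rw [conv_congr_left hx.1 (k' := fun y => P.psiD K 0 y + P.phiD K 0 y)
          (fun y hy => P.psiD_add_phiD K ⟨hy.1, hy.2.trans hx.2⟩), conv_comm,
          conv_add hu hψ hφ, conv_comm, conv_comm (P.phiD K 0)]
      have c12 : Continuous fun y => g 0 y t - conv (P.phiD K 0) (fun z => g 0 z t) y :=
        hu.sub c1
      rw [e0, conv_sub hψ c12 c2, conv_sub hψ hu c1, conv_assoc hψ hφ hu hx.1, e3,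
        conv_dotProduct hψ (P.continuous_PhiD K 0), e2, add_dotProduct]
      ring
    have e4 := congrFun e0 x
    simp only [transJet, e1, e4, Finset.range_zero, Finset.sum_empty]
    ring
  | succ k ih =>
    have d1 := hasDerivWithinAt_transJet (X := X) (P.hasDerivAt_psiD K) (P.hasDerivAt_GamD K)
      (continuous_uncurry_right (hw.cont 0 (by omega)) t) (i := k)
      (fun j hj x hx => hw.space j (by omega) t ht x hx) hx
    have d2 := (h.jet.space k (by omega) t ht x hx).congr (fun y hy => ih (by omega) hy)
      (ih (by omega) hx)
    exact (uniqueDiffOn_Icc (zero_lt_one (α := ℝ)) x hx).eq_deriv _ d1 d2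

end Plant

/-! ### Boundary operators as functionals of jets -/

/-- Functionals of a sequence that are controlled by its first `N` terms. -/
def IsBoundedOn (N : ℕ) (ℓ : (ℕ → ℝ) →ₗ[ℝ] ℝ) : Prop :=
  ∃ C : ℝ, 0 ≤ C ∧ ∀ (v : ℕ → ℝ) (S : ℝ), (∀ k < N, |v k| ≤ S) → |ℓ v| ≤ C * S

namespace IsBoundedOn

variable {N : ℕ} {ℓ ℓ' : (ℕ → ℝ) →ₗ[ℝ] ℝ}

theorem proj {k : ℕ} (hk : k < N) : IsBoundedOn N (LinearMap.proj k) :=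
  ⟨1, zero_le_one, fun v S h => by rw [one_mul]; exact h k hk⟩

theorem add (h : IsBoundedOn N ℓ) (h' : IsBoundedOn N ℓ') : IsBoundedOn N (ℓ + ℓ') := by
  obtain ⟨C, hC, hb⟩ := h
  obtain ⟨C', hC', hb'⟩ := h'
  refine ⟨C + C', add_nonneg hC hC', fun v S hv => ?_⟩
  rw [LinearMap.add_apply, add_mul]
  exact (abs_add_le _ _).trans (add_le_add (hb v S hv) (hb' v S hv))

theorem smul (a : ℝ) (h : IsBoundedOn N ℓ) : IsBoundedOn N (a • ℓ) := by
  obtain ⟨C, hC, hb⟩ := h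
  refine ⟨|a| * C, by positivity, fun v S hv => ?_⟩
  rw [LinearMap.smul_apply, smul_eq_mul, abs_mul, mul_assoc]
  exact mul_le_mul_of_nonneg_left (hb v S hv) (abs_nonneg _)

theorem neg (h : IsBoundedOn N ℓ) : IsBoundedOn N (-ℓ) := by
  have e : (-1 : ℝ) • ℓ = -ℓ := LinearMap.ext fun v => by
    rw [LinearMap.smul_apply, LinearMap.neg_apply, smul_eq_mul, neg_one_mul]
  exact e ▸ h.smul (-1)

theorem sub (h : IsBoundedOn N ℓ) (h' : IsBoundedOn N ℓ') : IsBoundedOn N (ℓ - ℓ') := by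
  rw [sub_eq_add_neg]; exact h.add h'.neg

theorem sum {ι : Type*} {s : Finset ι} {ℓ : ι → (ℕ → ℝ) →ₗ[ℝ] ℝ}
    (h : ∀ i ∈ s, IsBoundedOn N (ℓ i)) : IsBoundedOn N (∑ i ∈ s, ℓ i) := by
  classical
  induction s using Finset.induction_on with
  | empty => exact ⟨0, le_rfl, fun v S _ => by simp⟩
  | insert a s ha ih =>
    rw [Finset.sum_insert ha]
    exact (h a (Finset.mem_insert_self _ _)).add
      (ih fun i hi => h i (Finset.mem_insert_of_mem hi))

/-- The bound with S = 0, applied to the difference. It allows jets to be replaced by sequences that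
agree with them only below order 2m. -/
theorem congr (h : IsBoundedOn N ℓ) {v v' : ℕ → ℝ} (hv : ∀ k < N, v k = v' k) : ℓ v = ℓ v' := by
  obtain ⟨C, hC, hb⟩ := h
  have := hb (v - v') 0 fun k hk => by simp [hv k hk]
  rw [mul_zero, abs_nonpos_iff, map_sub, sub_eq_zero] at this
  exact this

end IsBoundedOn

namespace Plant

variable (P : Plant n m) (K : Fin n → ℝ)

/-- `invD` as a functional of the jet. -/
def invJ (k : ℕ) : (ℕ → ℝ) →ₗ[ℝ] ℝ :=
  LinearMap.proj k - ∑ j ∈ Finset.range k, P.psiD K j 0 • LinearMap.proj (k - 1 - j)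

/-- `𝓑` as a functional of the jet. -/
def jetB : (ℕ → ℝ) →ₗ[ℝ] ℝ :=
  ∑ k : Fin m, (P.a k * P.q ^ (k : ℕ)) • P.invJ K (2 * k)
    - P.q ^ m • ∑ i ∈ Finset.range (2 * m), P.phiD K i 0 • P.invJ K (2 * m - 1 - i)

/-- `𝓒` as a functional of the jet. -/
def jetC : (ℕ → ℝ) →ₗ[ℝ] ℝ :=
  P.q ^ m • ∑ i ∈ Finset.range (2 * m), P.phiD K i 1 • P.invJ K (2 * m - 1 - i)
    - ∑ i ∈ Finset.range m, ((P.PhiD K 0 1 ⬝ᵥ (P.A ^ i *ᵥ P.B)) * P.q ^ (m - 1 - i)) •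
      P.invJ K (2 * (m - 1 - i) + 1)

/-- `𝓛` as a functional of the jet. -/
def jetL (c : ℕ → ℝ) (cm : ℝ) : (ℕ → ℝ) →ₗ[ℝ] ℝ :=
  -P.jetB K - ∑ i ∈ Finset.range m, (P.q ^ i * (alpha m c i + cm * beta m c i)) •
    LinearMap.proj (2 * i)

theorem isBoundedOn_invJ {k N : ℕ} (hk : k < N) : IsBoundedOn N (P.invJ K k) :=
  (IsBoundedOn.proj hk).sub (IsBoundedOn.sum fun j _ => (IsBoundedOn.proj (by omega)).smul _)

theorem isBoundedOn_jetB (hm : 1 ≤ m) : IsBoundedOn (2 * m) (P.jetB K) :=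
  (IsBoundedOn.sum fun k _ => (P.isBoundedOn_invJ K (by omega)).smul _).sub
    ((IsBoundedOn.sum fun j _ => (P.isBoundedOn_invJ K (by omega)).smul _).smul _)

theorem isBoundedOn_jetC (hm : 1 ≤ m) : IsBoundedOn (2 * m) (P.jetC K) :=
  ((IsBoundedOn.sum fun j _ => (P.isBoundedOn_invJ K (by omega)).smul _).smul _).sub
    (IsBoundedOn.sum fun k _ => (P.isBoundedOn_invJ K (by omega)).smul _)

theorem isBoundedOn_jetL (hm : 1 ≤ m) (c : ℕ → ℝ) (cm : ℝ) :
    IsBoundedOn (2 * m) (P.jetL K c cm) :=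
  (P.isBoundedOn_jetB K hm).neg.sub
    (IsBoundedOn.sum fun i hi => (IsBoundedOn.proj (by have := Finset.mem_range.1 hi; omega)).smul _)

theorem invD_eq (k : ℕ) (x₀ : ℝ) (f : ℝ → ℝ) (x : ℝ) :
    P.invD K k x₀ f x = P.invJ K k fun k => dx k f x := by
  simp only [invD, invJ, chi_eq, LinearMap.sub_apply, LinearMap.proj_apply, LinearMap.sum_apply,
    LinearMap.smul_apply, smul_eq_mul]
  congr 1
  refine Finset.sum_congr rfl fun j hj => ?_
  rw [if_pos (Finset.mem_range.1 hj), Nat.sub_right_comm]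

theorem sum_Icc_one (f : ℕ → ℝ) (N : ℕ) :
    ∑ i ∈ Finset.Icc 1 N, f i = ∑ i ∈ Finset.range N, f (i + 1) := by
  rw [Finset.range_eq_Ico, Finset.sum_Ico_add' f 0 N 1]
  rfl

theorem opB_eq (f : ℝ → ℝ) (x : ℝ) : P.opB K f x = P.jetB K fun k => dx k f x := by
  simp only [opB, jetB, invD_eq, sum_Icc_one, dyPhi_eq, LinearMap.sub_apply, LinearMap.sum_apply,
    LinearMap.smul_apply, smul_eq_mul, sub_self, Nat.add_sub_cancel]
  rw [sub_eq_add_neg, ← mul_neg, ← Finset.sum_neg_distrib]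
  congr 2
  refine Finset.sum_congr rfl fun i _ => ?_
  rw [← mul_assoc, ← pow_add, show i + 1 + i = 2 * i + 1 by ring, pow_succ, pow_mul,
    show 2 * m - (i + 1) = 2 * m - 1 - i by omega]
  simp

theorem opC_eq (f : ℝ → ℝ) (x : ℝ) : P.opC K f x = P.jetC K fun k => dx k f x := by
  simp only [opC, jetC, invD_eq, sum_Icc_one, dyPhi_eq, LinearMap.sub_apply, LinearMap.sum_apply,
    LinearMap.smul_apply, smul_eq_mul, sub_zero, Nat.add_sub_cancel]
  rw [← mul_neg, ← Finset.sum_neg_distrib]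
  congr 1
  · congr 1
    refine Finset.sum_congr rfl fun i _ => ?_
    rw [← mul_assoc, ← pow_add, show i + 1 + i = 2 * i + 1 by ring, pow_succ, pow_mul,
      show 2 * m - (i + 1) = 2 * m - 1 - i by omega]
    simp
  · refine Finset.sum_congr rfl fun i _ => ?_
    rw [show m - (i + 1) = m - 1 - i by omega, PhiD_zero]

theorem opL_eq (c : ℕ → ℝ) (cm : ℝ) (f : ℝ → ℝ) (x : ℝ) :
    P.opL K c cm f x = P.jetL K c cm fun k => dx k f x := by
  simp [opL, jetL, opB_eq]

end Plant

/-! ### The feedback law in the target variable -/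

theorem dx_eq_of_hasDerivWithinAt {F : ℝ → ℝ} {f : ℕ → ℝ → ℝ} {N : ℕ}
    (h0 : ∀ x ∈ Icc (0 : ℝ) 1, F x = f 0 x)
    (h : ∀ i < N, ∀ x ∈ Icc (0 : ℝ) 1, HasDerivWithinAt (f i) (f (i + 1) x) (Icc 0 1) x) {k : ℕ}
    (hk : k ≤ N) {x : ℝ} (hx : x ∈ Icc (0 : ℝ) 1) : dx k F x = f k x := by
  induction k generalizing x with
  | zero => rw [dx, iteratedDerivWithin_zero]; exact h0 x hx
  | succ k ih =>
    have hd := (h k (by omega) x hx).congr (fun y hy => ih (by omega) hy) (ih (by omega) hx)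
    rw [dx, iteratedDerivWithin_succ]
    exact hd.derivWithin (uniqueDiffOn_Icc zero_lt_one x hx)

namespace Plant

variable {P : Plant n m} (K : Fin n → ℝ) {N : ℕ} {g : ℕ → ℝ → ℝ → ℝ} {X : ℝ → Fin n → ℝ}

/-- The feedback law in terms of `w`. -/
theorem IsReduced.feedback_eq (hm : 1 ≤ m) (h : P.IsReduced (2 * m - 1) g X) (c : ℕ → ℝ) (cm : ℝ)
    {t : ℝ} (ht : 0 ≤ t) {f : ℝ → ℝ} (hf : ∀ x ∈ Icc (0 : ℝ) 1, f x = g 0 x t) :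
    P.feedback K c cm f (X t) = P.jetL K c cm (fun k => P.wJet K g X k 1 t)
      - P.jetC K (fun k => P.wJet K g X k 0 t) := by
  have hgc := continuous_uncurry_right (h.jet.cont 0 (by omega)) t
  -- jets of the three functions
  have hu : ∀ x ∈ Icc (0 : ℝ) 1, ∀ k < 2 * m, dx k f x = g k x t := fun x hx k hk =>
    dx_eq_of_hasDerivWithinAt (f := fun k x => g k x t) hf
      (fun i hi x hx => h.jet.space i hi t ht x hx) (by omega) hx
  -- `transJet` with G = 0 and X = 0 is the jet of u - φ∗u, so subtracting it from g leaves the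
  -- derivatives of the Volterra term.
  have hv : ∀ x ∈ Icc (0 : ℝ) 1, ∀ k < 2 * m, dx k (P.volt K f) x
      = g k x t - transJet (P.phiD K) (fun _ _ => (0 : Fin n → ℝ)) g (fun _ => (0 : Fin n → ℝ)) k x t := fun x hx k hk =>
    dx_eq_of_hasDerivWithinAt (N := 2 * m - 1)
      (f := fun k x => g k x t - transJet (P.phiD K) (fun _ _ => (0 : Fin n → ℝ)) g (fun _ => (0 : Fin n → ℝ)) k x t)
      (fun x hx => by
        have : P.volt K f x = conv (P.phiD K 0) f x := by
          simp only [volt, conv, phi_eq]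
        rw [this, conv_congr_right hx.1 (g := fun y => g 0 y t)
          fun y hy => hf y ⟨hy.1, hy.2.trans hx.2⟩]
        simp [transJet])
      (fun i hi x hx => (h.jet.space i hi t ht x hx).sub
        (hasDerivWithinAt_transJet (P.hasDerivAt_phiD K) (fun i x j => hasDerivAt_const x (0 : ℝ)) hgc
          (fun j hj x hx => h.jet.space j (by omega) t ht x hx) hx)) (by omega) hx
  have hΦ : ∀ j, ∀ x ∈ Icc (0 : ℝ) 1, ∀ k, dx k (fun x => P.Phi K x j) x = P.PhiD K k x j :=
    fun j x hx k => dx_eq_of_hasDerivWithinAt (N := k) (f := fun k x => P.PhiD K k x j)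
      (fun x _ => by rw [PhiD_zero])
      (fun i _ x _ => (P.hasDerivAt_PhiD K i x j).hasDerivWithinAt) le_rfl hx
  -- The splitting w = u - φ∗u - ΦX passes through any functional of order below 2m; the feedback is
  -- this identity for 𝓛 at x = 1 minus the one for 𝓒 at x = 0.
  have key : ∀ ℓ : (ℕ → ℝ) →ₗ[ℝ] ℝ, IsBoundedOn (2 * m) ℓ → ∀ x ∈ Icc (0 : ℝ) 1,
      ℓ (fun k => P.wJet K g X k x t) = ℓ (fun k => dx k f x)
        - (fun j => ℓ fun k => dx k (fun x => P.Phi K x j) x) ⬝ᵥ X t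
        - ℓ (fun k => dx k (P.volt K f) x) := by
    intro ℓ hℓ x hx
    have e1 : (fun j => ℓ fun k => dx k (fun x => P.Phi K x j) x) ⬝ᵥ X t
        = ℓ (∑ j, X t j • fun k => dx k (fun x => P.Phi K x j) x) := by
      rw [map_sum]
      exact Finset.sum_congr rfl fun j _ => by rw [map_smul, smul_eq_mul, mul_comm]
    rw [e1, ← map_sub, ← map_sub]
    refine hℓ.congr fun k hk => ?_
    simp only [Pi.sub_apply, Finset.sum_apply, Pi.smul_apply, hu x hx k hk, hv x hx k hk,
      hΦ _ x hx, smul_eq_mul]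
    simp only [wJet, transJet, dotProduct, mul_comm (X t _)]
    simp
    ring
  have e1 : (fun j => P.opL K c cm (fun x => P.Phi K x j) 1 - P.opC K (fun x => P.Phi K x j) 0)
      = (fun j => P.jetL K c cm fun k => dx k (fun x => P.Phi K x j) 1)
        - fun j => P.jetC K fun k => dx k (fun x => P.Phi K x j) 0 := by
    funext j
    simp only [opL_eq, opC_eq, Pi.sub_apply]
  rw [feedback, e1, key _ (P.isBoundedOn_jetL K hm c cm) 1 (by simp),
    key _ (P.isBoundedOn_jetC K hm) 0 (by simp), sub_dotProduct, opL_eq, opC_eq, opL_eq, opC_eq]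
  ring

/-! ### Boundary dynamics -/

/-- The `k`-th time derivative of `Φ(1) X`. -/
def tX (P : Plant n m) (K : Fin n → ℝ) (g : ℕ → ℝ → ℝ → ℝ) (X : ℝ → Fin n → ℝ) (k : ℕ) (t : ℝ) : ℝ :=
  P.PhiD K 0 1 ⬝ᵥ (P.A ^ k *ᵥ X t) + ∑ i ∈ Finset.range k,
    (P.PhiD K 0 1 ⬝ᵥ (P.A ^ i *ᵥ P.B)) * P.q ^ (k - 1 - i) * g (2 * (k - 1 - i) + 1) 0 t

/-- The `k`-th time derivative of `∫₀¹ φ(1,y) u(y) dy`, integrated by parts. -/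
def tV (P : Plant n m) (K : Fin n → ℝ) (g : ℕ → ℝ → ℝ → ℝ) (k : ℕ) (t : ℝ) : ℝ :=
  P.q ^ k * (conv (P.phiD K (2 * k)) (fun y => g 0 y t) 1 + ∑ i ∈ Finset.range (2 * k),
    (P.phiD K i 0 * g (2 * k - 1 - i) 1 t - P.phiD K i 1 * g (2 * k - 1 - i) 0 t))

/-- The equation for X contributes one new trace u_x(0,t), and each older trace gains two
x-derivatives by the heat equation. -/
theorem IsReduced.hasDerivWithinAt_tX (h : P.IsReduced N g X) (hq : 0 < P.q) {k : ℕ}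
    (hk : 2 * k + 1 ≤ N) {t : ℝ} (ht : 0 ≤ t) :
    HasDerivWithinAt (P.tX K g X k) (P.tX K g X (k + 1) t) (Ici 0) t := by
  have h1 : HasDerivWithinAt (fun t => P.PhiD K 0 1 ⬝ᵥ (P.A ^ k *ᵥ X t))
      (P.PhiD K 0 1 ⬝ᵥ (P.A ^ k *ᵥ (P.A *ᵥ X t + g 1 0 t • P.B))) (Ici 0) t := by
    simp only [Matrix.dotProduct_mulVec, dotProduct_comm (P.PhiD K 0 1 ᵥ* P.A ^ k)]
    exact hasDerivAt_dotProduct_const (fun j => hasDerivWithinAt_pi.1 (h.odeX t ht) j) _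
  have h2 : HasDerivWithinAt (fun t => ∑ i ∈ Finset.range k,
      (P.PhiD K 0 1 ⬝ᵥ (P.A ^ i *ᵥ P.B)) * P.q ^ (k - 1 - i) * g (2 * (k - 1 - i) + 1) 0 t)
      (∑ i ∈ Finset.range k, (P.PhiD K 0 1 ⬝ᵥ (P.A ^ i *ᵥ P.B)) * P.q ^ (k - i)
        * g (2 * (k - i) + 1) 0 t) (Ici 0) t := by
    refine HasDerivWithinAt.fun_sum fun i hi => ?_
    have hi' := Finset.mem_range.1 hi
    refine ((h.jet.time hq (i := 2 * (k - 1 - i) + 1) (by omega) ht (x := 0)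
      (by simp)).const_mul _).congr_deriv ?_
    rw [show 2 * (k - 1 - i) + 1 + 2 = 2 * (k - i) + 1 by omega,
      show k - i = k - 1 - i + 1 by omega, pow_succ]
    ring
  refine (h1.add h2).congr_deriv ?_
  rw [tX, Finset.sum_range_succ]
  simp only [Nat.add_sub_cancel, Nat.sub_self, pow_zero, mul_zero, zero_add, mul_one,
    Matrix.mulVec_add, Matrix.mulVec_mulVec, Matrix.mulVec_smul, dotProduct_add, dotProduct_smul,
    smul_eq_mul, pow_succ]
  ring

/-- Time derivative of `∫₀¹ κ(1 - y) u(y) dy`. -/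
theorem _root_.Sandwich.HeatJet.hasDerivWithinAt_conv_one {q : ℝ} (h : HeatJet q N g) (hN : 1 ≤ N)
    {κ κ' κ'' : ℝ → ℝ} (hκ : ∀ x, HasDerivAt κ (κ' x) x) (hκ' : ∀ x, HasDerivAt κ' (κ'' x) x)
    (hκ'' : Continuous κ'') {t : ℝ} (ht : 0 ≤ t) :
    HasDerivWithinAt (fun t => conv κ (fun y => g 0 y t) 1)
      (q * (conv κ'' (fun y => g 0 y t) 1 + (κ 0 * g 1 1 t - κ 1 * g 1 0 t)
        + (κ' 0 * g 0 1 t - κ' 1 * g 0 0 t))) (Ici 0) t := by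
  have hκ'c : Continuous κ' := continuous_iff_continuousAt.2 fun x => (hκ' x).continuousAt
  have hc0 := h.cont 0 (by omega)
  have hc1 := h.cont 1 hN
  have hu := continuous_uncurry_right hc0
  have h1 : (1 : ℝ) ∈ Icc (0 : ℝ) 1 := by simp
  have hprim : ∀ s, Continuous fun x => ∫ y in (0 : ℝ)..x, g 0 y s := fun s =>
    intervalIntegral.continuous_primitive (fun a b => (hu s).intervalIntegrable a b) 0
  -- Integration by parts replaces u by its primitive, whose time derivative is the flux; u_t itself
  -- need not exist pointwise when N = 1.
  have e1 : ∀ s, conv κ (fun y => g 0 y s) 1 = κ 0 * (∫ y in (0 : ℝ)..1, g 0 y s)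
      + conv κ' (fun x => ∫ y in (0 : ℝ)..x, g 0 y s) 1 := by
    intro s
    have := conv_deriv hκ hκ'c (hu s) (hprim s)
      (fun x _ => hasDerivWithinAt_integral_right (hu s) 0 x _) h1
    simpa using this
  have e2 := hasDerivWithinAt_conv_time (k := κ') (x := 1)
    (F := fun x s => ∫ y in (0 : ℝ)..x, g 0 y s)
    (F' := fun x s => q * (g 1 x s - g 1 0 s)) zero_le_one hκ'c hprim
    (continuous_const.mul (hc1.sub (hc1.comp (continuous_const.prodMk continuous_snd))))
    (fun y hy s hs => h.flux y hy s hs) ht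
  have e3 := ((h.flux 1 h1 t ht).const_mul (κ 0)).add e2
  refine (e3.congr (fun s _ => e1 s) (e1 t)).congr_deriv ?_
  have e4 : conv κ' (fun x => q * (g 1 x t - g 1 0 t)) 1
      = q * (conv κ' (fun x => g 1 x t) 1 - g 1 0 t * conv κ' (fun _ => 1) 1) := by
    rw [conv_const_mul, conv_sub hκ'c (continuous_uncurry_right hc1 t) continuous_const,
      ← conv_const_mul]
    simp only [mul_one]
  have e5 : conv κ' (fun _ => 1) 1 = κ 1 - κ 0 := by
    rw [conv_comm]
    simp only [conv, one_mul]
    exact intervalIntegral.integral_eq_sub_of_hasDerivAt (fun y _ => hκ y)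
      (hκ'c.intervalIntegrable _ _)
  have e6 := conv_deriv hκ' hκ'' (continuous_uncurry_right hc1 t) (hu t)
    (fun x hx => h.space 0 (by omega) t ht x hx) h1
  rw [e4, e5, e6]
  ring

/-- Integrated by parts, the k-th time derivative contains traces of order at most 2k - 1. Hence k =
m is still meaningful, although an H^{2m} function has no trace of order 2m. -/
theorem IsReduced.hasDerivWithinAt_tV (h : P.IsReduced N g X) (hq : 0 < P.q) {k : ℕ}
    (hk : 2 * k + 1 ≤ N) {t : ℝ} (ht : 0 ≤ t) :
    HasDerivWithinAt (P.tV K g k) (P.tV K g (k + 1) t) (Ici 0) t := by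
  have h1 := h.jet.hasDerivWithinAt_conv_one h.one_le (P.hasDerivAt_phiD K (2 * k))
    (P.hasDerivAt_phiD K (2 * k + 1)) (P.continuous_phiD K (2 * k + 2)) ht
  have h2 : HasDerivWithinAt (fun t => ∑ i ∈ Finset.range (2 * k),
      (P.phiD K i 0 * g (2 * k - 1 - i) 1 t - P.phiD K i 1 * g (2 * k - 1 - i) 0 t))
      (P.q * ∑ i ∈ Finset.range (2 * k),
        (P.phiD K i 0 * g (2 * k + 1 - i) 1 t - P.phiD K i 1 * g (2 * k + 1 - i) 0 t))
      (Ici 0) t := by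
    rw [Finset.mul_sum]
    refine HasDerivWithinAt.fun_sum fun i hi => ?_
    have hi' := Finset.mem_range.1 hi
    have e : 2 * k - 1 - i + 2 = 2 * k + 1 - i := by omega
    have d1 := (h.jet.time hq (i := 2 * k - 1 - i) (by omega) ht (x := 1)
      (by simp)).const_mul (P.phiD K i 0)
    have d0 := (h.jet.time hq (i := 2 * k - 1 - i) (by omega) ht (x := 0)
      (by simp)).const_mul (P.phiD K i 1)
    rw [e] at d0 d1
    exact (d1.sub d0).congr_deriv (by ring)
  refine ((h1.add h2).const_mul (P.q ^ k)).congr_deriv ?_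
  rw [tV, show 2 * (k + 1) = 2 * k + 1 + 1 by ring, Finset.sum_range_succ, Finset.sum_range_succ,
    pow_succ]
  simp only [Nat.add_sub_cancel, Nat.sub_self, Nat.add_sub_cancel_left]
  ring

/-- The boundary values `∂_t^k w(1,t) = q^k ∂ₓ^{2k} w(1,t)` in terms of `u` and `X`. -/
theorem IsReduced.wJet_one_eq (h : P.IsReduced N g X) (hq : 0 < P.q) {k : ℕ} (hk : 2 * k ≤ N)
    {t : ℝ} (ht : 0 ≤ t) :
    P.q ^ k * P.wJet K g X (2 * k) 1 t
      = P.q ^ k * g (2 * k) 1 t - P.tV K g k t - P.tX K g X k t := by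
  have hw := h.heatJet_wJet K hq
  have h1 : (1 : ℝ) ∈ Icc (0 : ℝ) 1 := by simp
  induction k generalizing t with
  | zero => simp [wJet, transJet, tV, tX]
  | succ k ih =>
    have d1 := (hw.time hq (i := 2 * k) (by omega) ht h1).const_mul (P.q ^ k)
    have d2 := (((h.jet.time hq (i := 2 * k) (by omega) ht h1).const_mul (P.q ^ k)).sub
      (h.hasDerivWithinAt_tV K hq (k := k) (by omega) ht)).sub
      (h.hasDerivWithinAt_tX K hq (k := k) (by omega) ht)
    have d3 := d2.congr (fun s hs => ih (by omega) hs) (ih (by omega) ht)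
    have := (uniqueDiffOn_Ici (0 : ℝ) t ht).eq_deriv _ d1 d3
    rw [show 2 * (k + 1) = 2 * k + 2 by ring, pow_succ, mul_assoc, this]
    ring

/-- The part of `∂ₓᵏ u(x)` that is of lower order in `w` and `X`, up to sign. -/
def rho (P : Plant n m) (K : Fin n → ℝ) (w : ℝ → ℝ) (ξ : Fin n → ℝ) (k : ℕ) (x : ℝ) : ℝ :=
  conv (P.psiD K k) w x + P.GamD K k x ⬝ᵥ ξ

/-- `invJ` keeps the point values of w in the inverse transformation; the integral and the X-term
that it drops form `rho`. -/
theorem IsReduced.invJ_wJet (h : P.IsReduced N g X) (hq : 0 < P.q) {k : ℕ} (hk : k ≤ N)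
    {t : ℝ} (ht : 0 ≤ t) {x : ℝ} (hx : x ∈ Icc (0 : ℝ) 1) :
    P.invJ K k (fun k => P.wJet K g X k x t)
      = g k x t + P.rho K (fun y => P.wJet K g X 0 y t) (X t) k x := by
  rw [← h.transJet_wJet K hq hk ht hx]
  simp [invJ, rho, transJet]
  ring

/-- The perturbation in the equation for `∂_t^m w(1,t)`. -/
def distG (P : Plant n m) (K : Fin n → ℝ) (w : ℝ → ℝ) (ξ : Fin n → ℝ) : ℝ :=
  -(∑ k : Fin m, P.a k * P.q ^ (k : ℕ) * P.rho K w ξ (2 * k) 1)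
    + P.q ^ m * (∑ i ∈ Finset.range (2 * m), P.phiD K i 0 * P.rho K w ξ (2 * m - 1 - i) 1)
    - P.q ^ m * (∑ i ∈ Finset.range (2 * m), P.phiD K i 1 * P.rho K w ξ (2 * m - 1 - i) 0)
    + (∑ i ∈ Finset.range m, (P.PhiD K 0 1 ⬝ᵥ (P.A ^ i *ᵥ P.B)) * P.q ^ (m - 1 - i) *
        P.rho K w ξ (2 * (m - 1 - i) + 1) 0)
    - P.q ^ m * conv (P.phiD K (2 * m)) (fun y => w y - P.rho K w ξ 0 y) 1
    - P.PhiD K 0 1 ⬝ᵥ (P.A ^ m *ᵥ ξ)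

/-- The cancellation achieved by the feedback law at the boundary. -/
theorem IsReduced.boundary_identity (hm : 1 ≤ m) (h : P.IsReduced (2 * m - 1) g X) (hq : 0 < P.q)
    {t : ℝ} (ht : 0 ≤ t) :
    (∑ k : Fin m, P.a k * P.q ^ (k : ℕ) * g (2 * k) 1 t) - P.tV K g m t - P.tX K g X m t
      - P.jetB K (fun k => P.wJet K g X k 1 t) - P.jetC K (fun k => P.wJet K g X k 0 t)
      = P.distG K (fun y => P.wJet K g X 0 y t) (X t) := by
  set w : ℝ → ℝ := fun y => P.wJet K g X 0 y t with hw
  -- Up to `rho`-terms, 𝓑 reproduces the traces at x = 1 in `tV` and in the companion row, and 𝓒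
  -- those at x = 0 in `tV` and `tX`.
  have e1 : P.jetB K (fun k => P.wJet K g X k 1 t)
      = (∑ k : Fin m, P.a k * P.q ^ (k : ℕ) * g (2 * k) 1 t)
        + (∑ k : Fin m, P.a k * P.q ^ (k : ℕ) * P.rho K w (X t) (2 * k) 1)
        - P.q ^ m * ((∑ i ∈ Finset.range (2 * m), P.phiD K i 0 * g (2 * m - 1 - i) 1 t)
          + ∑ i ∈ Finset.range (2 * m), P.phiD K i 0 * P.rho K w (X t) (2 * m - 1 - i) 1) := by
    simp only [jetB, LinearMap.sub_apply, LinearMap.sum_apply, LinearMap.smul_apply, smul_eq_mul]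
    rw [← Finset.sum_add_distrib, ← Finset.sum_add_distrib]
    congr 1
    · refine Finset.sum_congr rfl fun k _ => ?_
      rw [h.invJ_wJet K hq (by omega) ht (by simp)]; ring
    · congr 1
      refine Finset.sum_congr rfl fun k _ => ?_
      rw [h.invJ_wJet K hq (by omega) ht (by simp)]; ring
  have e2 : P.jetC K (fun k => P.wJet K g X k 0 t)
      = P.q ^ m * ((∑ i ∈ Finset.range (2 * m), P.phiD K i 1 * g (2 * m - 1 - i) 0 t)
          + ∑ i ∈ Finset.range (2 * m), P.phiD K i 1 * P.rho K w (X t) (2 * m - 1 - i) 0)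
        - ((∑ i ∈ Finset.range m, (P.PhiD K 0 1 ⬝ᵥ (P.A ^ i *ᵥ P.B)) * P.q ^ (m - 1 - i) *
            g (2 * (m - 1 - i) + 1) 0 t)
          + ∑ i ∈ Finset.range m, (P.PhiD K 0 1 ⬝ᵥ (P.A ^ i *ᵥ P.B)) * P.q ^ (m - 1 - i) *
            P.rho K w (X t) (2 * (m - 1 - i) + 1) 0) := by
    simp only [jetC, LinearMap.sub_apply, LinearMap.sum_apply, LinearMap.smul_apply, smul_eq_mul]
    rw [← Finset.sum_add_distrib, ← Finset.sum_add_distrib]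
    congr 1
    · congr 1
      refine Finset.sum_congr rfl fun k _ => ?_
      rw [h.invJ_wJet K hq (by omega) ht (by simp)]; ring
    · refine Finset.sum_congr rfl fun k _ => ?_
      rw [h.invJ_wJet K hq (by omega) ht (by simp)]; ring
  have e3 : conv (P.phiD K (2 * m)) (fun y => w y - P.rho K w (X t) 0 y) 1
      = conv (P.phiD K (2 * m)) (fun y => g 0 y t) 1 := by
    refine conv_congr_right zero_le_one fun y hy => ?_
    have := h.invJ_wJet K hq (k := 0) (by omega) ht hy
    simp only [invJ, Finset.range_zero, Finset.sum_empty, sub_zero, LinearMap.proj_apply] at this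
    rw [hw]
    simp only
    rw [this]
    ring
  rw [e1, e2, distG, e3, tV, tX, Finset.sum_sub_distrib]
  ring

end Plant

/-! ### The virtual controls -/

/-- Each step of the recursion raises the degree by at most one. Hence y_i is monic of degree i - 1
in ∂_t, and the passage to the y_i is triangular. -/
theorem tau_coeff_eq_zero (c : ℕ → ℝ) (i j : ℕ) (h : i ≤ j) : (tau c i).coeff j = 0 := by
  induction i using Nat.strong_induction_on generalizing j with
  | _ i ih =>
    match i with
    | 0 => simp [tau]
    | 1 =>
      rw [tau, Polynomial.coeff_C_of_ne_zero (by omega)]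
    | i + 2 =>
      obtain ⟨j, rfl⟩ : ∃ l, j = l + 1 := ⟨j - 1, by omega⟩
      have h1 := ih (i + 1) (by omega) j (by omega)
      have h2 := ih i (by omega) (j + 1) (by omega)
      have h3 := ih (i + 1) (by omega) (j + 1) (by omega)
      simp only [tau, Polynomial.coeff_add, Polynomial.coeff_X_mul, Polynomial.coeff_C_mul,
        Polynomial.coeff_X_pow, h1, h2, h3]
      rw [if_neg (by omega), if_neg (by omega)]
      ring

/-- The recursion for τ read backwards; τ is defined so that the states form this chain. -/
theorem X_mul_yPoly (c : ℕ → ℝ) (i : ℕ) :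
    Polynomial.X * yPoly c (i + 1)
      = yPoly c (i + 2) - yPoly c i - Polynomial.C (c (i + 1)) * yPoly c (i + 1) := by
  match i with
  | 0 => simp [yPoly, tau]
  | i + 1 =>
    simp only [yPoly, tau]
    ring

theorem yPoly_coeff (c : ℕ → ℝ) (i j : ℕ) (h : i ≤ j) :
    (yPoly c (i + 1)).coeff j = if i = j then 1 else 0 := by
  rw [yPoly, Polynomial.coeff_add, Polynomial.coeff_X_pow, tau_coeff_eq_zero c i j h, add_zero]
  simp only [eq_comm]

/-- `p(∂_t)` applied to a function with time derivatives `η`, truncated at the order `m`. -/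
def evP (m : ℕ) (p : Polynomial ℝ) (η : ℕ → ℝ) : ℝ := ∑ j ∈ Finset.range m, p.coeff j * η j

theorem evP_add (p p' : Polynomial ℝ) (η : ℕ → ℝ) :
    evP m (p + p') η = evP m p η + evP m p' η := by
  simp [evP, add_mul, Finset.sum_add_distrib]

theorem evP_sub (p p' : Polynomial ℝ) (η : ℕ → ℝ) :
    evP m (p - p') η = evP m p η - evP m p' η := by
  simp [evP, sub_mul, Finset.sum_sub_distrib]

theorem evP_C_mul (a : ℝ) (p : Polynomial ℝ) (η : ℕ → ℝ) :
    evP m (Polynomial.C a * p) η = a * evP m p η := by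
  simp [evP, Finset.mul_sum, mul_assoc]

theorem abs_evP_le (p : Polynomial ℝ) {η : ℕ → ℝ} {S : ℝ} (h : ∀ j < m, |η j| ≤ S) :
    |evP m p η| ≤ (∑ j ∈ Finset.range m, |p.coeff j|) * S := by
  rw [Finset.sum_mul]
  refine (Finset.abs_sum_le_sum_abs _ _).trans (Finset.sum_le_sum fun j hj => ?_)
  rw [abs_mul]
  exact mul_le_mul_of_nonneg_left (h j (Finset.mem_range.1 hj)) (abs_nonneg _)

/-- Differentiation shifts coefficients like multiplication by X; the truncation drops the order k +
1, which is restored as a separate term. -/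
theorem hasDerivWithinAt_evP {k : ℕ} {η : ℕ → ℝ → ℝ} {t : ℝ} {s : Set ℝ}
    (h : ∀ j < k + 1, HasDerivWithinAt (η j) (η (j + 1) t) s t) (p : Polynomial ℝ) :
    HasDerivWithinAt (fun t => evP (k + 1) p fun j => η j t)
      (evP (k + 1) (Polynomial.X * p) (fun j => η j t) + p.coeff k * η (k + 1) t) s t := by
  have h1 : HasDerivWithinAt (fun t => evP (k + 1) p fun j => η j t)
      (∑ j ∈ Finset.range (k + 1), p.coeff j * η (j + 1) t) s t :=
    HasDerivWithinAt.fun_sum fun j hj => (h j (Finset.mem_range.1 hj)).const_mul _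
  refine h1.congr_deriv ?_
  rw [Finset.sum_range_succ, evP, Finset.sum_range_succ']
  simp [Polynomial.coeff_X_mul]

/-- The time derivatives are controlled by the states `y_i`. -/
theorem exists_bound_of_yPoly (m : ℕ) (c : ℕ → ℝ) :
    ∃ C : ℝ, 0 ≤ C ∧ ∀ (η : ℕ → ℝ) (S : ℝ), 0 ≤ S →
      (∀ i < m, |evP m (yPoly c (i + 1)) η| ≤ S) → ∀ j < m, |η j| ≤ C * S := by
  suffices H : ∀ J ≤ m, ∃ C : ℝ, 0 ≤ C ∧ ∀ (η : ℕ → ℝ) (S : ℝ), 0 ≤ S →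
      (∀ i < m, |evP m (yPoly c (i + 1)) η| ≤ S) → ∀ j < J, |η j| ≤ C * S from H m le_rfl
  intro J hJ
  induction J with
  | zero => exact ⟨0, le_rfl, fun _ _ _ _ j hj => absurd hj (Nat.not_lt_zero j)⟩
  | succ J ih =>
    -- Forward substitution: the next state is η_J plus τ_J, which involves only orders below J.
    obtain ⟨C, hC, hb⟩ := ih (by omega)
    set A := ∑ l ∈ Finset.range m, |(tau c J).coeff l| with hA
    have hA0 : 0 ≤ A := Finset.sum_nonneg fun _ _ => abs_nonneg _
    refine ⟨C + 1 + A * C, by positivity, fun η S hS h j hj => ?_⟩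
    have hbj := hb η S hS h
    have hAC : 0 ≤ A * C * S := by positivity
    have hCS : 0 ≤ C * S := by positivity
    rcases Nat.lt_succ_iff_lt_or_eq.1 hj with hj | rfl
    · linarith [hbj j hj]
    · have e1 : evP m (yPoly c (j + 1)) η = η j + evP m (tau c j) η := by
        rw [yPoly, evP_add]
        congr 1
        simp only [evP, Polynomial.coeff_X_pow, ite_mul, one_mul, zero_mul]
        rw [Finset.sum_ite_eq' (Finset.range m) j, if_pos (Finset.mem_range.2 hJ)]
      have e2 : |evP m (tau c j) η| ≤ A * (C * S) := by
        rw [hA, Finset.sum_mul]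
        refine (Finset.abs_sum_le_sum_abs _ _).trans (Finset.sum_le_sum fun l hl => ?_)
        rw [abs_mul]
        rcases lt_or_ge l j with hlj | hlj
        · exact mul_le_mul_of_nonneg_left (hbj l hlj) (abs_nonneg _)
        · rw [tau_coeff_eq_zero c j l hlj]; simp
      have e3 := h j hJ
      rw [e1] at e3
      have e4 := abs_sub (η j + evP m (tau c j) η) (evP m (tau c j) η)
      rw [add_sub_cancel_right] at e4
      nlinarith

/-! ### Bounds for the perturbation -/

namespace Plant

variable (P : Plant n m) (K : Fin n → ℝ)

theorem abs_dotProduct_le (v ξ : Fin n → ℝ) : |v ⬝ᵥ ξ| ≤ (∑ i, |v i|) * ‖ξ‖ := by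
  rw [Finset.sum_mul]
  refine (Finset.abs_sum_le_sum_abs _ _).trans (Finset.sum_le_sum fun i _ => ?_)
  rw [abs_mul]
  exact mul_le_mul_of_nonneg_left (norm_le_pi_norm ξ i) (abs_nonneg _)

theorem exists_bound_rho (k : ℕ) : ∃ C : ℝ, 0 ≤ C ∧ ∀ (w : ℝ → ℝ) (ξ : Fin n → ℝ) (S : ℝ),
    (∀ x ∈ Icc (0 : ℝ) 1, |w x| ≤ S) → ‖ξ‖ ≤ S → ∀ x ∈ Icc (0 : ℝ) 1,
      |P.rho K w ξ k x| ≤ C * S := by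
  obtain ⟨C₁, h₁⟩ := isCompact_Icc.exists_bound_of_continuousOn
    (P.continuous_psiD K k).continuousOn (s := Icc (0 : ℝ) 1)
  have hc : Continuous fun x => ∑ i, |P.GamD K k x i| :=
    continuous_finsetSum _ fun i _ => ((continuous_apply i).comp (P.continuous_GamD K k)).abs
  obtain ⟨C₂, h₂⟩ := isCompact_Icc.exists_bound_of_continuousOn hc.continuousOn
    (s := Icc (0 : ℝ) 1)
  have hC₁ : 0 ≤ C₁ := (norm_nonneg _).trans (h₁ 0 (by simp))
  have hC₂ : 0 ≤ C₂ := (norm_nonneg _).trans (h₂ 0 (by simp))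
  refine ⟨C₁ + C₂, add_nonneg hC₁ hC₂, fun w ξ S hw hξ x hx => ?_⟩
  rw [rho, add_mul]
  refine (abs_add_le _ _).trans (add_le_add (abs_conv_le hx (fun y hy => h₁ y hy) hw) ?_)
  refine (abs_dotProduct_le _ _).trans ?_
  exact mul_le_mul ((le_abs_self _).trans (h₂ x hx)) hξ (norm_nonneg _) hC₂

/-- Functionals of `(w, X)` that are of lower order. -/
def IsLowerOrder (F : (ℝ → ℝ) → (Fin n → ℝ) → ℝ) : Prop :=
  ∃ C : ℝ, 0 ≤ C ∧ ∀ (w : ℝ → ℝ) (ξ : Fin n → ℝ) (S : ℝ),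
    (∀ x ∈ Icc (0 : ℝ) 1, |w x| ≤ S) → ‖ξ‖ ≤ S → |F w ξ| ≤ C * S

namespace IsLowerOrder

variable {F F' : (ℝ → ℝ) → (Fin n → ℝ) → ℝ}

theorem add (h : IsLowerOrder F) (h' : IsLowerOrder F') :
    IsLowerOrder fun w ξ => F w ξ + F' w ξ := by
  obtain ⟨C, hC, hb⟩ := h
  obtain ⟨C', hC', hb'⟩ := h'
  refine ⟨C + C', add_nonneg hC hC', fun w ξ S hw hξ => ?_⟩
  rw [add_mul]
  exact (abs_add_le _ _).trans (add_le_add (hb w ξ S hw hξ) (hb' w ξ S hw hξ))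

theorem const_mul (a : ℝ) (h : IsLowerOrder F) : IsLowerOrder fun w ξ => a * F w ξ := by
  obtain ⟨C, hC, hb⟩ := h
  refine ⟨|a| * C, by positivity, fun w ξ S hw hξ => ?_⟩
  rw [abs_mul, mul_assoc]
  exact mul_le_mul_of_nonneg_left (hb w ξ S hw hξ) (abs_nonneg _)

theorem neg (h : IsLowerOrder F) : IsLowerOrder fun w ξ => -F w ξ := by
  simpa using h.const_mul (-1)

theorem sub (h : IsLowerOrder F) (h' : IsLowerOrder F') :
    IsLowerOrder fun w ξ => F w ξ - F' w ξ := by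
  simpa only [sub_eq_add_neg] using h.add h'.neg

theorem sum {ι : Type*} {s : Finset ι} {F : ι → (ℝ → ℝ) → (Fin n → ℝ) → ℝ}
    (h : ∀ i ∈ s, IsLowerOrder (F i)) : IsLowerOrder fun w ξ => ∑ i ∈ s, F i w ξ := by
  classical
  induction s using Finset.induction_on with
  | empty => exact ⟨0, le_rfl, fun w ξ S _ _ => by simp⟩
  | insert a s ha ih =>
    simp only [Finset.sum_insert ha]
    exact (h a (Finset.mem_insert_self _ _)).add
      (ih fun i hi => h i (Finset.mem_insert_of_mem hi))

end IsLowerOrder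

theorem isLowerOrder_rho (k : ℕ) {x : ℝ} (hx : x ∈ Icc (0 : ℝ) 1) :
    IsLowerOrder fun w ξ => P.rho K w ξ k x := by
  obtain ⟨C, hC, h⟩ := P.exists_bound_rho K k
  exact ⟨C, hC, fun w ξ S hw hξ => h w ξ S hw hξ x hx⟩

/-- Every term is built from w, integrals of w against continuous kernels and linear forms in X. No
derivative of w and no gain occurs, so the constant does not depend on c_m. -/
theorem isLowerOrder_distG : IsLowerOrder (P.distG K) := by
  have h0 : (0 : ℝ) ∈ Icc (0 : ℝ) 1 := by simp
  have h1 : (1 : ℝ) ∈ Icc (0 : ℝ) 1 := by simp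
  have hconv : IsLowerOrder fun w ξ =>
      conv (P.phiD K (2 * m)) (fun y => w y - P.rho K w ξ 0 y) 1 := by
    obtain ⟨C, hC, hρ⟩ := P.exists_bound_rho K 0
    obtain ⟨C₁, hb⟩ := isCompact_Icc.exists_bound_of_continuousOn
      (P.continuous_phiD K (2 * m)).continuousOn (s := Icc (0 : ℝ) 1)
    have hC₁ : 0 ≤ C₁ := (norm_nonneg _).trans (hb 0 (by simp))
    refine ⟨C₁ * (1 + C), by positivity, fun w ξ S hw hξ => ?_⟩
    rw [mul_assoc]
    refine abs_conv_le h1 (fun y hy => hb y hy) fun y hy => ?_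
    have e1 := abs_sub (w y) (P.rho K w ξ 0 y)
    have e2 := hw y hy
    have e3 := hρ w ξ S hw hξ y hy
    linarith
  have hX : IsLowerOrder fun (_ : ℝ → ℝ) ξ => P.PhiD K 0 1 ⬝ᵥ (P.A ^ m *ᵥ ξ) := by
    refine ⟨∑ i, |(P.PhiD K 0 1 ᵥ* P.A ^ m) i|, Finset.sum_nonneg fun _ _ => abs_nonneg _,
      fun w ξ S _ hξ => ?_⟩
    change |P.PhiD K 0 1 ⬝ᵥ (P.A ^ m *ᵥ ξ)| ≤ _
    rw [Matrix.dotProduct_mulVec]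
    exact (abs_dotProduct_le _ _).trans
      (mul_le_mul_of_nonneg_left hξ (Finset.sum_nonneg fun _ _ => abs_nonneg _))
  have hρ := fun k => P.isLowerOrder_rho K k h1
  have hρ' := fun k => P.isLowerOrder_rho K k h0
  exact ((((((IsLowerOrder.sum fun k _ => (hρ _).const_mul _).neg).add
    ((IsLowerOrder.sum fun i _ => (hρ _).const_mul _).const_mul _)).sub
    ((IsLowerOrder.sum fun i _ => (hρ' _).const_mul _).const_mul _)).add
    (IsLowerOrder.sum fun i _ => (hρ' _).const_mul _)).sub (hconv.const_mul _)).sub hX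

/-! ### The target system -/

/-- The closed loop in terms of the jet `w` of the backstepping variable. -/
structure IsTarget (P : Plant n m) (K : Fin n → ℝ) (c : ℕ → ℝ) (cm : ℝ) (w : ℕ → ℝ → ℝ → ℝ)
    (X : ℝ → Fin n → ℝ) : Prop where
  jet : HeatJet P.q (2 * m - 1) w
  odeX : ∀ t, 0 ≤ t → HasDerivWithinAt X (P.AK K *ᵥ X t + w 1 0 t • P.B) (Ici 0) t
  left : ∀ t, 0 ≤ t → w 0 0 t = 0
  top : ∀ t, 0 ≤ t → HasDerivWithinAt (fun t => P.q ^ (m - 1) * w (2 * (m - 1)) 1 t)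
    (P.distG K (fun x => w 0 x t) (X t)
      - ∑ i ∈ Finset.range m, (alpha m c i + cm * beta m c i) * (P.q ^ i * w (2 * i) 1 t))
    (Ici 0) t

variable {P} {K} {c : ℕ → ℝ} {cm : ℝ} {u : ℝ → ℝ → ℝ} {X : ℝ → Fin n → ℝ} {Z : ℝ → Fin m → ℝ}
  {U : ℝ → ℝ}

/-- X is extended by X(0) to negative times, which makes it continuous on ℝ; derivatives within
[0,∞) do not see the extension. -/
theorem IsClosedLoopSolution.isReduced (hm : 1 ≤ m) (h : P.IsClosedLoopSolution K c cm u X Z U) :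
    P.IsReduced (2 * m - 1) (uJet u) fun t => X (max t 0) where
  one_le := by omega
  jet := h.heatJet hm
  contX := by
    have hc : ContinuousOn X (Ici 0) := fun t ht => (h.odeX t ht).continuousWithinAt
    exact hc.comp_continuous (by fun_prop) fun t => mem_Ici.2 (le_max_right _ _)
  odeX t ht := by
    have e : ∀ s ∈ Ici (0 : ℝ), X (max s 0) = X s := fun s hs => by rw [max_eq_left hs]
    refine ((h.odeX t ht).congr e (e t ht)).congr_deriv ?_
    rw [e t ht, uJet_of_mem u 1 (by simp) ht]
  left t ht := by
    rw [uJet_zero u (by simp) ht, h.left t ht, max_eq_left ht]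

/-- The state of the input ODE consists of the time derivatives of `u(1,t)`. -/
theorem IsClosedLoopSolution.Z_eq (hm : 1 ≤ m) (hq : 0 < P.q)
    (h : P.IsClosedLoopSolution K c cm u X Z U) (i : ℕ) (hi : i < m) {t : ℝ} (ht : 0 ≤ t) :
    Z t ⟨i, hi⟩ = P.q ^ i * uJet u (2 * i) 1 t := by
  have hj := h.heatJet hm
  have h1 : (1 : ℝ) ∈ Icc (0 : ℝ) 1 := by simp
  induction i generalizing t with
  | zero =>
    have := h.right t ht
    rw [pow_zero, one_mul, uJet_zero u h1 ht, this, dotProduct,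
      Finset.sum_eq_single ⟨0, hi⟩ (fun j _ hj => ?_) (by simp)]
    · simp [Cz]
    · have : j.val ≠ 0 := fun h0 => hj (Fin.ext h0)
      simp [Cz, this]
  | succ i ih =>
    have hi' : i < m := by omega
    have d1 := hasDerivWithinAt_pi.1 (h.odeZ t ht) ⟨i, hi'⟩
    have d2 := ((hj.time hq (i := 2 * i) (by omega) ht h1).const_mul (P.q ^ i)).congr
      (fun s hs => ih hi' hs) (ih hi' ht)
    have e := (uniqueDiffOn_Ici (0 : ℝ) t ht).eq_deriv _ d1 d2
    have e2 : (P.Az *ᵥ Z t + U t • Bz m) ⟨i, hi'⟩ = Z t ⟨i + 1, hi⟩ := by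
      have hne : i + 1 ≠ m := by omega
      simp only [Pi.add_apply, Pi.smul_apply, Bz, hne, if_false, smul_zero, add_zero,
        Matrix.mulVec, dotProduct, Az]
      rw [Finset.sum_eq_single ⟨i + 1, hi⟩ (fun j _ hj => ?_) (by simp)]
      · simp
      · have : j.val ≠ i + 1 := fun h0 => hj (Fin.ext h0)
        simp [this]
    rw [← e2, e, show 2 * (i + 1) = 2 * i + 2 by ring, pow_succ]
    ring

/-- The last row of the Z-equation supplies the time derivative of the trace of order 2m - 2, which
the heat jet cannot give. -/
theorem IsClosedLoopSolution.hasDerivWithinAt_top (hm : 1 ≤ m) (hq : 0 < P.q)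
    (h : P.IsClosedLoopSolution K c cm u X Z U) {t : ℝ} (ht : 0 ≤ t) :
    HasDerivWithinAt (fun t => P.q ^ (m - 1) * uJet u (2 * (m - 1)) 1 t)
      ((∑ k : Fin m, P.a k * P.q ^ (k : ℕ) * uJet u (2 * k) 1 t) + U t) (Ici 0) t := by
  have hi : m - 1 < m := by omega
  have d1 := hasDerivWithinAt_pi.1 (h.odeZ t ht) ⟨m - 1, hi⟩
  refine (d1.congr (fun s hs => (h.Z_eq hm hq (m - 1) hi hs).symm)
    (h.Z_eq hm hq (m - 1) hi ht).symm).congr_deriv ?_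
  have he : m - 1 + 1 = m := by omega
  simp only [Pi.add_apply, Pi.smul_apply, Bz, he, if_true, smul_eq_mul, mul_one, Matrix.mulVec,
    dotProduct, Az]
  congr 1
  refine Finset.sum_congr rfl fun k _ => ?_
  rw [h.Z_eq hm hq k k.2 ht]
  ring

/-- The control in terms of `w`. -/
theorem IsClosedLoopSolution.control_eq (hm : 1 ≤ m) (h : P.IsClosedLoopSolution K c cm u X Z U)
    {t : ℝ} (ht : 0 ≤ t) :
    U t = P.jetL K c cm (fun k => P.wJet K (uJet u) (fun t => X (max t 0)) k 1 t)
      - P.jetC K (fun k => P.wJet K (uJet u) (fun t => X (max t 0)) k 0 t) := by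
  rw [← (h.isReduced hm).feedback_eq K hm c cm ht (f := fun x => u x t)
    (fun x hx => (uJet_zero u hx ht).symm), h.control t ht, max_eq_left ht]

theorem IsClosedLoopSolution.isTarget (hm : 1 ≤ m) (hq : 0 < P.q)
    (h : P.IsClosedLoopSolution K c cm u X Z U) :
    P.IsTarget K c cm (P.wJet K (uJet u) fun t => X (max t 0)) fun t => X (max t 0) where
  jet := (h.isReduced hm).heatJet_wJet K hq
  odeX t ht := (h.isReduced hm).odeX_wJet K ht
  left t ht := (h.isReduced hm).wJet_zero_left K ht
  top t ht := by
    have hr := h.isReduced hm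
    have d := ((h.hasDerivWithinAt_top hm hq ht).sub
      (hr.hasDerivWithinAt_tV K hq (k := m - 1) (by omega) ht)).sub
      (hr.hasDerivWithinAt_tX K hq (k := m - 1) (by omega) ht)
    refine (d.congr (fun s hs => hr.wJet_one_eq K hq (by omega) hs)
      (hr.wJet_one_eq K hq (by omega) ht)).congr_deriv ?_
    -- The parts -𝓑 and -𝓒 of the control complete the left side of `boundary_identity`; the rest of
    -- 𝓛 is the damping.
    rw [h.control_eq hm ht, ← hr.boundary_identity K hm hq ht, show m - 1 + 1 = m by omega]
    simp only [jetL, LinearMap.sub_apply, LinearMap.neg_apply, LinearMap.sum_apply,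
      LinearMap.smul_apply, LinearMap.proj_apply, smul_eq_mul]
    have e : ∀ i, P.q ^ i * (alpha m c i + cm * beta m c i)
        * P.wJet K (uJet u) (fun t => X (max t 0)) (2 * i) 1 t
        = (alpha m c i + cm * beta m c i)
        * (P.q ^ i * P.wJet K (uJet u) (fun t => X (max t 0)) (2 * i) 1 t) := fun i => by ring
    simp only [e]
    ring

end Plant

/-! ### Decay of the target system -/

theorem HeatJet.abs_sub_le {q M t : ℝ} {N i : ℕ} {g : ℕ → ℝ → ℝ → ℝ} (hg : HeatJet q N g)
    (hi : i + 1 ≤ N) (ht : 0 ≤ t) (hM : ∀ x ∈ Icc (0 : ℝ) 1, |g (i + 1) x t| ≤ M)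
    {x y : ℝ} (hx : x ∈ Icc (0 : ℝ) 1) (hy : y ∈ Icc (0 : ℝ) 1) :
    |g i x t - g i y t| ≤ M * |x - y| :=
  (convex_Icc (0 : ℝ) 1).norm_image_sub_le_of_norm_hasDerivWithin_le
    (fun z hz => hg.space i (by omega) t ht z hz) hM hy hx

namespace Plant

/-- The time derivatives of `w(1,t)`, up to the order `m`, in terms of the state. -/
def topDt (P : Plant n m) (K : Fin n → ℝ) (c : ℕ → ℝ) (cm : ℝ) (w : ℕ → ℝ → ℝ → ℝ)
    (X : ℝ → Fin n → ℝ) (k : ℕ) (t : ℝ) : ℝ :=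
  if k < m then P.q ^ k * w (2 * k) 1 t
  else P.distG K (fun x => w 0 x t) (X t)
    - ∑ i ∈ Finset.range m, (alpha m c i + cm * beta m c i) * (P.q ^ i * w (2 * i) 1 t)

namespace IsTarget

variable {P : Plant n m} {K : Fin n → ℝ} {c : ℕ → ℝ} {cm : ℝ} {w : ℕ → ℝ → ℝ → ℝ}
  {X : ℝ → Fin n → ℝ}

theorem hasDerivWithinAt_topDt (h : P.IsTarget K c cm w X) (hq : 0 < P.q) {k : ℕ} (hk : k < m)
    {t : ℝ} (ht : 0 ≤ t) :
    HasDerivWithinAt (P.topDt K c cm w X k) (P.topDt K c cm w X (k + 1) t) (Ici 0) t := by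
  have e : P.topDt K c cm w X k = fun t => P.q ^ k * w (2 * k) 1 t := by
    funext s; rw [topDt, if_pos hk]
  rw [e, topDt]
  split_ifs with h1
  · refine ((h.jet.time hq (i := 2 * k) (by omega) ht (by simp)).const_mul _).congr_deriv ?_
    rw [show 2 * (k + 1) = 2 * k + 2 by ring, pow_succ]
    ring
  · obtain rfl : k = m - 1 := by omega
    exact h.top t ht

theorem sum_mul_topDt (w : ℕ → ℝ → ℝ → ℝ) (X : ℝ → Fin n → ℝ) (t : ℝ) :
    ∑ i ∈ Finset.range m, (alpha m c i + cm * beta m c i) * (P.q ^ i * w (2 * i) 1 t)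
      = evP m (yPoly c (m - 1) + Polynomial.X * tau c (m - 1))
          (fun j => P.topDt K c cm w X j t)
        + cm * evP m (yPoly c m) (fun j => P.topDt K c cm w X j t) := by
  rw [evP, evP, Finset.mul_sum, ← Finset.sum_add_distrib]
  refine Finset.sum_congr rfl fun i hi => ?_
  rw [topDt, if_pos (Finset.mem_range.1 hi), alpha, beta]
  ring

theorem hasDerivWithinAt_yPoly (h : P.IsTarget K c cm w X) (hq : 0 < P.q) {i : ℕ}
    (hi : i + 1 < m) {t : ℝ} (ht : 0 ≤ t) :
    HasDerivWithinAt (fun t => evP m (yPoly c (i + 1)) fun j => P.topDt K c cm w X j t)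
      (evP m (yPoly c (i + 2)) (fun j => P.topDt K c cm w X j t)
        - evP m (yPoly c i) (fun j => P.topDt K c cm w X j t)
        - c (i + 1) * evP m (yPoly c (i + 1)) fun j => P.topDt K c cm w X j t) (Ici 0) t := by
  obtain ⟨k, rfl⟩ : ∃ k, m = k + 1 := ⟨m - 1, by omega⟩
  refine (hasDerivWithinAt_evP (fun j hj => h.hasDerivWithinAt_topDt hq hj ht) _).congr_deriv ?_
  rw [yPoly_coeff c i k (by omega), if_neg (by omega), X_mul_yPoly, evP_sub, evP_sub, evP_C_mul]
  ring

/-- The coefficients α cancel ∂_t τ_{m-1} and supply -y_{m-1}; c_m β supplies the damping -c_m y_m.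
-/
theorem hasDerivWithinAt_yPoly_top (h : P.IsTarget K c cm w X) (hm : 1 ≤ m) (hq : 0 < P.q)
    {t : ℝ} (ht : 0 ≤ t) :
    HasDerivWithinAt (fun t => evP m (yPoly c m) fun j => P.topDt K c cm w X j t)
      (-evP m (yPoly c (m - 1)) (fun j => P.topDt K c cm w X j t)
        - cm * evP m (yPoly c m) (fun j => P.topDt K c cm w X j t)
        + P.distG K (fun x => w 0 x t) (X t)) (Ici 0) t := by
  obtain ⟨k, rfl⟩ : ∃ k, m = k + 1 := ⟨m - 1, by omega⟩
  refine (hasDerivWithinAt_evP (fun j hj => h.hasDerivWithinAt_topDt hq hj ht) _).congr_deriv ?_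
  have e1 : P.topDt K c cm w X (k + 1) t = P.distG K (fun x => w 0 x t) (X t)
      - ∑ i ∈ Finset.range (k + 1), (alpha (k + 1) c i + cm * beta (k + 1) c i)
        * (P.q ^ i * w (2 * i) 1 t) := by
    rw [topDt, if_neg (lt_irrefl _)]
  have e2 : evP (k + 1) (Polynomial.X * yPoly c (k + 1)) (fun j => P.topDt K c cm w X j t)
      = evP (k + 1) (Polynomial.X * tau c k) fun j => P.topDt K c cm w X j t := by
    rw [yPoly, mul_add, evP_add, ← pow_succ']
    have : evP (k + 1) (Polynomial.X ^ (k + 1)) (fun j => P.topDt K c cm w X j t) = 0 := by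
      refine Finset.sum_eq_zero fun j hj => ?_
      rw [Polynomial.coeff_X_pow, if_neg (Finset.mem_range.1 hj).ne, zero_mul]
    rw [this, zero_add]
  rw [yPoly_coeff c k k le_rfl, if_pos rfl, e1, e2, sum_mul_topDt (K := K) w X t,
    add_tsub_cancel_right, evP_add]
  ring

/-- A boundary value that is zero for all times has zero time derivative, and by the heat equation
that is q times the trace two orders higher. -/
theorem left_even (h : P.IsTarget K c cm w X) (hq : 0 < P.q) {k : ℕ} (hk : k < m) {t : ℝ}
    (ht : 0 ≤ t) : w (2 * k) 0 t = 0 := by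
  induction k generalizing t with
  | zero => exact h.left t ht
  | succ k ih =>
    have d := h.jet.time hq (i := 2 * k) (by omega) ht (x := 0) (by simp)
    have d0 : HasDerivWithinAt (w (2 * k) 0) 0 (Ici 0) t :=
      (hasDerivWithinAt_const t (Ici 0) (0 : ℝ)).congr (fun s hs => ih (by omega) hs)
        (ih (by omega) ht)
    have e := (uniqueDiffOn_Ici (0 : ℝ) t ht).eq_deriv _ d d0
    exact (mul_eq_zero.1 e).resolve_left hq.ne'

/-- The bounds on the initial data of the target system that are used below. -/
structure InitialBound (m : ℕ) (w : ℕ → ℝ → ℝ → ℝ) (X : ℝ → Fin n → ℝ) (M : ℝ) : Prop where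
  nonneg : 0 ≤ M
  jet : ∀ i < 2 * m, ∀ x ∈ Icc (0 : ℝ) 1, |w i x 0| ≤ M
  state : ‖X 0‖ ≤ M

/-- The barrier that vanishes at x = 0 needs initial data vanishing linearly there; the mean value
inequality provides this. -/
theorem abs_initial_le_mul (h : P.IsTarget K c cm w X) (hq : 0 < P.q) {M : ℝ}
    (hM : InitialBound m w X M) {k : ℕ} (hk : k < m) {x : ℝ} (hx : x ∈ Icc (0 : ℝ) 1) :
    |w (2 * k) x 0| ≤ M * x := by
  have := h.jet.abs_sub_le (i := 2 * k) (by omega) le_rfl (hM.jet (2 * k + 1) (by omega)) hx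
    (y := 0) (by simp)
  rwa [h.left_even hq hk le_rfl, sub_zero, sub_zero, abs_of_nonneg hx.1] at this

theorem abs_initial_sub_le_mul (h : P.IsTarget K c cm w X) {M : ℝ}
    (hM : InitialBound m w X M) {k : ℕ} (hk : k < m) {x : ℝ} (hx : x ∈ Icc (0 : ℝ) 1) :
    |w (2 * k) x 0 - w (2 * k) 1 0| ≤ M * (1 - x) := by
  have := h.jet.abs_sub_le (i := 2 * k) (by omega) le_rfl (hM.jet (2 * k + 1) (by omega)) hx
    (y := 1) (by simp)
  rwa [abs_sub_comm x, abs_of_nonneg (sub_nonneg.2 hx.2)] at this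

/-- The perturbation is controlled by the initial data and the values `w(1,t)`. -/
theorem abs_distG_le {lam CX CG : ℝ} (hm : 1 ≤ m) (hq : 0 < P.q) (hlam : 0 < lam)
    (hlq : lam ≤ P.q) (hCX : 0 ≤ CX)
    (hX : ∀ (X g : ℝ → Fin n → ℝ) (N T : ℝ),
      (∀ t, 0 ≤ t → HasDerivWithinAt X (P.AK K *ᵥ X t + g t) (Ici 0) t) →
      (∀ t ∈ Icc 0 T, ‖g t‖ ≤ N * Real.exp (-lam * t)) →
      ∀ t ∈ Icc 0 T, ‖X t‖ ≤ CX * (‖X 0‖ + N) * Real.exp (-lam * t))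
    (hG : ∀ (w : ℝ → ℝ) (ξ : Fin n → ℝ) (S : ℝ),
      (∀ x ∈ Icc (0 : ℝ) 1, |w x| ≤ S) → ‖ξ‖ ≤ S → |P.distG K w ξ| ≤ CG * S)
    (h : P.IsTarget K c cm w X) {M S T : ℝ} (hM : InitialBound m w X M) (hMS : M ≤ S)
    (h1 : ∀ t ∈ Icc 0 T, |w 0 1 t| ≤ S * Real.exp (-lam * t)) {t : ℝ} (ht : t ∈ Icc 0 T) :
    |P.distG K (fun x => w 0 x t) (X t)|
      ≤ CG * (1 + CX * (1 + 2 * ‖P.B‖)) * S * Real.exp (-lam * t) := by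
  have hS : 0 ≤ S := hM.nonneg.trans hMS
  have hini : ∀ x ∈ Icc (0 : ℝ) 1, |w 0 x 0| ≤ S * x := fun x hx =>
    (h.abs_initial_le_mul hq hM (k := 0) (by omega) hx).trans
      (mul_le_mul_of_nonneg_right hMS hx.1)
  have hB := norm_nonneg P.B
  set b := ‖P.B‖ with hb
  have hE : ∀ t, 0 ≤ S * Real.exp (-lam * t) := fun t => by positivity
  rw [mul_assoc, mul_assoc]
  refine hG _ _ _ (fun x hx => ?_) ?_
  · have e := h.jet.abs_le_of_boundary hq hlam hlq hS (i := 0) (by omega) h.left h1 hini hx ht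
    have e2 : 0 ≤ CX * (1 + 2 * b) * (S * Real.exp (-lam * t)) := by have := hE t; positivity
    nlinarith [mul_nonneg (hE t) (sq_nonneg (1 - x))]
  -- The forcing of X is w_x(0,t)B, and the barrier bounds its norm by 2S‖B‖e^{-λt}.
  · have e := hX X (fun t => w 1 0 t • P.B) (2 * S * b) T h.odeX (fun s hs => ?_) t ht
    · refine e.trans ?_
      have e3 : ‖X 0‖ + 2 * S * b ≤ (1 + 2 * b) * S := by
        have := hM.state
        nlinarith
      have e4 : CX * (‖X 0‖ + 2 * S * b) ≤ CX * ((1 + 2 * b) * S) :=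
        mul_le_mul_of_nonneg_left e3 hCX
      have e5 := mul_le_mul_of_nonneg_right e4 (Real.exp_nonneg (-lam * t))
      have := hE t
      linarith
    · have e := h.jet.abs_deriv_zero_le hq hlam hlq hS (i := 0) (by omega) h.left h1 hini hs
      rw [norm_smul, Real.norm_eq_abs]
      refine (mul_le_mul_of_nonneg_right e hB).trans (le_of_eq (by ring))

/-- The closing of the loop between the chain of integrators and the target system. -/
theorem sum_sq_yPoly_le {lam C V M : ℝ} (hm : 1 ≤ m) (hq : 0 < P.q) (hlam : 0 < lam)
    (hcm : 3 * lam ≤ cm) (hC : 4 * C ^ 2 ≤ lam * cm)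
    (hc : ∀ i, i + 1 < m → 3 * lam ≤ 2 * c (i + 1))
    (h : P.IsTarget K c cm w X) (hM : 0 ≤ M)
    (hG : ∀ S T, M ≤ S → (∀ t ∈ Icc 0 T, |w 0 1 t| ≤ S * Real.exp (-lam * t)) →
      ∀ t ∈ Icc 0 T, |P.distG K (fun x => w 0 x t) (X t)| ≤ C * S * Real.exp (-lam * t))
    (hV : ∑ i ∈ Finset.range m, evP m (yPoly c (i + 1)) (fun j => P.topDt K c cm w X j 0) ^ 2
      ≤ V * M ^ 2) {t : ℝ} (ht : 0 ≤ t) :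
    ∑ i ∈ Finset.range m, evP m (yPoly c (i + 1)) (fun j => P.topDt K c cm w X j t) ^ 2
      ≤ (2 * V + 1) * M ^ 2 * Real.exp (-lam * t) ^ 2 := by
  set y : ℕ → ℝ → ℝ := fun i t => evP m (yPoly c i) fun j => P.topDt K c cm w X j t with hy
  have hy1 : ∀ t, y 1 t = w 0 1 t := by
    intro t
    simp only [hy, yPoly, tau, evP, add_zero, pow_zero, Polynomial.coeff_one]
    rw [Finset.sum_eq_single_of_mem 0 (Finset.mem_range.2 (by omega)) (fun j _ hj => by simp [hj])]
    rw [topDt, if_pos (show 0 < m by omega)]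
    simp
  have hcont : Continuous (w 0 1) := continuous_uncurry_left (h.jet.cont 0 (by omega)) 1
  -- Y, the weighted maximum of |w(1,·)| on [0,t], is the unknown of the small-gain inequality.
  obtain ⟨s, hs, hmax⟩ := isCompact_Icc.exists_isMaxOn (nonempty_Icc.2 ht)
    (f := fun s => |w 0 1 s| * Real.exp (lam * s)) (by fun_prop)
  set Y := |w 0 1 s| * Real.exp (lam * s) with hYdef
  have hY : 0 ≤ Y := by positivity
  have hexp : ∀ r, Real.exp (lam * r) * Real.exp (-lam * r) = 1 := fun r => by
    rw [← Real.exp_add]; simp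
  have hb : ∀ r ∈ Icc 0 t, |w 0 1 r| ≤ (M + Y) * Real.exp (-lam * r) := by
    intro r hr
    have h1 : |w 0 1 r| * Real.exp (lam * r) ≤ Y := hmax hr
    have h2 := mul_le_mul_of_nonneg_right h1 (Real.exp_nonneg (-lam * r))
    rw [mul_assoc, hexp, mul_one] at h2
    nlinarith [Real.exp_nonneg (-lam * r)]
  have hcm0 : 0 < cm := by linarith
  -- With 4C² ≤ λ c_m the perturbation contributes at most (M + Y)²/4.
  have hN : (C * (M + Y)) ^ 2 / (lam * cm) ≤ (M ^ 2 + Y ^ 2) / 2 := by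
    rw [div_le_iff₀ (by positivity)]
    have h1 : (M + Y) ^ 2 ≤ 2 * (M ^ 2 + Y ^ 2) := by nlinarith [sq_nonneg (M - Y)]
    have h2 := mul_le_mul hC h1 (sq_nonneg _) (by positivity)
    nlinarith
  have key : ∀ r ∈ Icc 0 t, ∑ i ∈ Finset.range m, y (i + 1) r ^ 2
      ≤ (V * M ^ 2 + (M ^ 2 + Y ^ 2) / 2) * Real.exp (-lam * r) ^ 2 := by
    intro r hr
    have hch := sum_sq_le_of_chain (k := m - 1) (c := c) (cm := cm) (lam := lam)
      (N := C * (M + Y)) (T := t) (y := y) (G := fun t => P.distG K (fun x => w 0 x t) (X t))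
      hlam hcm (fun i hi => hc i (by omega)) (fun t => by simp [hy, yPoly, evP])
      (fun i hi t ht => h.hasDerivWithinAt_yPoly hq (by omega) ht)
      (fun t ht => by
        rw [Nat.sub_add_cancel hm]; exact h.hasDerivWithinAt_yPoly_top hm hq ht)
      (hG _ _ (by linarith) hb) hr
    rw [Nat.sub_add_cancel hm] at hch
    refine hch.trans (mul_le_mul_of_nonneg_right (add_le_add hV hN) (sq_nonneg _))
  -- Since y_1 = w(1,·), evaluation at the maximizer bounds Y² by half of itself plus initial data,
  -- so Y² ≤ (2V + 1)M².
  have hY2 : Y ^ 2 ≤ V * M ^ 2 + (M ^ 2 + Y ^ 2) / 2 := by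
    have h1 : y 1 s ^ 2 ≤ ∑ i ∈ Finset.range m, y (i + 1) s ^ 2 :=
      Finset.single_le_sum (f := fun i => y (i + 1) s ^ 2) (fun i _ => sq_nonneg _)
        (Finset.mem_range.2 hm)
    have h2 := mul_le_mul_of_nonneg_right (h1.trans (key s hs)) (sq_nonneg (Real.exp (lam * s)))
    rw [hy1, ← sq_abs, ← mul_pow, mul_assoc, ← mul_pow, mul_comm (Real.exp (-lam * s)), hexp,
      one_pow, mul_one] at h2
    exact h2
  refine (key t ⟨ht, le_rfl⟩).trans (mul_le_mul_of_nonneg_right ?_ (sq_nonneg _))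
  linarith

theorem inv_pow_mul_topDt (hq : 0 < P.q) {k : ℕ} (hk : k < m) (t : ℝ) :
    P.q⁻¹ ^ k * P.topDt K c cm w X k t = w (2 * k) 1 t := by
  rw [topDt, if_pos hk, inv_pow, inv_mul_cancel_left₀ (pow_pos hq k).ne']

/-- All traces of the target system decay if the time derivatives of `w(1,t)` do. -/
theorem abs_traces_le {lam D R M T : ℝ} (hq : 0 < P.q) (hlam : 0 < lam) (hlq : lam ≤ P.q)
    (h : P.IsTarget K c cm w X) (hM : InitialBound m w X M) (hR : 1 ≤ R)
    (hRD : ∀ k < m, P.q⁻¹ ^ k * D ≤ R) (hRD' : ∀ k < m, P.q⁻¹ ^ (k + 1) * D ≤ R)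
    (hη : ∀ k ≤ m, ∀ t ∈ Icc 0 T, |P.topDt K c cm w X k t| ≤ D * M * Real.exp (-lam * t))
    {t : ℝ} (ht : t ∈ Icc 0 T) {k : ℕ} (hk : k < 2 * m) :
    |w k 0 t| ≤ 2 * R * M * Real.exp (-lam * t) ∧ |w k 1 t| ≤ 2 * R * M * Real.exp (-lam * t) := by
  have hM0 := hM.nonneg
  have hRM : 0 ≤ R * M := mul_nonneg (zero_le_one.trans hR) hM0
  have hMR : M ≤ R * M := by nlinarith
  have h1 : ∀ k < m, ∀ t ∈ Icc 0 T, |w (2 * k) 1 t| ≤ R * M * Real.exp (-lam * t) := by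
    intro k hk t ht
    rw [← inv_pow_mul_topDt (w := w) (K := K) (c := c) (cm := cm) (X := X) hq hk t, abs_mul,
      abs_of_nonneg (by positivity)]
    have e := mul_le_mul_of_nonneg_left (hη k hk.le t ht) (by positivity : 0 ≤ P.q⁻¹ ^ k)
    have e2 := mul_le_mul_of_nonneg_right (hRD k hk)
      (by positivity : 0 ≤ M * Real.exp (-lam * t))
    linarith
  have hE : 0 ≤ R * M * Real.exp (-lam * t) := by positivity
  obtain ⟨k, rfl | rfl⟩ := k.even_or_odd'
  · have hk' : k < m := by omega
    rw [h.left_even hq hk' ht.1, abs_zero]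
    have := h1 k hk' t ht
    constructor <;> linarith
  · have hk' : k < m := by omega
    have hl : ∀ t, 0 ≤ t → w (2 * k) 0 t = 0 := fun t ht => h.left_even hq hk' ht
    rw [mul_assoc 2 R M]
    constructor
    · exact h.jet.abs_deriv_zero_le hq hlam hlq hRM (by omega) hl (h1 k hk')
        (fun x hx => (h.abs_initial_le_mul hq hM hk' hx).trans
          (mul_le_mul_of_nonneg_right hMR hx.1)) ht
    -- This needs the time derivative of w_{2k}(1,t); for k = m - 1 it is `topDt` of order m, which
    -- is why `hη` includes k = m.
    · refine h.jet.abs_deriv_one_le hq hlam hlq hRM (by omega) hl (h1 k hk')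
        (η := fun t => (P.q⁻¹) ^ k * P.topDt K c cm w X (k + 1) t) (fun t ht => ?_)
        (fun t ht => ?_) (fun x hx => (h.abs_initial_sub_le_mul hM hk' hx).trans
          (mul_le_mul_of_nonneg_right hMR (sub_nonneg.2 hx.2))) ht
      · refine ((h.hasDerivWithinAt_topDt hq hk' ht).const_mul _).congr (fun s _ => ?_) ?_ <;>
          exact (inv_pow_mul_topDt hq hk' _).symm
      · rw [abs_mul, abs_of_nonneg (by positivity)]
        have e := mul_le_mul_of_nonneg_left (hη (k + 1) hk' t ht)
          (by positivity : 0 ≤ P.q⁻¹ ^ k)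
        have e2 := mul_le_mul_of_nonneg_right (hRD' k hk')
          (by positivity : 0 ≤ P.q * (M * Real.exp (-lam * t)))
        have e3 : P.q⁻¹ ^ (k + 1) * D * (P.q * (M * Real.exp (-lam * t)))
            = P.q⁻¹ ^ k * (D * M * Real.exp (-lam * t)) := by
          rw [pow_succ]; field_simp
        linarith

end IsTarget

theorem exists_pos_forall_three_mul_le (m : ℕ) (c : ℕ → ℝ) (hc : ∀ i, 1 ≤ i → i < m → 0 < c i) :
    ∃ δ : ℝ, 0 < δ ∧ ∀ i, i + 1 < m → 3 * δ ≤ 2 * c (i + 1) := by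
  -- The element `none`, with value 1, makes the minimum exist also for m = 1, when there are no
  -- gains.
  have hf : (Finset.insertNone (Finset.range (m - 1))).Nonempty := ⟨none, by simp⟩
  obtain ⟨a, ha, hmin⟩ := Finset.exists_min_image _
    (fun o : Option ℕ => o.elim 1 fun i => 2 * c (i + 1) / 3) hf
  refine ⟨a.elim 1 fun i => 2 * c (i + 1) / 3, ?_, fun i hi => ?_⟩
  · match a, ha with
    | none, _ => simp
    | some i, ha =>
      have hi := Finset.mem_range.1 (Finset.some_mem_insertNone.1 ha)
      have := hc (i + 1) (by omega) (by omega)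
      simp only [Option.elim]
      positivity
  · have := hmin (some i) (Finset.some_mem_insertNone.2 (Finset.mem_range.2 (by omega)))
    simp only [Option.elim] at this ⊢
    linarith

/-- Exponential decay of the boundary traces of the target system. -/
theorem exists_decay (P : Plant n m) (K : Fin n → ℝ) (hm : 1 ≤ m) (hq : 0 < P.q)
    (hK : IsHurwitz (P.AK K)) (c : ℕ → ℝ) (hc : ∀ i, 1 ≤ i → i < m → 0 < c i) :
    ∃ cstar : ℝ, 0 < cstar ∧ ∀ cm : ℝ, cstar < cm → ∃ lam : ℝ, 0 < lam ∧ ∃ C : ℝ, 0 ≤ C ∧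
      ∀ (w : ℕ → ℝ → ℝ → ℝ) (X : ℝ → Fin n → ℝ), P.IsTarget K c cm w X →
        ∀ M : ℝ, IsTarget.InitialBound m w X M → ∀ t : ℝ, 0 ≤ t → ∀ k < 2 * m,
          |w k 0 t| ≤ C * M * Real.exp (-lam * t) ∧ |w k 1 t| ≤ C * M * Real.exp (-lam * t) := by
  obtain ⟨δ, hδ, hcδ⟩ := exists_pos_forall_three_mul_le m c hc
  obtain ⟨mu, hmu, hH⟩ := exists_bound_of_isHurwitz hK
  -- λ is fixed before c_m: below the stability margin of A + BK, at most q for the barriers, at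
  -- most δ for the damping of the chain.
  obtain ⟨lam, hlam, hlmu, hlq, hlδ⟩ : ∃ lam : ℝ, 0 < lam ∧ lam < mu ∧ lam ≤ P.q ∧ lam ≤ δ :=
    ⟨min (mu / 2) (min P.q δ), by positivity,
      (min_le_left _ _).trans_lt (by linarith), (min_le_right _ _).trans (min_le_left _ _),
      (min_le_right _ _).trans (min_le_right _ _)⟩
  obtain ⟨CX, hCX, hX⟩ := hH lam hlmu
  obtain ⟨CG, hCG, hG⟩ := P.isLowerOrder_distG K
  obtain ⟨Cy, hCy, hη⟩ := exists_bound_of_yPoly m c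
  obtain ⟨C, hC⟩ : ∃ x, x = CG * (1 + CX * (1 + 2 * ‖P.B‖)) := ⟨_, rfl⟩
  have hC0 : 0 ≤ C := by rw [hC]; positivity
  -- The first summand serves the Lyapunov estimate, the second the small-gain condition.
  refine ⟨3 * lam + 4 * C ^ 2 / lam + 1, by positivity, fun cm hcm => ⟨lam, hlam, ?_⟩⟩
  have h4 : 0 ≤ 4 * C ^ 2 / lam := by positivity
  have hcm3 : 3 * lam ≤ cm := by linarith
  have hCcm : 4 * C ^ 2 ≤ lam * cm := by
    have : 4 * C ^ 2 / lam ≤ cm := by linarith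
    rwa [div_le_iff₀' hlam] at this
  obtain ⟨Q, hQ⟩ : ∃ x, x = ∑ j ∈ Finset.range m, P.q ^ j := ⟨_, rfl⟩
  have hQ0 : 0 ≤ Q := hQ ▸ Finset.sum_nonneg fun _ _ => by positivity
  obtain ⟨V, hV⟩ : ∃ x, x = ∑ i ∈ Finset.range m,
    ((∑ j ∈ Finset.range m, |(yPoly c (i + 1)).coeff j|) * Q) ^ 2 := ⟨_, rfl⟩
  have hV0 : 0 ≤ V := hV ▸ Finset.sum_nonneg fun _ _ => sq_nonneg _
  obtain ⟨D₀, hD₀⟩ : ∃ x, x = Cy * (2 * V + 1) := ⟨_, rfl⟩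
  have hD₀0 : 0 ≤ D₀ := by rw [hD₀]; positivity
  obtain ⟨L, hL⟩ : ∃ x, x = ∑ i ∈ Finset.range m, |alpha m c i + cm * beta m c i| := ⟨_, rfl⟩
  have hL0 : 0 ≤ L := hL ▸ Finset.sum_nonneg fun _ _ => abs_nonneg _
  -- D bounds all orders up to m: D₀ for those below m; at order m the perturbation gives C(1 + D₀)
  -- and the feedback sum L D₀.
  obtain ⟨D, hD⟩ : ∃ x, x = D₀ + C * (1 + D₀) + L * D₀ := ⟨_, rfl⟩
  have hD0 : 0 ≤ D := by rw [hD]; positivity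
  obtain ⟨R, hR⟩ : ∃ x, x = 1 + ∑ k ∈ Finset.range (m + 1), P.q⁻¹ ^ k * D := ⟨_, rfl⟩
  have hRs : ∀ k < m + 1, P.q⁻¹ ^ k * D ≤ R := fun k hk => by
    have := Finset.single_le_sum (f := fun k => P.q⁻¹ ^ k * D)
      (fun i _ => by positivity) (Finset.mem_range.2 hk)
    simp only [hR]
    linarith
  have hR1 : 1 ≤ R := by
    have : 0 ≤ ∑ k ∈ Finset.range (m + 1), P.q⁻¹ ^ k * D :=
      Finset.sum_nonneg fun i _ => by positivity
    linarith
  refine ⟨2 * R, by linarith, fun w X h M hM t ht k hk => ?_⟩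
  have hM0 := hM.nonneg
  have hG' : ∀ S T, M ≤ S → (∀ t ∈ Icc 0 T, |w 0 1 t| ≤ S * Real.exp (-lam * t)) →
      ∀ t ∈ Icc 0 T, |P.distG K (fun x => w 0 x t) (X t)| ≤ C * S * Real.exp (-lam * t) :=
    fun S T hMS h1 t ht => hC ▸ h.abs_distG_le hm hq hlam hlq hCX hX hG hM hMS h1 ht
  have hVini : ∑ i ∈ Finset.range m,
      evP m (yPoly c (i + 1)) (fun j => P.topDt K c cm w X j 0) ^ 2 ≤ V * M ^ 2 := by
    rw [hV, Finset.sum_mul]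
    refine Finset.sum_le_sum fun i _ => ?_
    rw [← mul_pow, mul_assoc]
    refine sq_le_sq' ?_ ?_ <;>
    · have := abs_evP_le (yPoly c (i + 1)) (η := fun j => P.topDt K c cm w X j 0) (S := Q * M)
        fun j hj => by
          rw [topDt, if_pos hj, abs_mul, abs_of_nonneg (by positivity)]
          exact mul_le_mul (hQ ▸ Finset.single_le_sum (f := fun j => P.q ^ j)
            (fun i _ => by positivity) (Finset.mem_range.2 hj))
            (hM.jet _ (by omega) 1 (by simp)) (abs_nonneg _) hQ0
      have := abs_le.1 this
      linarith [this.1, this.2]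
  have hη₀ : ∀ t, 0 ≤ t → ∀ j < m, |P.topDt K c cm w X j t| ≤ D₀ * M * Real.exp (-lam * t) := by
    intro t ht j hj
    have hE := Real.exp_nonneg (-lam * t)
    have hsum := h.sum_sq_yPoly_le hm hq hlam hcm3 hCcm
      (fun i hi => (by linarith [hcδ i hi])) hM0 hG' hVini ht
    have := hη (fun j => P.topDt K c cm w X j t) ((2 * V + 1) * (M * Real.exp (-lam * t)))
      (by positivity) (fun i hi => ?_) j hj
    · exact this.trans (le_of_eq (by rw [hD₀]; ring))
    · refine abs_le_of_sq_le_sq ?_ (by positivity)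
      refine ((Finset.single_le_sum (f := fun i =>
        evP m (yPoly c (i + 1)) (fun j => P.topDt K c cm w X j t) ^ 2)
        (fun i _ => sq_nonneg _) (Finset.mem_range.2 hi)).trans hsum).trans ?_
      have : (2 * V + 1) * (M * Real.exp (-lam * t)) ^ 2
          ≤ (2 * V + 1) ^ 2 * (M * Real.exp (-lam * t)) ^ 2 :=
        mul_le_mul_of_nonneg_right (by nlinarith) (sq_nonneg _)
      linarith [mul_pow M (Real.exp (-lam * t)) 2, mul_pow (2 * V + 1) (M * Real.exp (-lam * t)) 2]
  refine h.abs_traces_le (T := t) hq hlam hlq hM hR1 (D := D) (fun k hk => hRs k (by omega))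
    (fun k hk => hRs _ (by omega)) (fun k hk s hs => ?_) ⟨ht, le_rfl⟩ hk
  have hE : 0 ≤ M * Real.exp (-lam * s) := by positivity
  rcases hk.lt_or_eq with hk | rfl
  · refine (hη₀ s hs.1 k hk).trans ?_
    have : D₀ * (M * Real.exp (-lam * s)) ≤ D * (M * Real.exp (-lam * s)) :=
      mul_le_mul_of_nonneg_right (by simp only [hD]; nlinarith [mul_nonneg hL0 hD₀0]) hE
    linarith
  · have e1 := hG' ((1 + D₀) * M) t (by nlinarith) (fun r hr => by
      have := hη₀ r hr.1 0 (by omega)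
      rw [topDt, if_pos (by omega), pow_zero, one_mul, mul_zero] at this
      nlinarith [mul_nonneg hM0 (Real.exp_nonneg (-lam * r))]) s hs
    have e2 : |∑ i ∈ Finset.range k, (alpha k c i + cm * beta k c i)
        * (P.q ^ i * w (2 * i) 1 s)| ≤ L * (D₀ * M * Real.exp (-lam * s)) := by
      rw [hL, Finset.sum_mul]
      refine (Finset.abs_sum_le_sum_abs _ _).trans (Finset.sum_le_sum fun i hi => ?_)
      have := hη₀ s hs.1 i (Finset.mem_range.1 hi)
      rw [topDt, if_pos (Finset.mem_range.1 hi)] at this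
      rw [abs_mul]
      exact mul_le_mul_of_nonneg_left this (abs_nonneg _)
    rw [topDt, if_neg (lt_irrefl _)]
    refine (abs_sub _ _).trans ((add_le_add e1 e2).trans ?_)
    have : 0 ≤ D₀ * (M * Real.exp (-lam * s)) := mul_nonneg hD₀0 hE
    simp only [hD]
    linarith

/-! ### Dependence on the initial data -/

variable {P : Plant n m} {K : Fin n → ℝ} {c : ℕ → ℝ} {cm : ℝ} {u : ℝ → ℝ → ℝ}
  {X : ℝ → Fin n → ℝ} {Z : ℝ → Fin m → ℝ} {U : ℝ → ℝ}

/-- Derivatives within [0,1] see only values on [0,1], so the jet of w at time 0 is a function of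
the data. The final constant can therefore be chosen before the solution. -/
theorem wJet_initial {u₀ : ℝ → ℝ} {X₀ : Fin n → ℝ} (hu : ∀ x ∈ Icc (0 : ℝ) 1, u x 0 = u₀ x)
    (hX : X 0 = X₀) (k : ℕ) (x : ℝ) :
    P.wJet K (uJet u) (fun t => X (max t 0)) k x 0
      = P.wJet K (uJet fun x _ => u₀ x) (fun _ => X₀) k x 0 := by
  have e : ∀ i x, uJet u i x 0 = uJet (fun x _ => u₀ x) i x 0 := fun i x => by
    simp only [uJet, dx, max_self]
    exact iteratedDerivWithin_congr hu (clamp_mem x)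
  simp only [wJet, transJet, e, max_self, hX]

theorem IsClosedLoopSolution.exists_initialBound (hm : 1 ≤ m) (hq : 0 < P.q)
    (h : P.IsClosedLoopSolution K c cm u X Z U) :
    ∃ M, IsTarget.InitialBound m (P.wJet K (uJet u) fun t => X (max t 0))
      (fun t => X (max t 0)) M := by
  have hb : ∀ i : Fin (2 * m), ∃ M, ∀ x ∈ Icc (0 : ℝ) 1,
      |P.wJet K (uJet u) (fun t => X (max t 0)) i x 0| ≤ M := fun i =>
    isCompact_Icc.exists_bound_of_continuousOn
      (continuous_uncurry_right ((h.isTarget hm hq).jet.cont i (by omega)) 0).continuousOn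
  choose b hb using hb
  have hs : ∀ i, |b i| ≤ ∑ i, |b i| := fun i =>
    Finset.single_le_sum (f := fun i => |b i|) (fun _ _ => abs_nonneg _) (Finset.mem_univ i)
  have h0 : 0 ≤ ∑ i, |b i| := Finset.sum_nonneg fun _ _ => abs_nonneg _
  refine ⟨(∑ i, |b i|) + ‖X (max 0 0)‖, by positivity, fun i hi x hx => ?_, ?_⟩
  · have := (hb ⟨i, hi⟩ x hx).trans ((le_abs_self _).trans (hs ⟨i, hi⟩))
    linarith [norm_nonneg (X (max 0 0))]
  · simpa using h0

end Plant

end Sandwich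

end

theorem mainTheorem4 (n m : ℕ) (hm : 1 ≤ m) (P : Sandwich.Plant n m) (hq : 0 < P.q)
    (K : Fin n → ℝ) (hK : Sandwich.IsHurwitz (P.AK K))
    (c : ℕ → ℝ) (hc : ∀ i, 1 ≤ i → i < m → 0 < c i) :
    ∃ cstar : ℝ, 0 < cstar ∧ ∀ cm : ℝ, cstar < cm →
      ∃ lam : ℝ, 0 < lam ∧
        ∀ (u₀ : ℝ → ℝ) (X₀ : Fin n → ℝ) (Z₀ : Fin m → ℝ),
          ∃ Ups : ℝ, 0 < Ups ∧
            ∀ (u : ℝ → ℝ → ℝ) (X : ℝ → Fin n → ℝ) (Z : ℝ → Fin m → ℝ) (U : ℝ → ℝ),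
              P.IsClosedLoopSolution K c cm u X Z U →
              (∀ x ∈ Set.Icc (0 : ℝ) 1, u x 0 = u₀ x) → X 0 = X₀ → Z 0 = Z₀ →
              ∀ t : ℝ, 0 ≤ t → |U t| ≤ Ups ∧ |U t| ≤ Ups * Real.exp (-lam * t) := by
  obtain ⟨cstar, hcs, H⟩ := P.exists_decay K hm hq hK c hc
  refine ⟨cstar, hcs, fun cm hcm => ?_⟩
  obtain ⟨lam, hlam, C, hC, hdecay⟩ := H cm hcm
  obtain ⟨CL, hCL, hL⟩ := P.isBoundedOn_jetL K hm c cm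
  obtain ⟨CC, hCC, hCb⟩ := P.isBoundedOn_jetC K hm
  refine ⟨lam, hlam, fun u₀ X₀ Z₀ => ?_⟩
  -- Data whose jet has no such bound belong to no solution, by `exists_initialBound`, and any
  -- constant serves for them.
  by_cases hex : ∃ M, Sandwich.Plant.IsTarget.InitialBound m
      (P.wJet K (Sandwich.uJet fun x _ => u₀ x) fun _ => X₀) (fun _ => X₀) M
  · obtain ⟨M, hM⟩ := hex
    have hM0 := hM.nonneg
    -- The summand 1 only makes the constant positive.
    refine ⟨(CL + CC) * (C * M) + 1, by positivity, fun u X Z U h hu hX _ t ht => ?_⟩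
    have hini : Sandwich.Plant.IsTarget.InitialBound m
        (P.wJet K (Sandwich.uJet u) fun t => X (max t 0)) (fun t => X (max t 0)) M :=
      ⟨hM0, fun i hi x hx => by
        rw [Sandwich.Plant.wJet_initial hu hX]; exact hM.jet i hi x hx,
        by simpa [hX] using hM.state⟩
    have hw := hdecay _ _ (h.isTarget hm hq) M hini t ht
    have e1 := hL _ _ fun k hk => (hw k hk).2
    have e2 := hCb _ _ fun k hk => (hw k hk).1
    have e3 : |U t| ≤ ((CL + CC) * (C * M) + 1) * Real.exp (-lam * t) := by
      rw [h.control_eq hm ht]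
      refine (abs_sub _ _).trans ((add_le_add e1 e2).trans ?_)
      nlinarith [Real.exp_nonneg (-lam * t)]
    refine ⟨e3.trans (mul_le_of_le_one_right (by positivity) ?_), e3⟩
    exact Real.exp_le_one_iff.2 (by nlinarith)
  · refine ⟨1, one_pos, fun u X Z U h hu hX _ => (hex ?_).elim⟩
    obtain ⟨M, hM⟩ := h.exists_initialBound hm hq
    exact ⟨M, hM.nonneg, fun i hi x hx => by
      rw [← Sandwich.Plant.wJet_initial hu hX]; exact hM.jet i hi x hx,
      by simpa [hX] using hM.state⟩
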